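/- **Conventions.** For a nilpotent, connected, simply connected Lie group $G$ with Lie algebra $\mathfrak g$, with an inner product on $\mathfrak g$, identify $i\mathfrak g^*$ with the real dual, so that $e^{2\pi\zeta(X)}$ means $e^{2\pi i\lambda(X)}$ for $\zeta=i\lambda$; $i\mathfrak g^*$ carries the dual norm, $dX$ is the Lebesgue measure of the inner product, and $\langle x\rangle=(1+x^2)^{1/2}$. For $\zeta\in i\mathfrak g^*$ and a polarizing subalgebra $\mathfrak m$ (a subalgebra that is a maximal isotropic subspace for $B_\zeta(X,Y)=\zeta([X,Y])$), let $M=\exp\mathfrak m$ and $\sigma_\zeta=\operatorname{Ind}_M^G(\chi_\zeta)$, $\chi_\zeta(\exp Y)=e^{2\pi\zeta(Y)}$, acting by right translation on the space $\mathcal H_\zeta$ of measurable $f:G\to\mathbb C$ with $f(mg)=\chi_\zeta(m)f(g)$ and $\int_{M\backslash G}|f|^2<\infty$; $\mathcal H_\zeta^\infty$ is the space of smooth vectors. Fix a strong Malcev basis $X_1,\dots,X_n$ of $\mathfrak g$ (all $\mathfrak g_j=\operatorname{span}(X_1,\dots,X_j)$ are ideals). The orbit type of $\zeta$ is $d=(d_0,\dots,d_n)$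 with $d_j$ the dimension of the $G$-orbit of $\zeta|_{\mathfrak g_j}$ in $i\mathfrak g_j^*$, and $U_d$ is the set of all $\zeta$ of type $d$. For $\zeta\in U_d$, $\mathcal H_\zeta$ is identified with $L^2(\mathbb R^{d_n/2})$ by restricting $f$ to the section $t\mapsto\exp(t_1X_{j_1})\cdots\exp(t_kX_{j_k})$ of $G\to M\backslash G$, where $j_1<\dots<j_k$ are the indices with $X_j\notin\mathfrak m+\mathfrak g_{j-1}$. A family of polarizing subalgebras is called measurable if the orthogonal projections onto its members depend measurably on $\zeta$. For metric Lie algebras write $\mathfrak g\prec\mathfrak n$ if $\mathfrak g$ arises from $\mathfrak n$ by finitely many (possibly zero) steps, each of which passes either from $\mathfrak h$ to the quotient $\mathfrak h/\mathbb RZ$ by a nonzero central element $Z$, or, if the center of $\mathfrak h$ is a line $\mathbb RZ$ with $Z\neq0$ and $[X,Y]=Z$, to the centralizer $\mathfrak h_0$ of $Y$ when $\mathfrak h=\mathbb RX\oplus\mathfrak h_0$; the inner product is always the inherited one. **Proposition.** Let $\mathfrak n$ be a finite-dimensional real nilpotent Lie algebra with a fixed inner product. Let $0<\delta<1$ be such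 that $|\sin(2\pi x)|\le 2^{-3\dim\mathfrak n}$ for all $|x|<\delta$, and let $c>0$ and $R>0$ be constants. Then for every $n\le\dim\mathfrak n$ there is a constant $\tilde C_n>0$ such that the following holds for all nilpotent, connected, simply connected Lie groups $G$ with Lie algebra $\mathfrak g\prec\mathfrak n$, $\dim\mathfrak g=n$, for all strong Malcev bases of $\mathfrak g$ and all orbit types $d$. There is a measurable family of polarizing subalgebras $\mathfrak m_\zeta$, $\zeta\in U_d$. For every family of polarizing subalgebras $\mathfrak m_\zeta$, $\zeta\in U_d$, with the representations $\sigma_\zeta$ on $\mathcal H_\zeta$ that it defines, one can find for all $\zeta\in U_d$ vectors $u_\zeta\in\mathcal H_\zeta^\infty$ and $v_\zeta\in\mathcal H_\zeta$ with $\|u_\zeta\|=\|v_\zeta\|=1$, whose images in $L^2(\mathbb R^{d_n/2})$ depend measurably on $\zeta\in U_d$ if the family is measurable, such that: 1. the matrix coefficient $m(X)=\langle\sigma_\zeta(\exp X)u_\zeta,v_\zeta\rangle$ is $C^1$, and its $C^1$ norm is at most $\tilde C_n\langle\|\zeta\|\rangle$, both for the $C^1(G)$ norm formed with the left-invariant vector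 fields, i.e. $\sup_{g\in G}|m(g)|+\sup_{g\in G,\,\|Y\|\le1}\bigl|\frac{d}{dt}\big|_{t=0}m(g\exp tY)\bigr|$ (with $m$ viewed as a function on $G$ through $\exp$), and for the $C^1$ norm on the ball of radius $R$ about $0$ in $\mathfrak g$; 2. with $\varepsilon=\min\bigl(\tfrac14,(2^{3n}\tilde C_n c)^{-1/2}\bigr)$, for all $\eta\in i\mathfrak g^*$ with $\|\eta-\zeta\|<\varepsilon^{-1}\delta$ and all non-negative $\phi\in C_c^\infty(\mathfrak g)$ supported in the open ball of radius $\varepsilon\langle\|\zeta\|\rangle^{-1/2}$ about $0$, $$\operatorname{Re}\left(\int_{\mathfrak g}m(X)\,\phi(X)\,e^{-2\pi\eta(X)}\,dX\right)\ \ge\ 2^{-3n}\int_{\mathfrak g}\phi(X)\,dX\ \ge\ 0.$$ -/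

import Mathlib

open MeasureTheory
open scoped ENNReal ContDiff

universe u

noncomputable section

/-- A finite-dimensional real Lie algebra together with an inner product. -/
structure MetricLieAlgebra : Type (u + 1) where
  carrier : Type u
  [normedGroup : NormedAddCommGroup carrier]
  [innerSpace : InnerProductSpace ℝ carrier]
  [finiteDim : FiniteDimensional ℝ carrier]
  bracket : carrier →ₗ[ℝ] carrier →ₗ[ℝ] carrier
  bracket_self : ∀ x, bracket x x = 0
  leibniz : ∀ x y z, bracket x (bracket y z) = bracket (bracket x y) z + bracket y (bracket x z)

namespace MetricLieAlgebra

instance : CoeSort MetricLieAlgebra.{u} (Type u) := ⟨carrier⟩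

attribute [instance] normedGroup innerSpace finiteDim

variable (𝔤 : MetricLieAlgebra.{u})

instance : LieRing 𝔤 where
  bracket x y := 𝔤.bracket x y
  add_lie x y z := by simp
  lie_add x y z := by simp
  lie_self x := 𝔤.bracket_self x
  leibniz_lie x y z := 𝔤.leibniz x y z

instance : LieAlgebra ℝ 𝔤 where
  lie_smul t x y := (𝔤.bracket x).map_smul t y

instance : MeasurableSpace 𝔤 := borel 𝔤

instance : BorelSpace 𝔤 := ⟨rfl⟩

/-- `Prec 𝔫 𝔤` is the relation `𝔤 ≺ 𝔫`: the metric Lie algebra `𝔤` is obtained from `𝔫` by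
finitely many steps, each of which is the passage to the quotient by the line of a nonzero central
element, or the passage to the ideal of codimension one of Kirillov's lemma (the centralizer of
`Y`, where the center is `ℝ Z` and `[X, Y] = Z`). In each step the inner product is the inherited
one. A quotient is given as a surjection `π` that is isometric on the orthogonal complement of its
kernel, a subalgebra as an isometric embedding `ι`. -/
inductive Prec (𝔫 : MetricLieAlgebra.{u}) : MetricLieAlgebra.{u} → Prop
  | refl : Prec 𝔫 𝔫
  | quotient {𝔥 𝔤 : MetricLieAlgebra.{u}} (h : Prec 𝔫 𝔥)
      (Z : 𝔥) (hZ : Z ≠ 0) (hcentral : Z ∈ LieAlgebra.center ℝ 𝔥)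
      (π : 𝔥 →ₗ⁅ℝ⁆ 𝔤) (hsurj : Function.Surjective π)
      (hker : ∀ W : 𝔥, π W = 0 ↔ W ∈ Submodule.span ℝ {Z})
      (hisom : ∀ W : 𝔥, inner ℝ W Z = 0 → ‖π W‖ = ‖W‖) : Prec 𝔫 𝔤
  | subalgebra {𝔥 𝔤 : MetricLieAlgebra.{u}} (h : Prec 𝔫 𝔥)
      (X Y Z : 𝔥) (hZ : Z ≠ 0)
      (hcenter : ∀ W : 𝔥, W ∈ LieAlgebra.center ℝ 𝔥 ↔ W ∈ Submodule.span ℝ {Z})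
      (hXY : ⁅X, Y⁆ = Z)
      (ι : 𝔤 →ₗ⁅ℝ⁆ 𝔥) (hisom : ∀ W : 𝔤, ‖ι W‖ = ‖W‖)
      (hrange : ∀ W : 𝔥, (∃ V : 𝔤, ι V = W) ↔ ⁅W, Y⁆ = 0)
      (hcompl : ∀ W : 𝔥, ∃ (s : ℝ) (V : 𝔤), W = s • X + ι V) : Prec 𝔫 𝔤

variable {𝔤}

/-! ### The simply connected group

The connected, simply connected nilpotent Lie group with Lie algebra `𝔤` is realized, through its
global exponential chart, as `𝔤` itself with the Baker-Campbell-Hausdorff product `bch`; its unit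
is `0` and its one-parameter groups are `t ↦ t • X`. -/

/-- `ad X` as a continuous linear map. -/
def adL (X : 𝔤) : 𝔤 →L[ℝ] 𝔤 := LinearMap.toContinuousLinearMap (LieAlgebra.ad ℝ 𝔤 X)

/-- The function `z ↦ z log z / (z - 1) = 1 + ∑_{m ≥ 1} (-1)^(m+1) / (m (m+1)) (z - 1)^m` at a
unipotent `z`; the sum breaks off since `(z - 1) ^ dim 𝔤 = 0`. -/
def bchKernel (z : 𝔤 →L[ℝ] 𝔤) : 𝔤 →L[ℝ] 𝔤 :=
  1 + ∑ m ∈ Finset.Icc 1 (Module.finrank ℝ 𝔤),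
    ((-1 : ℝ) ^ (m + 1) / ((m : ℝ) * ((m : ℝ) + 1))) • (z - 1) ^ m

/-- The Baker-Campbell-Hausdorff product `log (exp X exp Y)` of a nilpotent Lie algebra, in the
integral form `X + ∫₀¹ ψ(e^{ad X} e^{t ad Y}) Y dt` with `ψ(z) = z log z / (z - 1)`. -/
def bch (X Y : 𝔤) : 𝔤 :=
  X + ∫ t in (0 : ℝ)..1, bchKernel (NormedSpace.exp (adL X) * NormedSpace.exp (t • adL Y)) Y

/-! ### Linear forms, orbit types, polarizations

The space `i𝔤*` is identified with the real dual `StrongDual ℝ 𝔤` (with the dual norm):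
the form `ζ` stands for `i ζ`, so that `e^{2π⟨iζ, X⟩}` is `exp (2 π i ζ(X))`. -/

/-- The alternating form `B_ζ(X, Y) = ζ([X, Y])`. -/
def kirillovForm (ζ : StrongDual ℝ 𝔤) : 𝔤 →ₗ[ℝ] 𝔤 →ₗ[ℝ] ℝ :=
  𝔤.bracket.compr₂ (ζ : 𝔤 →ₗ[ℝ] ℝ)

/-- The span `𝔤_j` of the first `j` basis vectors. -/
def flag {n : ℕ} (b : Module.Basis (Fin n) ℝ 𝔤) (j : ℕ) : Submodule ℝ 𝔤 :=
  Submodule.span ℝ (b '' {i | (i : ℕ) < j})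

/-- A basis is a strong Malcev basis if all `𝔤_j` are ideals. -/
def IsStrongMalcev {n : ℕ} (b : Module.Basis (Fin n) ℝ 𝔤) : Prop :=
  ∀ (j : ℕ) (X Y : 𝔤), Y ∈ flag b j → ⁅X, Y⁆ ∈ flag b j

/-- The orbit type of `ζ` with respect to a strong Malcev basis: `d_j` (for `0 ≤ j ≤ n`) is the
dimension of the `G`-orbit of `ζ|_{𝔤_j}` in `𝔤_j*`, that is, of its tangent space
`{ζ([X, ·])|_{𝔤_j} : X ∈ 𝔤}`. In particular `d_n` is the dimension of the coadjoint orbit. -/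
def orbitType {n : ℕ} (b : Module.Basis (Fin n) ℝ 𝔤) (ζ : StrongDual ℝ 𝔤) (j : Fin (n + 1)) : ℕ :=
  Module.finrank ℝ (LinearMap.range ((kirillovForm ζ).domRestrict₂ (flag b j)))

/-- `U_d`, the union of all coadjoint orbits of type `d`. -/
def orbitStratum {n : ℕ} (b : Module.Basis (Fin n) ℝ 𝔤) (d : Fin (n + 1) → ℕ) :
    Set (StrongDual ℝ 𝔤) :=
  {ζ | orbitType b ζ = d}

/-- A subspace on which `B_ζ` vanishes. -/
def IsIsotropic (ζ : StrongDual ℝ 𝔤) (W : Submodule ℝ 𝔤) : Prop :=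
  ∀ X ∈ W, ∀ Y ∈ W, ζ ⁅X, Y⁆ = 0

/-- A polarizing subalgebra for `ζ`: a subalgebra that is a maximal isotropic subspace. -/
def IsPolarizing (ζ : StrongDual ℝ 𝔤) (𝔪 : LieSubalgebra ℝ 𝔤) : Prop :=
  IsIsotropic ζ 𝔪.toSubmodule ∧
    ∀ W : Submodule ℝ 𝔤, 𝔪.toSubmodule ≤ W → IsIsotropic ζ W → W = 𝔪.toSubmodule

/-- A family of subalgebras depends measurably on `ζ ∈ U`, that is, the orthogonal projections
onto its members do. -/
def MeasurableFamily (U : Set (StrongDual ℝ 𝔤)) (𝔪 : StrongDual ℝ 𝔤 → LieSubalgebra ℝ 𝔤) : Prop :=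
  ∀ X : 𝔤, Measurable fun ζ : U => (𝔪 ζ).toSubmodule.starProjection X

/-! ### The induced representation

`M = exp 𝔪` has the character `χ(exp Y) = e^{2πiζ(Y)}`. A vector of `H_ζ` is a measurable function
`f` on `G` with `f(mg) = χ(m) f(g)` that is square integrable on `M\G`, and `σ_ζ` acts on such
functions by right translation. If `j_1 < ⋯ < j_k` are the indices with
`X_j ∉ 𝔪 + 𝔤_{j-1}`, then `t ↦ M exp(t_1 X_{j_1}) ⋯ exp(t_k X_{j_k})` is a bijection from `ℝ^k` to
`M\G` which carries Lebesgue measure to an invariant measure. This identifies `H_ζ` with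
`L²(ℝ^k)`. If `𝔪` is polarizing for `ζ`, then `k` is half of the dimension of the orbit. -/

open Classical in
/-- The indices `j` with `X_j ∉ 𝔪 + 𝔤_{j-1}`. -/
def cosetIndices {n : ℕ} (b : Module.Basis (Fin n) ℝ 𝔤) (𝔪 : LieSubalgebra ℝ 𝔤) : Finset (Fin n) :=
  Finset.univ.filter fun j => b j ∉ 𝔪.toSubmodule ⊔ flag b j

/-- The section `t ↦ exp(t_1 X_{j_1}) ⋯ exp(t_k X_{j_k})` of `G → M\G`. -/
def cosetSection {n : ℕ} (b : Module.Basis (Fin n) ℝ 𝔤) (𝔪 : LieSubalgebra ℝ 𝔤) {k : ℕ}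
    (t : Fin k → ℝ) : 𝔤 :=
  (List.zipWith (fun j s => s • b j) ((cosetIndices b 𝔪).sort (· ≤ ·)) (List.ofFn t)).foldl bch 0

/-- The functions on `G` that represent the vectors of `H_ζ`. -/
structure IsInducedVector {n : ℕ} (b : Module.Basis (Fin n) ℝ 𝔤) (k : ℕ) (ζ : StrongDual ℝ 𝔤)
    (𝔪 : LieSubalgebra ℝ 𝔤) (f : 𝔤 → ℂ) : Prop where
  measurable : Measurable f
  equivariant : ∀ Y ∈ 𝔪, ∀ X : 𝔤, f (bch Y X) = Complex.exp (2 * Real.pi * Complex.I * ζ Y) * f X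
  memLp : MemLp (fun t : Fin k → ℝ => f (cosetSection b 𝔪 t)) 2 volume

open Classical in
/-- The identification of `H_ζ` with `L²(ℝ^k)`. -/
def toL2 {n : ℕ} (b : Module.Basis (Fin n) ℝ 𝔤) (k : ℕ) (𝔪 : LieSubalgebra ℝ 𝔤) (f : 𝔤 → ℂ) :
    Lp ℂ 2 (volume : Measure (Fin k → ℝ)) :=
  if h : MemLp (fun t : Fin k → ℝ => f (cosetSection b 𝔪 t)) 2 volume then h.toLp else 0

/-- The representation on functions: `(σ(exp X) f)(g) = f(g exp X)`. -/
def rightTranslate (X : 𝔤) (f : 𝔤 → ℂ) : 𝔤 → ℂ := fun W => f (bch W X)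

/-- `f` represents a smooth vector: the orbit map `X ↦ σ(exp X) f` is smooth. -/
def IsSmoothVector {n : ℕ} (b : Module.Basis (Fin n) ℝ 𝔤) (k : ℕ) (𝔪 : LieSubalgebra ℝ 𝔤)
    (f : 𝔤 → ℂ) : Prop :=
  ContDiff ℝ ∞ fun X : 𝔤 => toL2 b k 𝔪 (rightTranslate X f)

/-- The matrix coefficient `X ↦ ⟨σ(exp X) f, h⟩`, linear in `f` and conjugate linear in `h`. -/
def matrixCoeff {n : ℕ} (b : Module.Basis (Fin n) ℝ 𝔤) (k : ℕ) (𝔪 : LieSubalgebra ℝ 𝔤)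
    (f h : 𝔤 → ℂ) (X : 𝔤) : ℂ :=
  inner ℂ (toL2 b k 𝔪 h) (toL2 b k 𝔪 (rightTranslate X f))

/-! ### Norms -/

/-- The Japanese bracket `⟨x⟩ = (1 + x²)^{1/2}`. -/
def japanese (x : ℝ) : ℝ := Real.sqrt (1 + x ^ 2)

/-- The `C¹` norm on the group `G`, formed with the left-invariant vector fields
`(Y f)(g) = d/dt f(g exp(tY))` at `t = 0` of the vectors `Y` of norm at most one. -/
def groupC1Norm (f : 𝔤 → ℂ) : ℝ≥0∞ :=
  (⨆ g : 𝔤, ‖f g‖ₑ) +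
    ⨆ (g : 𝔤) (Y : 𝔤) (_ : ‖Y‖ ≤ 1), ‖deriv (fun t : ℝ => f (bch g (t • Y))) 0‖ₑ

/-- The `C¹` norm on the ball of radius `R` about the origin, in the exponential chart. -/
def ballC1Norm (R : ℝ) (f : 𝔤 → ℂ) : ℝ≥0∞ :=
  (⨆ X ∈ Metric.ball (0 : 𝔤) R, ‖f X‖ₑ) + ⨆ X ∈ Metric.ball (0 : 𝔤) R, ‖fderiv ℝ f X‖ₑ

end MetricLieAlgebra

end

/-! The group is realized as `𝔤` with the product `bch`. For a polarization 𝔪 of ζ one takes u = v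
to be a coherent state: a vector of σ_ζ concentrated near the base point of M\G at the scale r =
⟨‖ζ‖⟩^(-1/2) and carrying the phase of ζ. It is an approximate joint eigenvector of the Lie algebra:
dσ_ζ(Y)u = 2πiζ(Y)u up to an error of norm at most A⟨‖ζ‖⟩^(1/2)‖Y‖
(`isCoherentOrbit_coherentState`). Since σ_ζ is unitary, this bounds the derivatives of the matrix
coefficient m. Along a one-parameter group it gives |m(X)e^(-2πζ(X)) - 1| ≤ A⟨‖ζ‖⟩^(1/2)‖X‖
(`norm_inner_mul_exp_sub_one_le`), which is at most 1/2 on the ball of radius ε⟨‖ζ‖⟩^(-1/2) once Aε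
≤ 1/2. There the remaining phase (η-ζ)(X) is smaller than δ, so the integrand has real part at least
φ/8 if n ≥ 1 (`integral_re_ge`).

To build the state, climb the subalgebras 𝔪 + 𝔤_j. Each contains the commutators of the next, so the
component of g along the unit vector e_j orthogonal to 𝔪 + 𝔤_j is additive in g, and dividing by exp
of that component descends one step (`strip`). The state `wave` is χ_ζ on M times, for each step, a
bump β(τ/r) with phase e^(2πiτζ(e_j)). Differentiating from the right produces two kinds of error
(`norm_fderiv_wave_sub_le`): derivatives of bumps, of size 1/r, and conjugations by exp(τe_j) with
|τ| ≤ r, which move the direction by O(r) and cost O(‖ζ‖r). The chosen r balances them. Errors are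
pointwise bounded by the indicator of a coordinate box, whose L² norm is comparable to that of the
state by Fubini (`lintegral_towerProd`), with a ratio that does not depend on 𝔪.

All constants depend only on n, the cutoff profile and a bound K for the bracket. Both K and
nilpotency pass along ≺ (`Prec.isNilpotent_and_norm_lie_le`), and nothing else about ≺ is needed.
Measurability follows from an explicit construction out of orthogonal projections, and a measurable
family of polarizations is given by Vergne's construction (`vergne`).

The group law requires its own proof. The curve t ↦ `bch X (t • Y)` is an integral curve of a
left-invariant field, so exp turns `bch` into multiplication in every representation. Associativity
then follows from a faithful affine representation of a graded cover of `𝔤`. -/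

open MeasureTheory
open scoped ENNReal ContDiff

universe v

noncomputable section

/-! ### Exponentials in Banach algebras: Duhamel's formula and truncated logarithms. -/

section Banach

set_option linter.unusedSectionVars false

variable {𝔸 : Type*} [NormedRing 𝔸] [NormedAlgebra ℝ 𝔸] [CompleteSpace 𝔸]

open NormedSpace

theorem continuous_exp_banach : Continuous (exp : 𝔸 → 𝔸) :=
  continuous_iff_continuousAt.2 fun x => (exp_analytic (𝕂 := ℝ) x).continuousAt

theorem contDiff_exp_banach {n : WithTop ℕ∞} : ContDiff ℝ n (exp : 𝔸 → 𝔸) :=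
  contDiff_iff_contDiffAt.2 fun x => (exp_analytic (𝕂 := ℝ) x).contDiffAt

theorem hasDerivAt_exp_smul (a : 𝔸) (s : ℝ) :
    HasDerivAt (fun s : ℝ => exp (s • a)) (exp (s • a) * a) s :=
  hasDerivAt_exp_smul_const a s

theorem hasDerivAt_exp_smul' (a : 𝔸) (s : ℝ) :
    HasDerivAt (fun s : ℝ => exp (s • a)) (a * exp (s • a)) s :=
  hasDerivAt_exp_smul_const' a s

theorem exp_smul_neg_mul (a : 𝔸) (s : ℝ) : exp (s • -a) * exp (s • a) = 1 := by
  let _ : NormedAlgebra ℚ 𝔸 := NormedAlgebra.restrictScalars ℚ ℝ 𝔸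
  rw [← exp_add_of_commute (by simp), smul_neg, neg_add_cancel, exp_zero]

theorem exp_smul_mul_neg (a : 𝔸) (s : ℝ) : exp (s • a) * exp (s • -a) = 1 := by
  simpa using exp_smul_neg_mul (-a) s

theorem exp_mul_exp_neg (a : 𝔸) : exp a * exp (-a) = 1 := by
  simpa using exp_smul_mul_neg a 1

theorem exp_neg_mul_exp (a : 𝔸) : exp (-a) * exp a = 1 := by
  simpa using exp_smul_neg_mul a 1

theorem continuous_exp_smul (a : 𝔸) : Continuous fun s : ℝ => exp (s • a) :=
  continuous_exp_banach.comp (continuous_id.smul continuous_const)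

/-- Duhamel's formula. -/
theorem exp_sub_exp (A B : 𝔸) :
    exp B - exp A = exp A * ∫ s in (0 : ℝ)..1, exp (s • -A) * (B - A) * exp (s • B) := by
  have h : ∀ s : ℝ, HasDerivAt (fun s : ℝ => exp (s • -A) * exp (s • B))
      (exp (s • -A) * (B - A) * exp (s • B)) s := fun s => by
    refine ((hasDerivAt_exp_smul (-A) s).mul (hasDerivAt_exp_smul' B s)).congr_deriv ?_
    noncomm_ring
  rw [intervalIntegral.integral_eq_sub_of_hasDerivAt (fun s _ => h s)
    ((((continuous_exp_smul _).mul continuous_const).mul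
      (continuous_exp_smul _)).intervalIntegrable _ _)]
  · simp [mul_sub, ← mul_assoc, exp_mul_exp_neg]

/-- Duhamel's formula is linear in the increment, so it also expresses the difference quotient; the
integral is jointly continuous in the quotient of `A` and the end point, and the limit can be taken
inside. -/
theorem hasDerivAt_exp_curve {A : ℝ → 𝔸} {A' : 𝔸} {t : ℝ} (h : HasDerivAt A A' t) :
    HasDerivAt (fun t => exp (A t))
      (exp (A t) * ∫ s in (0 : ℝ)..1, exp (s • -A t) * A' * exp (s • A t)) t := by
  rw [hasDerivAt_iff_tendsto_slope] at h ⊢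
  have hc : Continuous fun p : 𝔸 × 𝔸 =>
      exp (A t) * ∫ s in (0 : ℝ)..1, exp (s • -A t) * p.1 * exp (s • p.2) := by
    refine continuous_const.mul
      (intervalIntegral.continuous_parametric_intervalIntegral_of_continuous' ?_ 0 1)
    refine Continuous.mul (Continuous.mul ?_ (by fun_prop)) ?_
    · exact continuous_exp_banach.comp (by fun_prop)
    · exact continuous_exp_banach.comp (by fun_prop)
  have hA : Filter.Tendsto A (nhdsWithin t {t}ᶜ) (nhds (A t)) :=
    ((hasDerivAt_iff_tendsto_slope.2 h).continuousAt.tendsto).mono_left nhdsWithin_le_nhds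
  refine ((hc.tendsto (A', A t)).comp (h.prodMk_nhds hA)).congr fun x => ?_
  simp only [Function.comp, slope_def_module, exp_sub_exp (A t) (A x)]
  rw [← mul_smul_comm, ← intervalIntegral.integral_smul]
  simp

/-- The function `a ↦ ∫₀ˢ e^{-va} dv`. -/
def expInt (a : 𝔸) (s : ℝ) : 𝔸 := ∫ v in (0 : ℝ)..s, exp (v • -a)

theorem hasDerivAt_expInt (a : 𝔸) (s : ℝ) : HasDerivAt (expInt a) (exp (s • -a)) s :=
  intervalIntegral.integral_hasDerivAt_right ((continuous_exp_smul _).intervalIntegrable _ _)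
    (continuous_exp_smul _).stronglyMeasurable.stronglyMeasurableAtFilter
    (continuous_exp_smul _).continuousAt

@[simp] theorem expInt_zero (a : 𝔸) : expInt a 0 = 0 := by simp [expInt]

theorem mul_expInt (a : 𝔸) (s : ℝ) : a * expInt a s = 1 - exp (s • -a) := by
  have h : ∀ s : ℝ, HasDerivAt (fun s => a * expInt a s + exp (s • -a)) 0 s := fun s => by
    refine (((hasDerivAt_expInt a s).const_mul a).add (hasDerivAt_exp_smul' (-a) s)).congr_deriv ?_
    noncomm_ring
  have := is_const_of_deriv_eq_zero (fun s => (h s).differentiableAt) (fun s => (h s).deriv) s 0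
  simp only [expInt_zero, mul_zero, zero_smul, exp_zero, zero_add] at this
  exact eq_sub_of_add_eq this

/-- Uniqueness for a linear differential equation, through the integrating factor e^(sa). -/
theorem eq_zero_of_hasDerivAt_neg_mul {a : 𝔸} {M : ℝ → 𝔸} (h0 : M 0 = 0)
    (h : ∀ s, HasDerivAt M (-(a * M s)) s) (s : ℝ) : M s = 0 := by
  have h' : ∀ s : ℝ, HasDerivAt (fun s => exp (s • a) * M s) 0 s := fun s => by
    refine ((hasDerivAt_exp_smul a s).mul (h s)).congr_deriv ?_
    noncomm_ring
  have := is_const_of_deriv_eq_zero (fun s => (h' s).differentiableAt) (fun s => (h' s).deriv) s 0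
  simp [h0] at this
  calc M s = exp (s • -a) * (exp (s • a) * M s) := by rw [← mul_assoc, exp_smul_neg_mul, one_mul]
    _ = 0 := by rw [this, mul_zero]

variable (𝔸) in
/-- The truncation of `z log z / (z - 1)`, as a function of `y = z - 1`. -/
def logKernel (N : ℕ) (y : 𝔸) : 𝔸 :=
  1 + ∑ m ∈ Finset.Icc 1 N, ((-1 : ℝ) ^ (m + 1) / ((m : ℝ) * ((m : ℝ) + 1))) • y ^ m

theorem hasDerivAt_pow_of_commute {y : ℝ → 𝔸} {y' : 𝔸} {s : ℝ} (h : HasDerivAt y y' s)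
    (hc : Commute (y s) y') (m : ℕ) :
    HasDerivAt (fun s => y s ^ m) ((m : ℝ) • (y s ^ (m - 1) * y')) s := by
  induction m with
  | zero => simpa using hasDerivAt_const s (1 : 𝔸)
  | succ m ih =>
    simp only [pow_succ]
    refine (ih.mul h).congr_deriv ?_
    rcases m with _ | m
    · simp
    · have : y' * y s = y s * y' := hc.symm
      simp only [Nat.add_sub_cancel, smul_mul_assoc, mul_assoc, this]
      rw [← mul_assoc (y s ^ m), ← pow_succ]
      push_cast
      module

/-- Both sides vanish at s = 0 and have the same derivative: differentiating the logarithmic series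
leaves a geometric series in 1 - e^(sa), which is finite by nilpotency and sums to e^(-sa). -/
theorem log_exp {a : 𝔸} {N : ℕ} (hN : ∀ s : ℝ, (exp (s • a) - 1) ^ N = 0) (s : ℝ) :
    ∑ m ∈ Finset.Icc 1 N, ((-1 : ℝ) ^ (m + 1) / m) • (exp (s • a) - 1) ^ m = s • a := by
  set y : ℝ → 𝔸 := fun s => exp (s • a) - 1 with hy
  have hcomm : ∀ s t : ℝ, Commute (exp (s • a)) (exp (t • a)) := fun s t => by
    let _ : NormedAlgebra ℚ 𝔸 := NormedAlgebra.restrictScalars ℚ ℝ 𝔸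
    have : Commute (s • a) (t • a) := ((Commute.refl a).smul_left s).smul_right t
    exact this.exp
  have hca : ∀ s : ℝ, Commute (exp (s • a)) a := fun s => by
    have := (hasDerivAt_exp_smul a s).unique (hasDerivAt_exp_smul' a s)
    exact this
  have hya : ∀ s : ℝ, Commute (y s) a := fun s => (hca s).sub_left (Commute.one_left a)
  have hy' : ∀ s : ℝ, HasDerivAt y (exp (s • a) * a) s := fun s =>
    (hasDerivAt_exp_smul a s).sub_const 1
  have hcy : ∀ s : ℝ, Commute (y s) (exp (s • a) * a) := fun s =>
    (((hcomm s s).sub_left (Commute.one_left _))).mul_right (hya s)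
  have hpow : ∀ s : ℝ, ∀ m : ℕ, HasDerivAt (fun s => y s ^ m)
      ((m : ℝ) • (y s ^ (m - 1) * (exp (s • a) * a))) s := fun s m =>
    hasDerivAt_pow_of_commute (hy' s) (hcy s) m
  have hpoly : ∀ (c : ℕ → ℝ) (s : ℝ), HasDerivAt (fun s => ∑ m ∈ Finset.Icc 1 N, c m • y s ^ m)
      (∑ m ∈ Finset.Icc 1 N, c m • ((m : ℝ) • (y s ^ (m - 1) * (exp (s • a) * a)))) s :=
    fun c s => HasDerivAt.fun_sum fun m _ => (hpow s m).fun_const_smul (c m)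
  have hd : ∀ s : ℝ, HasDerivAt (fun s : ℝ => ∑ m ∈ Finset.Icc 1 N,
      ((-1 : ℝ) ^ (m + 1) / m) • y s ^ m - s • a) 0 s := fun s => by
    refine ((hpoly (fun m => (-1 : ℝ) ^ (m + 1) / m) s).sub
      ((hasDerivAt_id s).smul_const a)).congr_deriv ?_
    have h1 : ∀ m ∈ Finset.Icc 1 N, ((-1 : ℝ) ^ (m + 1) / m) •
        ((m : ℝ) • (y s ^ (m - 1) * (exp (s • a) * a)))
        = (-(y s)) ^ (m - 1) * (exp (s • a) * a) := fun m hm => by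
      have hm1 := (Finset.mem_Icc.1 hm).1
      have hm0 : (m : ℝ) ≠ 0 := by positivity
      rw [smul_smul, div_mul_cancel₀ _ hm0, ← smul_mul_assoc, neg_pow (y s)]
      obtain ⟨k, rfl⟩ := Nat.exists_eq_add_of_le hm1
      have : (-1 : ℝ) ^ (1 + k + 1) = (-1) ^ k := by ring
      rw [this, Nat.add_sub_cancel_left]
      congr 1
      rcases neg_one_pow_eq_or ℝ k with h | h <;> rcases Nat.even_or_odd k with h2 | h2 <;>
        simp [h2.neg_one_pow] 
    rw [Finset.sum_congr rfl h1, ← Finset.sum_mul]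
    have h2 : ∑ m ∈ Finset.Icc 1 N, (-(y s)) ^ (m - 1) = ∑ j ∈ Finset.range N, (-(y s)) ^ j := by
      have := Finset.sum_Ico_add_right_sub_eq (f := fun j => (-(y s)) ^ j) 0 N 1
      rwa [← Finset.range_eq_Ico] at this
    have h3 : (∑ j ∈ Finset.range N, (-(y s)) ^ j) * exp (s • a) = 1 := by
      have := geom_sum_mul_neg (-(y s)) N
      rw [neg_pow, hN s, mul_zero, sub_zero] at this
      simpa [hy] using this
    rw [h2, ← mul_assoc, h3]
    simp
  have := is_const_of_deriv_eq_zero (fun s => (hd s).differentiableAt) (fun s => (hd s).deriv) s 0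
  have hz : ∀ m ∈ Finset.Icc 1 N, ((-1 : ℝ) ^ (m + 1) / m) • y 0 ^ m = 0 := fun m hm => by
    have := (Finset.mem_Icc.1 hm).1
    simp [hy, show m ≠ 0 by omega]
  rw [Finset.sum_eq_zero hz] at this
  simpa [sub_eq_zero] using this

/-- Formally (1 - e^(-sa))/a times z log z/(z - 1) at z = e^(sa) equals s. Since `a` cannot be
inverted, the difference M of the two sides is shown instead to satisfy M' = -aM and M(0) = 0. -/
theorem logKernel_exp {a : 𝔸} {N : ℕ} (hN : ∀ s : ℝ, (exp (s • a) - 1) ^ N = 0) (s : ℝ) :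
    expInt a s * logKernel 𝔸 N (exp (s • a) - 1) = s • 1 := by
  set y : ℝ → 𝔸 := fun s => exp (s • a) - 1 with hy
  have hcomm : ∀ s t : ℝ, Commute (exp (s • a)) (exp (t • a)) := fun s t => by
    let _ : NormedAlgebra ℚ 𝔸 := NormedAlgebra.restrictScalars ℚ ℝ 𝔸
    have : Commute (s • a) (t • a) := ((Commute.refl a).smul_left s).smul_right t
    exact this.exp
  have hca : ∀ s : ℝ, Commute (exp (s • a)) a := fun s => by
    have := (hasDerivAt_exp_smul a s).unique (hasDerivAt_exp_smul' a s)
    exact this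
  have hya : ∀ s : ℝ, Commute (y s) a := fun s => (hca s).sub_left (Commute.one_left a)
  have hy' : ∀ s : ℝ, HasDerivAt y (exp (s • a) * a) s := fun s =>
    (hasDerivAt_exp_smul a s).sub_const 1
  have hcy : ∀ s : ℝ, Commute (y s) (exp (s • a) * a) := fun s =>
    (((hcomm s s).sub_left (Commute.one_left _))).mul_right (hya s)
  have hpow : ∀ s : ℝ, ∀ m : ℕ, HasDerivAt (fun s => y s ^ m)
      ((m : ℝ) • (y s ^ (m - 1) * (exp (s • a) * a))) s := fun s m =>
    hasDerivAt_pow_of_commute (hy' s) (hcy s) m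
  have hpoly : ∀ (c : ℕ → ℝ) (s : ℝ), HasDerivAt (fun s => ∑ m ∈ Finset.Icc 1 N, c m • y s ^ m)
      (∑ m ∈ Finset.Icc 1 N, c m • ((m : ℝ) • (y s ^ (m - 1) * (exp (s • a) * a)))) s :=
    fun c s => HasDerivAt.fun_sum fun m _ => (hpow s m).fun_const_smul (c m)
  have hlog : ∀ s : ℝ, ∑ m ∈ Finset.Icc 1 N, ((-1 : ℝ) ^ (m + 1) / m) • y s ^ m = s • a :=
    log_exp hN
  have hq : ∀ s : ℝ, HasDerivAt (fun s => logKernel 𝔸 N (y s))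
      (∑ m ∈ Finset.Icc 1 N, ((-1 : ℝ) ^ (m + 1) / ((m : ℝ) * ((m : ℝ) + 1))) •
        ((m : ℝ) • (y s ^ (m - 1) * (exp (s • a) * a)))) s := fun s =>
    (hpoly (fun m => (-1 : ℝ) ^ (m + 1) / ((m : ℝ) * ((m : ℝ) + 1))) s).const_add 1
  refine sub_eq_zero.1 (eq_zero_of_hasDerivAt_neg_mul (a := a)
    (M := fun s => expInt a s * logKernel 𝔸 N (y s) - s • 1) (by simp) (fun s => ?_) s)
  refine (((hasDerivAt_expInt a s).mul (hq s)).sub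
    ((hasDerivAt_id s).smul_const (1 : 𝔸))).congr_deriv ?_
  -- Multiplying the derivative of y by `expInt` returns y, so each differentiated term recovers the
  -- power that it lost. With 1/m - 1/(m(m+1)) = 1/(m+1) this expresses the sum through the
  -- logarithm and the kernel themselves.
  have hP : expInt a s * (exp (s • a) * a) = y s := by
    have h : ∀ s : ℝ, HasDerivAt (fun s => expInt a s * a + exp (s • -a)) 0 s := fun s => by
      refine (((hasDerivAt_expInt a s).mul_const a).add (hasDerivAt_exp_smul (-a) s)).congr_deriv ?_
      noncomm_ring
    have := is_const_of_deriv_eq_zero (fun s => (h s).differentiableAt) (fun s => (h s).deriv) s 0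
    simp only [expInt_zero, zero_mul, zero_smul, exp_zero, zero_add] at this
    rw [(hca s).eq, ← mul_assoc, eq_sub_of_add_eq this, sub_mul, exp_smul_neg_mul, one_mul]
  have hsum : expInt a s * (∑ m ∈ Finset.Icc 1 N, ((-1 : ℝ) ^ (m + 1) / ((m : ℝ) * ((m : ℝ) + 1))) •
        ((m : ℝ) • (y s ^ (m - 1) * (exp (s • a) * a))))
      = 1 + s • a - logKernel 𝔸 N (y s) := by
    conv_rhs => rw [← hlog s]
    rw [logKernel, add_sub_add_left_eq_sub, ← Finset.sum_sub_distrib, Finset.mul_sum]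
    refine Finset.sum_congr rfl fun m hm => ?_
    have hm1 := (Finset.mem_Icc.1 hm).1
    rw [((hcy s).pow_left (m - 1)).eq, mul_smul_comm, mul_smul_comm, ← mul_assoc, hP, ← pow_succ',
      Nat.sub_add_cancel hm1, smul_smul, ← sub_smul]
    congr 1
    have hm0 : (m : ℝ) ≠ 0 := by positivity
    have hm2 : (m : ℝ) + 1 ≠ 0 := by positivity
    field_simp
    ring
  rw [hsum, mul_sub, ← mul_assoc, mul_expInt]
  simp only [one_smul, sub_mul, one_mul, mul_smul_comm, mul_one]
  abel

end Banach

/-! ### Invariant subspaces under exponentials, integrals and the logarithmic kernel. -/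

section Invariant

variable {V : Type*} [NormedAddCommGroup V] [InnerProductSpace ℝ V] [FiniteDimensional ℝ V]

/-- The projection of the curve to the orthogonal complement of `W` has zero derivative. -/
theorem sub_mem_of_hasDerivAt_mem (W : Submodule ℝ V) {f f' : ℝ → V}
    (h : ∀ t, HasDerivAt f (f' t) t) (hm : ∀ t, f' t ∈ W) (s t : ℝ) : f t - f s ∈ W := by
  have hP : ∀ t, HasDerivAt (fun t => Wᗮ.starProjection (f t)) 0 t := fun t => by
    refine (Wᗮ.starProjection.hasFDerivAt.comp_hasDerivAt t (h t)).congr_deriv ?_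
    rw [Submodule.starProjection_apply_eq_zero_iff, Submodule.orthogonal_orthogonal]
    exact hm t
  have := is_const_of_deriv_eq_zero (fun s => (hP s).differentiableAt) (fun s => (hP s).deriv) t s
  rw [← sub_eq_zero, ← map_sub, Submodule.starProjection_apply_eq_zero_iff,
    Submodule.orthogonal_orthogonal] at this
  exact this

theorem intervalIntegral_mem (W : Submodule ℝ V) {f : ℝ → V} (hf : Continuous f)
    (hm : ∀ t, f t ∈ W) (a b : ℝ) : ∫ t in a..b, f t ∈ W := by
  have := sub_mem_of_hasDerivAt_mem W (f := fun b => ∫ t in a..b, f t) (f' := f)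
    (fun t => intervalIntegral.integral_hasDerivAt_right (hf.intervalIntegrable _ _)
      hf.stronglyMeasurable.stronglyMeasurableAtFilter hf.continuousAt) hm a b
  simpa using this

omit [FiniteDimensional ℝ V] in
theorem pow_apply_mem {A : V →L[ℝ] V} {W₁ W₂ : Submodule ℝ V} (h21 : W₂ ≤ W₁)
    (h : ∀ x ∈ W₁, A x ∈ W₂) {x : V} (hx : x ∈ W₁) {m : ℕ} (hm : m ≠ 0) : (A ^ m) x ∈ W₂ := by
  obtain ⟨m, rfl⟩ := Nat.exists_eq_succ_of_ne_zero hm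
  induction m with
  | zero => simpa using h x hx
  | succ m ih =>
    rw [pow_succ']
    exact h _ (h21 (ih (by omega)))

theorem exp_apply_sub_mem {A : V →L[ℝ] V} {W₁ W₂ : Submodule ℝ V} (h21 : W₂ ≤ W₁)
    (h : ∀ x ∈ W₁, A x ∈ W₂) {x : V} (hx : x ∈ W₁) : NormedSpace.exp A x - x ∈ W₂ := by
  have hs := (NormedSpace.exp_series_hasSum_exp' (𝕂 := ℝ) A).mapL
    (ContinuousLinearMap.apply ℝ V x)
  have ht := (hs.tendsto_sum_nat.sub_const x)
  refine (Submodule.closed_of_finiteDimensional W₂).mem_of_tendsto ht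
    (Filter.eventually_atTop.2 ⟨1, fun n hn => ?_⟩)
  obtain ⟨n, rfl⟩ := Nat.exists_eq_add_of_le' hn
  rw [Finset.sum_range_succ']
  simp only [ContinuousLinearMap.apply_apply, smul_apply, pow_zero,
    Nat.factorial_zero, Nat.cast_one, inv_one, one_smul, one_apply_eq_self,
    add_sub_cancel_right]
  exact Submodule.sum_mem _ fun m _ => Submodule.smul_mem _ _ (pow_apply_mem h21 h hx (by omega))

theorem exp_apply_mem {A : V →L[ℝ] V} {W : Submodule ℝ V}
    (h : ∀ x ∈ W, A x ∈ W) {x : V} (hx : x ∈ W) : NormedSpace.exp A x ∈ W := by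
  simpa using W.add_mem (exp_apply_sub_mem le_rfl h hx) hx

theorem expInt_apply (A : V →L[ℝ] V) (s : ℝ) (x : V) :
    expInt A s x = ∫ v in (0 : ℝ)..s, NormedSpace.exp (v • -A) x :=
  (ContinuousLinearMap.intervalIntegral_comp_comm (ContinuousLinearMap.apply ℝ V x)
    ((continuous_exp_smul (-A)).intervalIntegrable 0 s)).symm

theorem continuous_exp_smul_apply (A : V →L[ℝ] V) (x : V) :
    Continuous fun v : ℝ => NormedSpace.exp (v • A) x :=
  (continuous_exp_smul A).clm_apply continuous_const

theorem expInt_apply_mem {A : V →L[ℝ] V} {W : Submodule ℝ V}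
    (h : ∀ x ∈ W, A x ∈ W) {x : V} (hx : x ∈ W) (s : ℝ) : expInt A s x ∈ W := by
  rw [expInt_apply]
  refine intervalIntegral_mem W (continuous_exp_smul_apply _ _) (fun t => exp_apply_mem ?_ hx) 0 s
  intro y hy
  simpa using W.smul_mem _ (W.neg_mem (h y hy))

theorem logKernel_apply_sub_mem (N : ℕ) {y : V →L[ℝ] V} {W₁ W₂ : Submodule ℝ V} (h21 : W₂ ≤ W₁)
    (h : ∀ x ∈ W₁, y x ∈ W₂) {x : V} (hx : x ∈ W₁) : logKernel (V →L[ℝ] V) N y x - x ∈ W₂ := by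
  simp only [logKernel, add_apply, one_apply_eq_self,
    add_sub_cancel_left, sum_apply, smul_apply]
  refine Submodule.sum_mem _ fun m hm => Submodule.smul_mem _ _ (pow_apply_mem h21 h hx ?_)
  have := (Finset.mem_Icc.1 hm).1
  omega

omit [FiniteDimensional ℝ V] in
theorem logKernel_apply_sub_logKernel_apply_mem (N : ℕ) {y z : V →L[ℝ] V} {W : Submodule ℝ V}
    (hy : ∀ x ∈ W, y x ∈ W) (h : ∀ x, y x - z x ∈ W) (x : V) :
    logKernel (V →L[ℝ] V) N y x - logKernel (V →L[ℝ] V) N z x ∈ W := by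
  have hp : ∀ m : ℕ, (y ^ m) x - (z ^ m) x ∈ W := fun m => by
    induction m with
    | zero => simp
    | succ m ih =>
      have : (y ^ (m + 1)) x - (z ^ (m + 1)) x
          = y ((y ^ m) x - (z ^ m) x) + (y ((z ^ m) x) - z ((z ^ m) x)) := by
        simp [pow_succ']
      rw [this]
      exact W.add_mem (hy _ ih) (h _)
  simp only [logKernel, add_apply, one_apply_eq_self,
    add_sub_add_left_eq_sub, sum_apply, smul_apply,
    ← Finset.sum_sub_distrib, ← smul_sub]
  exact Submodule.sum_mem _ fun m hm => Submodule.smul_mem _ _ (hp m)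

end Invariant

/-! ### The adjoint representation and the lower central series. -/

namespace MetricLieAlgebra

variable {𝔤 : MetricLieAlgebra.{u}}

@[simp] theorem adL_apply (X Y : 𝔤) : adL X Y = ⁅X, Y⁆ := rfl

theorem adL_add (X Y : 𝔤) : adL (X + Y) = adL X + adL Y := by ext; simp

theorem adL_smul (t : ℝ) (X : 𝔤) : adL (t • X) = t • adL X := by ext; simp

theorem adL_neg (X : 𝔤) : adL (-X) = -adL X := by ext; simp

variable (𝔤) in
/-- `ad` as a continuous linear map. -/
def adCLM : 𝔤 →L[ℝ] (𝔤 →L[ℝ] 𝔤) :=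
  LinearMap.toContinuousLinearMap
    { toFun := adL
      map_add' := adL_add
      map_smul' := adL_smul }

@[simp] theorem adCLM_apply (X : 𝔤) : adCLM 𝔤 X = adL X := rfl

theorem adL_lie (X Y : 𝔤) : adL ⁅X, Y⁆ = adL X * adL Y - adL Y * adL X := by
  ext W; simp

variable (𝔤) in
/-- The lower central series, as a sequence of subspaces. -/
def lcs (i : ℕ) : Submodule ℝ 𝔤 := (LieModule.lowerCentralSeries ℝ 𝔤 𝔤 i).toSubmodule

theorem lcs_zero : lcs 𝔤 0 = ⊤ := by simp [lcs]

theorem lie_mem_lcs_succ {i : ℕ} (X : 𝔤) {Y : 𝔤} (hY : Y ∈ lcs 𝔤 i) : ⁅X, Y⁆ ∈ lcs 𝔤 (i + 1) := by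
  rw [lcs, LieSubmodule.mem_toSubmodule, LieModule.lowerCentralSeries_succ]
  exact LieSubmodule.lie_mem_lie (LieSubmodule.mem_top X) hY

theorem lcs_succ_le (i : ℕ) : lcs 𝔤 (i + 1) ≤ lcs 𝔤 i :=
  LieModule.antitone_lowerCentralSeries ℝ 𝔤 𝔤 (Nat.le_succ i)

theorem lie_mem_lcs_succ' {i : ℕ} {X : 𝔤} (hX : X ∈ lcs 𝔤 i) (Y : 𝔤) : ⁅X, Y⁆ ∈ lcs 𝔤 (i + 1) := by
  rw [← lie_skew]
  exact Submodule.neg_mem _ (lie_mem_lcs_succ Y hX)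

/-- The dimension drops at each step until the series is stationary, and by nilpotency the
stationary value is zero. This is why truncating `bchKernel` at the dimension loses nothing. -/
theorem lcs_finrank [LieRing.IsNilpotent 𝔤] {N : ℕ} (hN : Module.finrank ℝ 𝔤 ≤ N) :
    lcs 𝔤 N = ⊥ := by
  have key : ∀ i : ℕ, Module.finrank ℝ (lcs 𝔤 i) + i ≤ Module.finrank ℝ 𝔤 ∨ lcs 𝔤 i = ⊥ := fun i => by
    induction i with
    | zero => left; simpa using Submodule.finrank_le (lcs 𝔤 0)
    | succ i ih =>
      rcases ih with ih | ih
      · rcases eq_or_lt_of_le (lcs_succ_le (𝔤 := 𝔤) i) with h | h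
        · right
          have h' : LieModule.lowerCentralSeries ℝ 𝔤 𝔤 (i + 1)
              = LieModule.lowerCentralSeries ℝ 𝔤 𝔤 i := by
            rwa [← LieSubmodule.toSubmodule_inj]
          have hst : ∀ k, LieModule.lowerCentralSeries ℝ 𝔤 𝔤 (i + 1 + k)
              = LieModule.lowerCentralSeries ℝ 𝔤 𝔤 (i + 1) := fun k => by
            induction k with
            | zero => rfl
            | succ k ih => rw [← add_assoc, LieModule.lowerCentralSeries_succ, ih, h',
                ← LieModule.lowerCentralSeries_succ, h']
          obtain ⟨k, hk⟩ := LieModule.IsNilpotent.nilpotent ℝ 𝔤 𝔤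
          have : LieModule.lowerCentralSeries ℝ 𝔤 𝔤 (i + 1) = ⊥ := by
            rw [← hst k, eq_bot_iff, ← hk]
            exact LieModule.antitone_lowerCentralSeries ℝ 𝔤 𝔤 (by omega)
          rw [lcs, this, LieSubmodule.bot_toSubmodule]
        · left
          have := Submodule.finrank_lt_finrank_of_lt h
          omega
      · right
        exact eq_bot_iff.2 ((lcs_succ_le i).trans ih.le)
  rcases key N with h | h
  · exact Submodule.finrank_eq_zero.1 (by omega)
  · exact h

end MetricLieAlgebra

/-! ### The Baker-Campbell-Hausdorff product as an integral curve. -/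

namespace MetricLieAlgebra

variable {𝔤 : MetricLieAlgebra.{u}}

open NormedSpace

theorem pow_apply_mem_lcs {A : 𝔤 →L[ℝ] 𝔤} (hA : ∀ i, ∀ x ∈ lcs 𝔤 i, A x ∈ lcs 𝔤 (i + 1)) (m : ℕ) (x : 𝔤) :
    (A ^ m) x ∈ lcs 𝔤 m := by
  induction m with
  | zero => simp [lcs_zero]
  | succ m ih => rw [pow_succ']; exact hA m _ ih

theorem pow_eq_zero_of_lcs [LieRing.IsNilpotent 𝔤] {A : 𝔤 →L[ℝ] 𝔤}
    (hA : ∀ i, ∀ x ∈ lcs 𝔤 i, A x ∈ lcs 𝔤 (i + 1)) {m : ℕ} (hm : Module.finrank ℝ 𝔤 ≤ m) :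
    A ^ m = 0 := by
  ext x
  have := pow_apply_mem_lcs hA m x
  rw [lcs_finrank hm] at this
  simpa using this

theorem adL_pow_eq_zero [LieRing.IsNilpotent 𝔤] (X : 𝔤) : adL X ^ Module.finrank ℝ 𝔤 = 0 :=
  pow_eq_zero_of_lcs (fun _ _ hx => lie_mem_lcs_succ X hx) le_rfl

theorem exp_adL_sub_mem_lcs (X : 𝔤) {i : ℕ} {x : 𝔤} (hx : x ∈ lcs 𝔤 i) :
    exp (adL X) x - x ∈ lcs 𝔤 (i + 1) :=
  exp_apply_sub_mem (lcs_succ_le i) (fun _ hx => lie_mem_lcs_succ X hx) hx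

theorem exp_adL_mem_lcs (X : 𝔤) {i : ℕ} {x : 𝔤} (hx : x ∈ lcs 𝔤 i) : exp (adL X) x ∈ lcs 𝔤 i :=
  exp_apply_mem (fun _ hx => lcs_succ_le i (lie_mem_lcs_succ X hx)) hx

theorem exp_mul_exp_sub_mem_lcs (X Y : 𝔤) {i : ℕ} {x : 𝔤} (hx : x ∈ lcs 𝔤 i) :
    (exp (adL X) * exp (adL Y) - 1) x ∈ lcs 𝔤 (i + 1) := by
  have h1 := exp_adL_sub_mem_lcs X (exp_adL_mem_lcs Y hx)
  have h2 := exp_adL_sub_mem_lcs Y hx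
  simpa using Submodule.add_mem _ h1 h2

theorem exp_adL_sub_one_pow [LieRing.IsNilpotent 𝔤] (X : 𝔤) :
    (exp (adL X) - 1) ^ Module.finrank ℝ 𝔤 = 0 :=
  pow_eq_zero_of_lcs (fun _ _ hx => by simpa using exp_adL_sub_mem_lcs X hx) le_rfl

/-- `expInt (adL X) 1` is the left logarithmic derivative of exp at `X`; the kernel that defines
`bch` inverts it. -/
theorem expInt_bchKernel [LieRing.IsNilpotent 𝔤] (X : 𝔤) :
    expInt (adL X) 1 * bchKernel (exp (adL X)) = 1 := by
  have := logKernel_exp (a := adL X) (N := Module.finrank ℝ 𝔤)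
    (fun s => by rw [← adL_smul]; exact exp_adL_sub_one_pow _) 1
  rw [one_smul, one_smul] at this
  exact this

theorem continuous_bchKernel : Continuous (bchKernel : (𝔤 →L[ℝ] 𝔤) → (𝔤 →L[ℝ] 𝔤)) := by
  unfold bchKernel
  fun_prop

theorem continuous_bch_integrand (X Y Z : 𝔤) :
    Continuous fun t : ℝ => bchKernel (exp (adL X) * exp (t • adL Y)) Z :=
  (continuous_bchKernel.comp (continuous_const.mul (continuous_exp_smul _))).clm_apply
    continuous_const

theorem bch_smul_eq (X Y : 𝔤) (t : ℝ) :
    bch X (t • Y) = X + ∫ s in (0 : ℝ)..t, bchKernel (exp (adL X) * exp (s • adL Y)) Y := by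
  have := intervalIntegral.smul_integral_comp_mul_right (a := 0) (b := 1)
    (fun s => bchKernel (exp (adL X) * exp (s • adL Y)) Y) t
  rw [zero_mul, one_mul] at this
  rw [bch, ← this, ← intervalIntegral.integral_smul]
  simp [adL_smul, smul_smul]

theorem hasDerivAt_bch_smul (X Y : 𝔤) (t : ℝ) :
    HasDerivAt (fun t : ℝ => bch X (t • Y)) (bchKernel (exp (adL X) * exp (t • adL Y)) Y) t := by
  simp only [bch_smul_eq]
  exact (intervalIntegral.integral_hasDerivAt_right
    ((continuous_bch_integrand X Y Y).intervalIntegrable _ _)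
    (continuous_bch_integrand X Y Y).stronglyMeasurable.stronglyMeasurableAtFilter
    (continuous_bch_integrand X Y Y).continuousAt).const_add X

@[simp] theorem bch_zero (X : 𝔤) : bch X 0 = X := by simp [bch]

section Representation

variable {𝔸 : Type*} [NormedRing 𝔸] [NormedAlgebra ℝ 𝔸] [CompleteSpace 𝔸]

/-- Conjugation by exp is the exponential of ad: undoing the conjugation gives a curve with zero
derivative. -/
theorem exp_conj {ρ : 𝔤 →L[ℝ] 𝔸} (hρ : ∀ X Y : 𝔤, ρ ⁅X, Y⁆ = ρ X * ρ Y - ρ Y * ρ X)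
    (X Y : 𝔤) (s : ℝ) :
    exp (s • -ρ X) * ρ Y * exp (s • ρ X) = ρ (exp (s • -adL X) Y) := by
  have h : ∀ s : ℝ, HasDerivAt
      (fun s : ℝ => exp (s • ρ X) * ρ (exp (s • -adL X) Y) * exp (s • -ρ X)) 0 s := fun s => by
    have h1 : HasDerivAt (fun s : ℝ => ρ (exp (s • -adL X) Y))
        (ρ (-⁅X, exp (s • -adL X) Y⁆)) s := by
      have := (hasDerivAt_exp_smul' (-adL X) s).clm_apply (hasDerivAt_const s Y)
      refine (ρ.hasFDerivAt.comp_hasDerivAt s this).congr_deriv ?_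
      simp
    refine (((hasDerivAt_exp_smul (ρ X) s).mul h1).mul
      (hasDerivAt_exp_smul' (-ρ X) s)).congr_deriv ?_
    rw [map_neg, hρ, Pi.mul_apply]
    noncomm_ring
  have := is_const_of_deriv_eq_zero (fun s => (h s).differentiableAt) (fun s => (h s).deriv) s 0
  simp only [zero_smul, exp_zero, one_mul, mul_one, one_apply_eq_self] at this
  rw [← this]
  simp only [mul_assoc, exp_smul_neg_mul, mul_one]
  rw [← mul_assoc, exp_smul_neg_mul, one_mul]

theorem hasDerivAt_exp_rep {ρ : 𝔤 →L[ℝ] 𝔸} (hρ : ∀ X Y : 𝔤, ρ ⁅X, Y⁆ = ρ X * ρ Y - ρ Y * ρ X)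
    {γ : ℝ → 𝔤} {γ' : 𝔤} {t : ℝ} (h : HasDerivAt γ γ' t) :
    HasDerivAt (fun t => exp (ρ (γ t))) (exp (ρ (γ t)) * ρ (expInt (adL (γ t)) 1 γ')) t := by
  refine (hasDerivAt_exp_curve (ρ.hasFDerivAt.comp_hasDerivAt t h)).congr_deriv ?_
  simp only [Function.comp, exp_conj hρ, expInt_apply]
  rw [ρ.intervalIntegral_comp_comm]
  exact (continuous_exp_smul_apply _ _).intervalIntegrable _ _

end Representation

/-- The curve `t ↦ bch X (t Y)` is an integral curve of the left-invariant vector field of `Y`. -/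
theorem expInt_deriv_bch [LieRing.IsNilpotent 𝔤] (X Y : 𝔤) (t : ℝ) :
    expInt (adL (bch X (t • Y))) 1 (bchKernel (exp (adL X) * exp (t • adL Y)) Y) = Y := by
  set γ : ℝ → 𝔤 := fun t => bch X (t • Y)
  set om : ℝ → 𝔤 := fun t => expInt (adL (γ t)) 1 (bchKernel (exp (adL X) * exp (t • adL Y)) Y)
  -- Bootstrap along the lower central series. If the logarithmic derivative `om` of the curve is
  -- `Y` modulo level i, then e^(ad γ(t)) agrees with e^(ad X)e^(t ad Y) modulo level i + 1, because
  -- ad raises the level. The kernels at these two operators then agree to the same order, and so do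
  -- `om` and `Y`.
  have key : ∀ i, ∀ t, om t - Y ∈ lcs 𝔤 i := fun i => by
    induction i with
    | zero => simp [lcs_zero]
    | succ i ih =>
      have hN : ∀ t, HasDerivAt (fun t => exp (adL (γ t)) * exp (t • -adL Y) * exp (-adL X))
          (exp (adL (γ t)) * adL (om t - Y) * exp (t • -adL Y) * exp (-adL X)) t := fun t => by
        have h1 := hasDerivAt_exp_rep (ρ := adCLM 𝔤) adL_lie (hasDerivAt_bch_smul X Y t)
        refine ((h1.mul (hasDerivAt_exp_smul' (-adL Y) t)).mul_const (exp (-adL X))).congr_deriv ?_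
        have : adL (om t - Y) = adL (om t) - adL Y := by rw [sub_eq_add_neg, adL_add, adL_neg]; abel
        rw [this]
        simp only [adCLM_apply, om, γ]
        noncomm_ring
      have h2 : ∀ t x, (exp (adL (γ t)) - exp (adL X) * exp (t • adL Y)) x ∈ lcs 𝔤 (i + 1) := by
        intro t x
        set w := (exp (adL X) * exp (t • adL Y)) x with hw
        have h3 := sub_mem_of_hasDerivAt_mem (lcs 𝔤 (i + 1))
          (fun t => (hN t).clm_apply (hasDerivAt_const t w)) (fun t => ?_) 0 t
        · have h5 : exp (t • -adL Y) * exp (-adL X) * (exp (adL X) * exp (t • adL Y)) = 1 := by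
            rw [mul_assoc, ← mul_assoc (exp (-adL X)), exp_neg_mul_exp, one_mul, exp_smul_neg_mul]
          have h6 : (exp (adL (γ t)) * exp (t • -adL Y) * exp (-adL X)) w = exp (adL (γ t)) x := by
            rw [hw, ← mul_apply_eq_comp, mul_assoc, mul_assoc, ← mul_assoc (exp (t • -adL Y)),
              h5, mul_one]
          have h7 : (exp (adL (γ 0)) * exp ((0 : ℝ) • -adL Y) * exp (-adL X)) w = w := by
            simp only [γ, zero_smul, bch_zero, exp_zero, mul_one, exp_mul_exp_neg, one_apply_eq_self]
          rw [h6, h7, hw] at h3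
          exact h3
        · simp only [mul_apply_eq_comp, map_zero, add_zero]
          exact exp_apply_mem (fun x hx => lcs_succ_le _ (lie_mem_lcs_succ _ hx))
            (lie_mem_lcs_succ' (ih t) _)
      intro t
      -- `Y` is rewritten as `expInt` applied to the kernel at e^(ad γ(t)), so that only a
      -- difference of two kernels remains.
      have h4 : om t - Y = expInt (adL (γ t)) 1
          (logKernel _ (Module.finrank ℝ 𝔤) (exp (adL X) * exp (t • adL Y) - 1) Y
            - logKernel _ (Module.finrank ℝ 𝔤) (exp (adL (γ t)) - 1) Y) := by
        have := congrArg (fun A : 𝔤 →L[ℝ] 𝔤 => A Y) (expInt_bchKernel (γ t))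
        simp only [mul_apply_eq_comp, one_apply_eq_self] at this
        rw [map_sub]
        refine congrArg₂ _ rfl this.symm
      rw [h4]
      refine expInt_apply_mem (fun x hx => lcs_succ_le _ (lie_mem_lcs_succ _ hx)) ?_ 1
      refine logKernel_apply_sub_logKernel_apply_mem _ (fun x hx => ?_) (fun x => ?_) Y
      · rw [← adL_smul]
        exact lcs_succ_le _ (exp_mul_exp_sub_mem_lcs X (t • Y) hx)
      · have := (lcs 𝔤 (i + 1)).neg_mem (h2 t x)
        simpa using this
  have := key (Module.finrank ℝ 𝔤) t
  rw [lcs_finrank le_rfl] at this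
  simpa [sub_eq_zero] using this

/-- By `expInt_deriv_bch`, t ↦ exp ρ(bch X (tY)) solves the same equation as t ↦ exp ρ(X)
exp(tρ(Y)); hence their quotient is constant. -/
theorem exp_rep_bch [LieRing.IsNilpotent 𝔤] {𝔸 : Type*} [NormedRing 𝔸] [NormedAlgebra ℝ 𝔸]
    [CompleteSpace 𝔸] {ρ : 𝔤 →L[ℝ] 𝔸} (hρ : ∀ X Y : 𝔤, ρ ⁅X, Y⁆ = ρ X * ρ Y - ρ Y * ρ X)
    (X Y : 𝔤) : exp (ρ (bch X Y)) = exp (ρ X) * exp (ρ Y) := by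
  have h : ∀ t : ℝ, HasDerivAt (fun t : ℝ => exp (ρ (bch X (t • Y))) * exp (t • -ρ Y)) 0 t :=
    fun t => by
      have h1 := hasDerivAt_exp_rep hρ (hasDerivAt_bch_smul X Y t)
      rw [expInt_deriv_bch] at h1
      refine (h1.mul (hasDerivAt_exp_smul' (-ρ Y) t)).congr_deriv ?_
      noncomm_ring
  have := is_const_of_deriv_eq_zero (fun s => (h s).differentiableAt) (fun s => (h s).deriv) 1 0
  simp only [one_smul, zero_smul, bch_zero, exp_zero, mul_one] at this
  rw [← this, mul_assoc, exp_neg_mul_exp, mul_one]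

end MetricLieAlgebra

open NormedSpace

/-! ### Naturality of exponentials and kernels, and injectivity of exp on nilpotent elements. -/

section Intertwine

variable {V W : Type*} [NormedAddCommGroup V] [NormedSpace ℝ V] [CompleteSpace V]
  [NormedAddCommGroup W] [NormedSpace ℝ W] [CompleteSpace W]

omit [CompleteSpace V] [CompleteSpace W] in
theorem map_pow_apply {φ : V →L[ℝ] W} {A : V →L[ℝ] V} {B : W →L[ℝ] W}
    (h : ∀ x, φ (A x) = B (φ x)) (m : ℕ) (x : V) : φ ((A ^ m) x) = (B ^ m) (φ x) := by
  induction m generalizing x with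
  | zero => simp
  | succ m ih => rw [pow_succ, pow_succ, mul_apply_eq_comp, mul_apply_eq_comp, ih, h]

theorem map_exp_apply {φ : V →L[ℝ] W} {A : V →L[ℝ] V} {B : W →L[ℝ] W}
    (h : ∀ x, φ (A x) = B (φ x)) (x : V) : φ (exp A x) = exp B (φ x) := by
  have h1 := ((exp_series_hasSum_exp' (𝕂 := ℝ) A).mapL (ContinuousLinearMap.apply ℝ V x)).mapL φ
  have h2 := (exp_series_hasSum_exp' (𝕂 := ℝ) B).mapL (ContinuousLinearMap.apply ℝ W (φ x))
  simp only [map_smul, ContinuousLinearMap.apply_apply, map_pow_apply h] at h1 h2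
  exact h1.unique h2

theorem map_logKernel_apply {φ : V →L[ℝ] W} {A : V →L[ℝ] V} {B : W →L[ℝ] W}
    (h : ∀ x, φ (A x) = B (φ x)) (N : ℕ) (x : V) :
    φ (logKernel (V →L[ℝ] V) N A x) = logKernel (W →L[ℝ] W) N B (φ x) := by
  simp only [logKernel, add_apply, one_apply_eq_self, sum_apply, smul_apply, map_add, map_sum,
    map_smul, map_pow_apply h]

end Intertwine

/-- e^(sa) - 1 is `a` times an element that commutes with `a`. -/
theorem exp_sub_one_pow_eq_zero {𝔸 : Type*} [NormedRing 𝔸] [NormedAlgebra ℝ 𝔸] [CompleteSpace 𝔸]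
    {a : 𝔸} {N : ℕ} (h : a ^ N = 0) (s : ℝ) : (exp (s • a) - 1) ^ N = 0 := by
  have h1 := mul_expInt (-a) s
  have h2 : exp (s • a) - 1 = a * expInt (-a) s := by
    rw [neg_mul, neg_neg] at h1
    rw [← neg_sub, ← h1, neg_neg]
  have hc : Commute a (expInt (-a) s) := by
    have h : ∀ s : ℝ, HasDerivAt (fun s => a * expInt (-a) s - expInt (-a) s * a) 0 s := fun s => by
      have hca := (hasDerivAt_exp_smul a s).unique (hasDerivAt_exp_smul' a s)
      refine (((hasDerivAt_expInt (-a) s).const_mul a).sub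
        ((hasDerivAt_expInt (-a) s).mul_const a)).congr_deriv ?_
      rw [neg_neg, hca, sub_self]
    have := is_const_of_deriv_eq_zero (fun s => (h s).differentiableAt) (fun s => (h s).deriv) s 0
    simp only [expInt_zero, mul_zero, zero_mul, sub_self, sub_eq_zero] at this
    exact this
  rw [h2, hc.mul_pow, h, zero_mul]

theorem exp_injOn_nilpotent {𝔸 : Type*} [NormedRing 𝔸] [NormedAlgebra ℝ 𝔸] [CompleteSpace 𝔸]
    {a b : 𝔸} {N : ℕ} (ha : a ^ N = 0) (hb : b ^ N = 0) (h : exp a = exp b) : a = b := by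
  have h1 := log_exp (exp_sub_one_pow_eq_zero ha) 1
  have h2 := log_exp (exp_sub_one_pow_eq_zero hb) 1
  rw [one_smul] at h1 h2
  rw [← h1, ← h2, h]

/-! ### Functoriality of `bch` and its behaviour modulo subspaces. -/

namespace MetricLieAlgebra

variable {𝔤 : MetricLieAlgebra.{u}}

/-- The truncation order may be raised freely. A homomorphism relates algebras of different
dimensions, and `map_bch` needs a common order for both. -/
theorem bchKernel_eq_logKernel [LieRing.IsNilpotent 𝔤] {N : ℕ} (hN : Module.finrank ℝ 𝔤 ≤ N)
    (X Y : 𝔤) : bchKernel (exp (adL X) * exp (adL Y))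
      = logKernel (𝔤 →L[ℝ] 𝔤) N (exp (adL X) * exp (adL Y) - 1) := by
  unfold bchKernel logKernel
  congr 1
  refine Finset.sum_subset (Finset.Icc_subset_Icc_right hN) fun m _ hm => ?_
  rw [pow_eq_zero_of_lcs (fun _ _ hx => exp_mul_exp_sub_mem_lcs X Y hx), smul_zero]
  simp only [Finset.mem_Icc] at *
  omega

theorem map_bch {𝔥 : MetricLieAlgebra.{v}} [LieRing.IsNilpotent 𝔤] [LieRing.IsNilpotent 𝔥]
    (φ : 𝔤 →ₗ⁅ℝ⁆ 𝔥) (X Y : 𝔤) : φ (bch X Y) = bch (φ X) (φ Y) := by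
  set φL : 𝔤 →L[ℝ] 𝔥 := LinearMap.toContinuousLinearMap (φ : 𝔤 →ₗ[ℝ] 𝔥) with hφL
  have hφ : ∀ x, φL x = φ x := fun _ => rfl
  have hexp : ∀ X x : 𝔤, φL (exp (adL X) x) = exp (adL (φ X)) (φL x) := fun X x =>
    map_exp_apply (fun x => by simp [hφ]) x
  set N := max (Module.finrank ℝ 𝔤) (Module.finrank ℝ 𝔥)
  rw [bch, bch, map_add, ← hφ (∫ _ in _.._, _), ← φL.intervalIntegral_comp_comm]
  · congr 1
    refine intervalIntegral.integral_congr fun t _ => ?_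
    simp only [← adL_smul]
    rw [bchKernel_eq_logKernel (le_max_left _ _ : _ ≤ N), bchKernel_eq_logKernel (le_max_right _ _ : _ ≤ N)]
    rw [map_logKernel_apply (φ := φL) (B := exp (adL (φ X)) * exp (adL (t • φ Y)) - 1)]
    · rfl
    · intro x
      simp only [sub_apply, map_sub, mul_apply_eq_comp, hexp, one_apply_eq_self, map_smul]
  · exact (continuous_bch_integrand X Y Y).intervalIntegrable _ _

/-- If the commutators of a subalgebra lie in a subspace, then `bch X Y = X + Y` modulo that subspace. -/
theorem bch_sub_mem {𝔥 W : Submodule ℝ 𝔤} (hW : W ≤ 𝔥)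
    (hlie : ∀ X ∈ 𝔥, ∀ Y ∈ 𝔥, ⁅X, Y⁆ ∈ W) {X Y : 𝔤} (hX : X ∈ 𝔥) (hY : Y ∈ 𝔥) :
    bch X Y - X - Y ∈ W := by
  have h1 : ∀ t : ℝ, bchKernel (exp (adL X) * exp (t • adL Y)) Y - Y ∈ W := fun t => by
    refine logKernel_apply_sub_mem _ hW (fun x hx => ?_) hY
    have h2 : exp (t • adL Y) x - x ∈ W := by
      rw [← adL_smul]
      exact exp_apply_sub_mem hW (fun x hx => hlie _ (𝔥.smul_mem t hY) x hx) hx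
    have h3 := exp_apply_sub_mem (A := adL X) hW (fun x hx => hlie _ hX x hx)
      ((𝔥.sub_mem_iff_left hx).1 (hW h2))
    have := W.add_mem h2 h3
    simpa using this
  have h2 := intervalIntegral_mem W ((continuous_bch_integrand X Y Y).sub continuous_const) h1 0 1
  simp only [Pi.sub_apply] at h2
  rw [intervalIntegral.integral_sub ((continuous_bch_integrand X Y Y).intervalIntegrable _ _)
    intervalIntegrable_const] at h2
  simpa [bch] using h2

theorem bch_mem {𝔥 : Submodule ℝ 𝔤} (hlie : ∀ X ∈ 𝔥, ∀ Y ∈ 𝔥, ⁅X, Y⁆ ∈ 𝔥) {X Y : 𝔤}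
    (hX : X ∈ 𝔥) (hY : Y ∈ 𝔥) : bch X Y ∈ 𝔥 := by
  have := 𝔥.add_mem (bch_sub_mem le_rfl hlie hX hY) (𝔥.add_mem hX hY)
  simpa using this

/-- Apply `bch_sub_mem` with the kernel of `l` in `𝔥` as the subspace that receives the commutators.
This yields both the character of M and the additivity of tower coordinates. -/
theorem map_bch_eq_add {𝔥 : Submodule ℝ 𝔤} (hlie : ∀ X ∈ 𝔥, ∀ Y ∈ 𝔥, ⁅X, Y⁆ ∈ 𝔥) (l : 𝔤 →ₗ[ℝ] ℝ)
    (hl : ∀ X ∈ 𝔥, ∀ Y ∈ 𝔥, l ⁅X, Y⁆ = 0) {X Y : 𝔤}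
    (hX : X ∈ 𝔥) (hY : Y ∈ 𝔥) : l (bch X Y) = l X + l Y := by
  have := (bch_sub_mem (W := 𝔥 ⊓ LinearMap.ker l) inf_le_left
    (fun X hX Y hY => ⟨hlie X hX Y hY, hl X hX Y hY⟩) hX hY).2
  have : l (bch X Y - X - Y) = 0 := this
  rw [map_sub, map_sub] at this
  linarith

theorem bch_eq_add {X Y : 𝔤} (h : ⁅X, Y⁆ = 0) : bch X Y = X + Y := by
  have hs : ∀ A ∈ Submodule.span ℝ {X, Y}, ∀ B ∈ Submodule.span ℝ {X, Y}, ⁅A, B⁆ ∈ (⊥ : Submodule ℝ 𝔤) := by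
    intro A hA B hB
    obtain ⟨a, b, rfl⟩ := Submodule.mem_span_pair.1 hA
    obtain ⟨c, d, rfl⟩ := Submodule.mem_span_pair.1 hB
    have h' : ⁅Y, X⁆ = 0 := by rw [← lie_skew, h, neg_zero]
    simp [h, h']
  have := bch_sub_mem bot_le hs (Submodule.subset_span (by simp : X ∈ ({X, Y} : Set 𝔤)))
    (Submodule.subset_span (by simp : Y ∈ ({X, Y} : Set 𝔤)))
  rw [Submodule.mem_bot, sub_sub, sub_eq_zero] at this
  exact this

@[simp] theorem zero_bch (X : 𝔤) : bch 0 X = X := by rw [bch_eq_add (by simp), zero_add]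

theorem smul_bch_smul (s t : ℝ) (X : 𝔤) : bch (s • X) (t • X) = (s + t) • X := by
  rw [bch_eq_add (by simp), add_smul]

end MetricLieAlgebra

open NormedSpace

namespace MetricLieAlgebra

variable {𝔤 : MetricLieAlgebra.{u}}

/-! ### The Rees algebra of the lower central series -/

theorem lie_mem_lcs_add (i : ℕ) : ∀ (j : ℕ) {X Y : 𝔤}, X ∈ lcs 𝔤 i → Y ∈ lcs 𝔤 j →
    ⁅X, Y⁆ ∈ lcs 𝔤 (i + j + 1) := by
  induction i with
  | zero => intro j X Y _ hY; rw [zero_add]; exact lie_mem_lcs_succ X hY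
  | succ i ih =>
    intro j X Y hX hY
    have hX' : X ∈ Submodule.span ℝ {W : 𝔤 | ∃ (A : 𝔤), ∃ B ∈ lcs 𝔤 i, ⁅A, B⁆ = W} := by
      rw [lcs, LieModule.lowerCentralSeries_succ, LieSubmodule.lieIdeal_oper_eq_linear_span] at hX
      refine Submodule.span_mono ?_ hX
      rintro W ⟨A, B, rfl⟩
      exact ⟨A, B, B.2, rfl⟩
    clear hX
    induction hX' using Submodule.span_induction with
    | mem W hW =>
      obtain ⟨A, B, hB, rfl⟩ := hW
      rw [lie_lie]
      refine Submodule.sub_mem _ ?_ ?_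
      · have := lie_mem_lcs_succ A (ih j hB hY)
        rwa [show i + j + 1 + 1 = i + 1 + j + 1 by ring] at this
      · have := ih (j + 1) hB (lie_mem_lcs_succ A hY)
        rwa [show i + (j + 1) + 1 = i + 1 + j + 1 by ring] at this
    | zero => simp
    | add A B _ _ hA hB => 
      rw [add_lie]; exact Submodule.add_mem _ hA hB
    | smul t A _ hA => rw [smul_lie]; exact Submodule.smul_mem _ _ hA

variable (𝔤) in
-- The index is shifted by one, so that brackets respect the sum of the degrees and degree zero is
-- trivial; all degrees that occur are then positive.
def reesFiltration : ℕ → Submodule ℝ 𝔤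
  | 0 => ⊥
  | i + 1 => lcs 𝔤 i

theorem lie_mem_reesFiltration {i j : ℕ} {X Y : 𝔤} (hX : X ∈ reesFiltration 𝔤 i)
    (hY : Y ∈ reesFiltration 𝔤 j) : ⁅X, Y⁆ ∈ reesFiltration 𝔤 (i + j) := by
  rcases i with _ | i
  · rw [reesFiltration, Submodule.mem_bot] at hX
    simp [hX]
  rcases j with _ | j
  · rw [reesFiltration, Submodule.mem_bot] at hY
    simp [hY]
  have := lie_mem_lcs_add i j hX hY
  rwa [show i + 1 + (j + 1) = (i + j + 1) + 1 by ring]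

theorem eq_zero_of_mem_reesFiltration [LieRing.IsNilpotent 𝔤] {i : ℕ}
    (hi : Module.finrank ℝ 𝔤 < i) {X : 𝔤} (hX : X ∈ reesFiltration 𝔤 i) : X = 0 := by
  obtain ⟨i, rfl⟩ := Nat.exists_eq_succ_of_ne_zero (by omega : i ≠ 0)
  have := lcs_finrank (𝔤 := 𝔤) (N := i) (by omega)
  rw [reesFiltration, this] at hX
  simpa using hX

open Finset in
/-- The bracket of two sequences as generating polynomials. -/
def convLie (x y : ℕ → 𝔤) (k : ℕ) : 𝔤 := ∑ p ∈ antidiagonal k, ⁅x p.1, y p.2⁆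

open Finset in
theorem convLie_self (x : ℕ → 𝔤) : convLie x x = 0 := by
  ext k
  have h : convLie x x k = -convLie x x k := by
    conv_lhs => rw [convLie, ← Finset.Nat.sum_antidiagonal_swap]
    rw [convLie, ← sum_neg_distrib]
    exact sum_congr rfl fun p _ => by simp
  have : IsAddTorsionFree 𝔤 := .of_isTorsionFree ℝ 𝔤
  exact self_eq_neg.1 h

open Finset in
theorem convLie_leibniz (x y z : ℕ → 𝔤) :
    convLie x (convLie y z) = convLie (convLie x y) z + convLie y (convLie x z) := by
  ext k
  simp only [convLie, Pi.add_apply, lie_sum, sum_lie, sum_sigma']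
  have e1 : ∑ p ∈ (antidiagonal k).sigma fun p => antidiagonal p.1,
      ⁅⁅x p.2.1, y p.2.2⁆, z p.1.2⁆ = ∑ p ∈ (antidiagonal k).sigma fun p => antidiagonal p.2,
      ⁅⁅x p.1.1, y p.2.1⁆, z p.2.2⁆ := by
    apply sum_nbij' (fun ⟨⟨_i, j⟩, ⟨k, l⟩⟩ ↦ ⟨(k, l + j), (l, j)⟩)
      (fun ⟨⟨i, _j⟩, ⟨k, l⟩⟩ ↦ ⟨(i + k, l), (i, k)⟩) <;> simp <;> grind
  have e2 : ∑ p ∈ (antidiagonal k).sigma fun p => antidiagonal p.2,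
      ⁅y p.1.1, ⁅x p.2.1, z p.2.2⁆⁆ = ∑ p ∈ (antidiagonal k).sigma fun p => antidiagonal p.2,
      ⁅y p.2.1, ⁅x p.1.1, z p.2.2⁆⁆ := by
    apply sum_nbij' (fun ⟨⟨i, _j⟩, ⟨k, l⟩⟩ ↦ ⟨(k, i + l), (i, l)⟩)
      (fun ⟨⟨i, _j⟩, ⟨k, l⟩⟩ ↦ ⟨(k, i + l), (i, l)⟩) <;> simp <;> grind
  rw [e1, e2, ← sum_add_distrib]
  exact sum_congr rfl fun p _ => leibniz_lie _ _ _

variable (𝔤) in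
def reesSubmodule : Submodule ℝ (ℕ → 𝔤) where
  carrier := {x | ∀ i, x i ∈ reesFiltration 𝔤 i}
  add_mem' hx hy i := Submodule.add_mem _ (hx i) (hy i)
  zero_mem' _ := Submodule.zero_mem _
  smul_mem' t _x hx i := Submodule.smul_mem _ t (hx i)

theorem convLie_mem {x y : ℕ → 𝔤} (hx : x ∈ reesSubmodule 𝔤) (hy : y ∈ reesSubmodule 𝔤) :
    convLie x y ∈ reesSubmodule 𝔤 := fun k =>
  Submodule.sum_mem _ fun p hp => by
    rw [← Finset.HasAntidiagonal.mem_antidiagonal.1 hp]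
    exact lie_mem_reesFiltration (hx _) (hy _)

instance [LieRing.IsNilpotent 𝔤] : FiniteDimensional ℝ (reesSubmodule 𝔤) := by
  refine FiniteDimensional.of_injective (V₂ := Fin (Module.finrank ℝ 𝔤 + 1) → 𝔤)
    ({ toFun := fun x i => x.1 i, map_add' := fun _ _ => rfl, map_smul' := fun _ _ => rfl } :
      reesSubmodule 𝔤 →ₗ[ℝ] Fin (Module.finrank ℝ 𝔤 + 1) → 𝔤) fun x y h => ?_
  ext i
  by_cases hi : i < Module.finrank ℝ 𝔤 + 1
  · exact congrFun h ⟨i, hi⟩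
  · rw [eq_zero_of_mem_reesFiltration (by omega) (x.2 i),
      eq_zero_of_mem_reesFiltration (by omega) (y.2 i)]

variable (𝔤) in
-- Serves only to equip the space of sequences with an inner product, which `MetricLieAlgebra`
-- demands; its choice is irrelevant.
def reesEquiv [LieRing.IsNilpotent 𝔤] :
    EuclideanSpace ℝ (Fin (Module.finrank ℝ (reesSubmodule 𝔤))) ≃ₗ[ℝ] reesSubmodule 𝔤 :=
  LinearEquiv.ofFinrankEq _ _ (by simp)

theorem convLie_add_left (x y z : ℕ → 𝔤) : convLie (x + y) z = convLie x z + convLie y z := by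
  ext k; simp [convLie, Finset.sum_add_distrib]

theorem convLie_add_right (x y z : ℕ → 𝔤) : convLie x (y + z) = convLie x y + convLie x z := by
  ext k; simp [convLie, Finset.sum_add_distrib]

theorem convLie_smul_left (t : ℝ) (x y : ℕ → 𝔤) : convLie (t • x) y = t • convLie x y := by
  ext k; simp [convLie, Finset.smul_sum]

theorem convLie_smul_right (t : ℝ) (x y : ℕ → 𝔤) : convLie x (t • y) = t • convLie x y := by
  ext k; simp [convLie, Finset.smul_sum]

variable (𝔤) in
/-- The Rees algebra of the lower central series. -/
def rees [LieRing.IsNilpotent 𝔤] : MetricLieAlgebra.{0} where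
  carrier := EuclideanSpace ℝ (Fin (Module.finrank ℝ (reesSubmodule 𝔤)))
  bracket := LinearMap.mk₂ ℝ
    (fun x y => (reesEquiv 𝔤).symm ⟨convLie (reesEquiv 𝔤 x).1 (reesEquiv 𝔤 y).1,
      convLie_mem (reesEquiv 𝔤 x).2 (reesEquiv 𝔤 y).2⟩)
    (fun x y z => by rw [← map_add]; congr 1; ext1; simp [convLie_add_left])
    (fun t x y => by rw [← map_smul]; congr 1; ext1; simp [convLie_smul_left])
    (fun x y z => by rw [← map_add]; congr 1; ext1; simp [convLie_add_right])
    (fun t x y => by rw [← map_smul]; congr 1; ext1; simp [convLie_smul_right])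
  bracket_self x := by
    simp only [LinearMap.mk₂_apply, convLie_self]
    exact map_zero _
  leibniz x y z := by
    simp only [LinearMap.mk₂_apply, LinearEquiv.apply_symm_apply]
    rw [← map_add]
    congr 1
    ext1
    exact convLie_leibniz _ _ _

variable [LieRing.IsNilpotent 𝔤]

variable (𝔤) in
def reesCoeff : rees 𝔤 →ₗ[ℝ] ℕ → 𝔤 := (reesSubmodule 𝔤).subtype ∘ₗ (reesEquiv 𝔤).toLinearMap

theorem reesCoeff_lie (x y : rees 𝔤) :
    reesCoeff 𝔤 ⁅x, y⁆ = convLie (reesCoeff 𝔤 x) (reesCoeff 𝔤 y) := by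
  change ((reesEquiv 𝔤 ((reesEquiv 𝔤).symm _) : reesSubmodule 𝔤) : ℕ → 𝔤) = _
  rw [LinearEquiv.apply_symm_apply]
  rfl

theorem reesCoeff_injective : Function.Injective (reesCoeff 𝔤) :=
  Subtype.val_injective.comp (reesEquiv 𝔤).injective

theorem reesCoeff_mem (x : rees 𝔤) (i : ℕ) : reesCoeff 𝔤 x i ∈ reesFiltration 𝔤 i :=
  (reesEquiv 𝔤 x).2 i

theorem reesCoeff_zero_right (x : rees 𝔤) : reesCoeff 𝔤 x 0 = 0 := by
  simpa [reesFiltration] using reesCoeff_mem x 0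

theorem reesCoeff_eq_zero (x : rees 𝔤) {i : ℕ} (hi : Module.finrank ℝ 𝔤 < i) :
    reesCoeff 𝔤 x i = 0 :=
  eq_zero_of_mem_reesFiltration hi (reesCoeff_mem x i)

theorem exists_reesCoeff_eq {x : ℕ → 𝔤} (hx : x ∈ reesSubmodule 𝔤) : ∃ y, reesCoeff 𝔤 y = x :=
  ⟨(reesEquiv 𝔤).symm ⟨x, hx⟩, by
    change ((reesEquiv 𝔤 ((reesEquiv 𝔤).symm _) : reesSubmodule 𝔤) : ℕ → 𝔤) = _
    rw [LinearEquiv.apply_symm_apply]⟩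

/-- `F m` consists of the elements without terms of degree at most m. Every element has positive
degrees only, so a bracket moves `F m` into `F (m + 1)`, and no degree exceeds dim 𝔤. -/
instance : LieRing.IsNilpotent (rees 𝔤) := by
  let F : ℕ → LieSubmodule ℝ (rees 𝔤) (rees 𝔤) := fun m =>
    { carrier := {x | ∀ i ≤ m, reesCoeff 𝔤 x i = 0}
      add_mem' := fun hx hy i hi => by simp [hx i hi, hy i hi]
      zero_mem' := fun i _ => by simp
      smul_mem' := fun t x hx i hi => by simp [hx i hi]
      lie_mem := fun {x y} hy k hk => by
        rw [reesCoeff_lie]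
        refine Finset.sum_eq_zero fun p hp => ?_
        rw [hy p.2 ((Finset.HasAntidiagonal.antidiagonal.snd_le hp).trans hk), lie_zero] }
  have hF : ∀ m, LieModule.lowerCentralSeries ℝ (rees 𝔤) (rees 𝔤) m ≤ F m := fun m => by
    induction m with
    | zero =>
      intro x _ i hi
      obtain rfl : i = 0 := by omega
      exact reesCoeff_zero_right x
    | succ m ih =>
      rw [LieModule.lowerCentralSeries_succ, LieSubmodule.lie_le_iff]
      intro x _ y hy k hk
      rw [reesCoeff_lie]
      refine Finset.sum_eq_zero fun p hp => ?_
      rcases Nat.eq_zero_or_pos p.1 with h | h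
      · rw [h, reesCoeff_zero_right, zero_lie]
      · have := Finset.HasAntidiagonal.mem_antidiagonal.1 hp
        rw [ih hy p.2 (by omega), lie_zero]
  refine LieModule.IsNilpotent.mk (R := ℝ) (L := rees 𝔤) (M := rees 𝔤) (k := Module.finrank ℝ 𝔤) (eq_bot_iff.2 fun x hx => ?_)
  rw [LieSubmodule.mem_bot]
  refine reesCoeff_injective (funext fun i => ?_)
  rw [map_zero]
  by_cases hi : i ≤ Module.finrank ℝ 𝔤
  · exact hF _ hx i hi
  · exact reesCoeff_eq_zero x (by omega)

variable (𝔤) in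
-- Evaluation of the generating polynomial at 1. The range contains every degree with a nonzero
-- coefficient, and always the degree 1 that gives surjectivity.
def reesEval : rees 𝔤 →ₗ⁅ℝ⁆ 𝔤 where
  toFun x := ∑ i ∈ Finset.range (Module.finrank ℝ 𝔤 + 2), reesCoeff 𝔤 x i
  map_add' x y := by simp [Finset.sum_add_distrib]
  map_smul' t x := by simp [Finset.smul_sum]
  map_lie' {x y} := by
    set M := Module.finrank ℝ 𝔤 + 2 with hM
    have h1 : ∑ k ∈ Finset.range M, reesCoeff 𝔤 ⁅x, y⁆ k
        = ∑ k ∈ Finset.range (2 * M), reesCoeff 𝔤 ⁅x, y⁆ k := by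
      refine Finset.sum_subset (Finset.range_subset_range.2 (by omega)) fun i _ hi => ?_
      rw [Finset.mem_range] at hi
      exact reesCoeff_eq_zero _ (by omega)
    have h2 : ∀ k, reesCoeff 𝔤 ⁅x, y⁆ k
        = ∑ p ∈ (Finset.range M ×ˢ Finset.range M).filter (fun p => p.1 + p.2 = k),
          ⁅reesCoeff 𝔤 x p.1, reesCoeff 𝔤 y p.2⁆ := fun k => by
      rw [reesCoeff_lie]
      refine (Finset.sum_subset (fun p hp => ?_) fun p _ hp => ?_).symm
      · exact Finset.HasAntidiagonal.mem_antidiagonal.2 (Finset.mem_filter.1 hp).2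
      · by_cases h : p.1 < M
        · have : ¬ p.2 < M := fun h' => hp (by simp_all)
          rw [reesCoeff_eq_zero y (by omega), lie_zero]
        · rw [reesCoeff_eq_zero x (by omega), zero_lie]
    rw [h1, Finset.sum_congr rfl fun k _ => h2 k, Finset.sum_fiberwise_of_maps_to, Finset.sum_product]
    · simp only [lie_sum, sum_lie]
      exact Finset.sum_comm
    · intro p hp
      simp only [Finset.mem_product, Finset.mem_range] at *
      omega

theorem reesEval_surjective : Function.Surjective (reesEval 𝔤) := fun X => by
  obtain ⟨y, hy⟩ := exists_reesCoeff_eq (𝔤 := 𝔤) (x := Pi.single 1 X) fun i => by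
    rcases eq_or_ne i 1 with rfl | h
    · simp [reesFiltration, lcs_zero]
    · simp [h]
  refine ⟨y, ?_⟩
  change ∑ i ∈ Finset.range (Module.finrank ℝ 𝔤 + 2), reesCoeff 𝔤 y i = X
  rw [hy]
  simp [Finset.sum_pi_single']

variable (𝔤) in
/-- The degree derivation of the Rees algebra. -/
def reesDegree : rees 𝔤 →ₗ[ℝ] rees 𝔤 where
  toFun x := (reesEquiv 𝔤).symm ⟨fun i => (i : ℝ) • reesCoeff 𝔤 x i,
    fun i => Submodule.smul_mem _ _ (reesCoeff_mem x i)⟩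
  map_add' x y := by
    refine (congrArg _ (Subtype.ext (funext fun i => ?_))).trans (map_add (reesEquiv 𝔤).symm _ _)
    simp
  map_smul' t x := by
    refine (congrArg _ (Subtype.ext (funext fun i => ?_))).trans (map_smul (reesEquiv 𝔤).symm t _)
    simp [smul_comm t]

theorem reesCoeff_degree (x : rees 𝔤) (i : ℕ) :
    reesCoeff 𝔤 (reesDegree 𝔤 x) i = (i : ℝ) • reesCoeff 𝔤 x i := by
  change ((reesEquiv 𝔤 ((reesEquiv 𝔤).symm _) : reesSubmodule 𝔤) : ℕ → 𝔤) i = _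
  rw [LinearEquiv.apply_symm_apply]

/-- Positivity of the degrees enters here: the derivation multiplies degree i by i ≠ 0. -/
theorem reesDegree_injective : Function.Injective (reesDegree 𝔤) := fun x y h => by
  refine reesCoeff_injective (funext fun i => ?_)
  rcases Nat.eq_zero_or_pos i with rfl | hi
  · rw [reesCoeff_zero_right, reesCoeff_zero_right]
  · have h1 := reesCoeff_degree x i
    rw [h, reesCoeff_degree] at h1
    exact (smul_right_injective 𝔤 (by positivity : (i : ℝ) ≠ 0) h1).symm

theorem reesDegree_lie (x y : rees 𝔤) :
    reesDegree 𝔤 ⁅x, y⁆ = ⁅reesDegree 𝔤 x, y⁆ + ⁅x, reesDegree 𝔤 y⁆ := by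
  refine reesCoeff_injective (funext fun k => ?_)
  rw [reesCoeff_degree, map_add, Pi.add_apply, reesCoeff_lie, reesCoeff_lie, reesCoeff_lie,
    convLie, convLie, convLie, ← Finset.sum_add_distrib, Finset.smul_sum]
  refine Finset.sum_congr rfl fun p hp => ?_
  rw [reesCoeff_degree, reesCoeff_degree, smul_lie, lie_smul, ← add_smul]
  congr 1
  exact_mod_cast (Finset.HasAntidiagonal.mem_antidiagonal.1 hp).symm

/-! ### Faithful affine representations -/

section Affine

variable {𝔥 : MetricLieAlgebra.{v}} {W : Type*} [NormedAddCommGroup W] [NormedSpace ℝ W]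
  [FiniteDimensional ℝ W] (e : W ≃ₗ[ℝ] 𝔥 × ℝ) (D : 𝔥 →ₗ[ℝ] 𝔥)

/-- The affine representation `x ↦ (ad x, D x)` defined by a derivation `D`, on a normed space `W`
that is identified with `𝔥 × ℝ`. -/
def affineRep : 𝔥 →L[ℝ] (W →L[ℝ] W) :=
  LinearMap.toContinuousLinearMap
    { toFun := fun x => LinearMap.toContinuousLinearMap
        { toFun := fun p => e.symm (⁅x, (e p).1⁆ + (e p).2 • D x, 0)
          map_add' := fun p q => by
            rw [← map_add]
            refine congrArg e.symm ?_
            ext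
            · simp only [map_add, Prod.fst_add, lie_add, Prod.snd_add, add_smul]; abel
            · simp
          map_smul' := fun t p => by
            rw [RingHom.id_apply, ← map_smul e.symm]
            refine congrArg e.symm ?_
            refine Prod.ext ?_ ?_ <;> simp [smul_smul] }
      map_add' := fun x y => by
        refine ContinuousLinearMap.ext fun p => ?_
        change e.symm _ = e.symm _ + e.symm _
        rw [← map_add]
        refine congrArg e.symm ?_
        refine Prod.ext ?_ ?_
        · simp only [add_lie, map_add, smul_add, Prod.fst_add]; abel
        · simp
      map_smul' := fun t x => by
        refine ContinuousLinearMap.ext fun p => ?_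
        change e.symm _ = t • e.symm _
        rw [← map_smul e.symm]
        refine congrArg e.symm ?_
        refine Prod.ext ?_ ?_ <;> simp [smul_comm t] }

theorem affineRep_apply (x : 𝔥) (p : W) :
    e (affineRep e D x p) = (⁅x, (e p).1⁆ + (e p).2 • D x, 0) := e.apply_symm_apply _

variable {D}

theorem affineRep_lie (hD : ∀ x y : 𝔥, D ⁅x, y⁆ = ⁅D x, y⁆ + ⁅x, D y⁆) (x y : 𝔥) :
    affineRep e D ⁅x, y⁆ = affineRep e D x * affineRep e D y - affineRep e D y * affineRep e D x := by
  refine ContinuousLinearMap.ext fun p => e.injective ?_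
  rw [sub_apply, mul_apply_eq_comp, mul_apply_eq_comp]
  simp only [map_sub, affineRep_apply, hD, lie_add, lie_lie, lie_smul, zero_smul, add_zero]
  ext1
  · simp only [Prod.fst_sub]
    rw [← lie_skew (D x) y]
    module
  · simp

theorem affineRep_pow [LieRing.IsNilpotent 𝔥] (x : 𝔥) :
    affineRep e D x ^ (Module.finrank ℝ 𝔥 + 1) = 0 := by
  have h : ∀ (m : ℕ) (p : W), e ((affineRep e D x ^ (m + 1)) p)
      = ((adL x ^ m) (⁅x, (e p).1⁆ + (e p).2 • D x), 0) := fun m p => by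
    induction m with
    | zero => simp [affineRep_apply]
    | succ m ih =>
      rw [pow_succ', mul_apply_eq_comp, affineRep_apply, ih, pow_succ', mul_apply_eq_comp]
      simp
  refine ContinuousLinearMap.ext fun p => e.injective ?_
  rw [h, adL_pow_eq_zero]
  simp

/-- The operators are nilpotent, so their exponentials determine them; applied to the vector (0, 1)
they return `D x`, which determines `x`. -/
theorem exp_affineRep_injective [LieRing.IsNilpotent 𝔥] (hDi : Function.Injective D) {x y : 𝔥}
    (h : exp (affineRep e D x) = exp (affineRep e D y)) : x = y := by
  have h1 := exp_injOn_nilpotent (affineRep_pow e x) (affineRep_pow e y) h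
  have h2 := congrArg (fun A : W →L[ℝ] W => e (A (e.symm ((0 : 𝔥), (1 : ℝ))))) h1
  simp only [affineRep_apply, LinearEquiv.apply_symm_apply, lie_zero, one_smul, zero_add,
    Prod.mk.injEq, and_true] at h2
  exact hDi h2

variable (𝔥) in
def affineEquiv : EuclideanSpace ℝ (Fin (Module.finrank ℝ (𝔥 × ℝ))) ≃ₗ[ℝ] 𝔥 × ℝ :=
  LinearEquiv.ofFinrankEq _ _ (by simp)

theorem bch_assoc_of_derivation [LieRing.IsNilpotent 𝔥]
    (hD : ∀ x y : 𝔥, D ⁅x, y⁆ = ⁅D x, y⁆ + ⁅x, D y⁆) (hDi : Function.Injective D) (x y z : 𝔥) :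
    bch (bch x y) z = bch x (bch y z) := by
  apply exp_affineRep_injective (affineEquiv 𝔥) hDi
  simp only [exp_rep_bch (affineRep_lie _ hD), mul_assoc]

theorem bch_bch_neg_of_derivation [LieRing.IsNilpotent 𝔥]
    (hD : ∀ x y : 𝔥, D ⁅x, y⁆ = ⁅D x, y⁆ + ⁅x, D y⁆) (hDi : Function.Injective D) (x y : 𝔥) :
    bch (bch x y) (-x) = exp (adL x) y := by
  apply exp_affineRep_injective (affineEquiv 𝔥) hDi
  set ρ := affineRep (affineEquiv 𝔥) D
  have h2 : ρ (exp (adL x) y) = exp (ρ x) * ρ y * exp (-ρ x) := by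
    have := exp_conj (affineRep_lie (affineEquiv 𝔥) hD) x y (-1)
    simpa using this.symm
  rw [exp_rep_bch (affineRep_lie _ hD), exp_rep_bch (affineRep_lie _ hD), h2, map_neg]
  let _ : NormedAlgebra ℚ (EuclideanSpace ℝ (Fin (Module.finrank ℝ (𝔥 × ℝ))) →L[ℝ]
    EuclideanSpace ℝ (Fin (Module.finrank ℝ (𝔥 × ℝ)))) := NormedAlgebra.restrictScalars ℚ ℝ _
  exact (exp_units_conj ⟨_, _, exp_mul_exp_neg (ρ x), exp_neg_mul_exp (ρ x)⟩ (ρ y)).symm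

end Affine

/-- The adjoint representation kills the center, and `𝔤` itself need not have an injective
derivation. Its Rees algebra has one, the degree, and `bch` descends along the surjection
`reesEval`. -/
theorem bch_assoc (X Y Z : 𝔤) : bch (bch X Y) Z = bch X (bch Y Z) := by
  obtain ⟨x, rfl⟩ := reesEval_surjective X
  obtain ⟨y, rfl⟩ := reesEval_surjective Y
  obtain ⟨z, rfl⟩ := reesEval_surjective Z
  simp only [← map_bch]
  rw [bch_assoc_of_derivation reesDegree_lie reesDegree_injective]

theorem bch_bch_neg (X Y : 𝔤) : bch (bch X Y) (-X) = exp (adL X) Y := by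
  obtain ⟨x, rfl⟩ := reesEval_surjective X
  obtain ⟨y, rfl⟩ := reesEval_surjective Y
  have h1 : exp (adL (reesEval 𝔤 x)) (reesEval 𝔤 y) = reesEval 𝔤 (exp (adL x) y) :=
    (map_exp_apply (φ := LinearMap.toContinuousLinearMap (reesEval 𝔤 : rees 𝔤 →ₗ[ℝ] 𝔤))
      (fun z => LieHom.map_lie (reesEval 𝔤) x z) y).symm
  rw [h1, ← map_neg, ← map_bch, ← map_bch,
    bch_bch_neg_of_derivation reesDegree_lie reesDegree_injective]

end MetricLieAlgebra

/-! ### Smoothness of integrals with a parameter. -/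

section ParametricIntegral

variable {E F : Type*} [NormedAddCommGroup E] [NormedSpace ℝ E] [FiniteDimensional ℝ E]
  [NormedAddCommGroup F] [NormedSpace ℝ F] [CompleteSpace F]

omit [FiniteDimensional ℝ E] [CompleteSpace F] in
theorem hasFDerivAt_partial {f : E × ℝ → F} (hf : ContDiff ℝ ∞ f) (x : E) (t : ℝ) :
    HasFDerivAt (fun x => f (x, t)) ((fderiv ℝ f (x, t)).comp (ContinuousLinearMap.inl ℝ E ℝ)) x :=
  ((hf.differentiable (by simp)).differentiableAt.hasFDerivAt).comp x (hasFDerivAt_prodMk_left x t)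

theorem hasFDerivAt_intervalIntegral {f : E × ℝ → F} (hf : ContDiff ℝ ∞ f) (x : E) :
    HasFDerivAt (fun x => ∫ t in (0 : ℝ)..1, f (x, t))
      (∫ t in (0 : ℝ)..1, (fderiv ℝ f (x, t)).comp (ContinuousLinearMap.inl ℝ E ℝ)) x := by
  have hc : Continuous fun p : E × ℝ => (fderiv ℝ f p).comp (ContinuousLinearMap.inl ℝ E ℝ) :=
    (hf.continuous_fderiv (by simp)).clm_comp continuous_const
  obtain ⟨C, hC⟩ := ((isCompact_closedBall x 1).prod (isCompact_Icc (a := (0 : ℝ)) (b := 1))).exists_bound_of_continuousOn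
    hc.continuousOn
  refine intervalIntegral.hasFDerivAt_integral_of_dominated_of_fderiv_le
    (F' := fun x t => (fderiv ℝ f (x, t)).comp (ContinuousLinearMap.inl ℝ E ℝ))
    (bound := fun _ => C) (Metric.closedBall_mem_nhds x one_pos) ?_ ?_ ?_ ?_ ?_ ?_
  · exact Filter.Eventually.of_forall fun x =>
      (hf.continuous.comp (Continuous.prodMk_right x)).aestronglyMeasurable
  · exact (hf.continuous.comp (Continuous.prodMk_right x)).intervalIntegrable _ _
  · exact (hc.comp (Continuous.prodMk_right x)).aestronglyMeasurable
  · refine Filter.Eventually.of_forall fun t ht y hy => hC (y, t) ⟨hy, ?_⟩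
    rw [Set.uIoc_of_le zero_le_one] at ht
    exact Set.Ioc_subset_Icc_self ht
  · exact intervalIntegrable_const
  · exact Filter.Eventually.of_forall fun t _ y _ => hasFDerivAt_partial hf y t

theorem contDiff_intervalIntegral {f : E × ℝ → F} (hf : ContDiff ℝ ∞ f) :
    ContDiff ℝ ∞ fun x => ∫ t in (0 : ℝ)..1, f (x, t) := by
  rw [contDiff_infty]
  intro n
  induction n generalizing f with
  | zero =>
    exact contDiff_zero.2 (continuous_iff_continuousAt.2 fun x =>
      (hasFDerivAt_intervalIntegral hf x).continuousAt)
  | succ n ih =>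
    push_cast
    rw [contDiff_succ_iff_fderiv_apply]
    refine ⟨fun x => (hasFDerivAt_intervalIntegral hf x).differentiableAt, by simp, fun y => ?_⟩
    have h := ih (f := fun p => fderiv ℝ f p (y, 0))
      ((hf.fderiv_right (by simp)).clm_apply contDiff_const)
    have he : (fun x => fderiv ℝ (fun x => ∫ t in (0 : ℝ)..1, f (x, t)) x y)
        = fun x => ∫ t in (0 : ℝ)..1, fderiv ℝ f (x, t) (y, 0) := funext fun x => ?_
    · rw [he]; exact h
    have hc : Continuous fun t : ℝ => (fderiv ℝ f (x, t)).comp (ContinuousLinearMap.inl ℝ E ℝ) :=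
      ((hf.continuous_fderiv (by simp)).comp (Continuous.prodMk_right x)).clm_comp continuous_const
    rw [(hasFDerivAt_intervalIntegral hf x).fderiv]
    exact (ContinuousLinearMap.intervalIntegral_comp_comm (ContinuousLinearMap.apply ℝ F y)
      (hc.intervalIntegrable 0 1)).symm

end ParametricIntegral

/-! ### Norm bounds for operator exponentials. -/

section ExpBounds

variable {V : Type*} [NormedAddCommGroup V] [NormedSpace ℝ V] [CompleteSpace V]

omit [CompleteSpace V] in
theorem norm_pow_apply_le (A : V →L[ℝ] V) (n : ℕ) (x : V) : ‖(A ^ n) x‖ ≤ ‖A‖ ^ n * ‖x‖ := by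
  induction n with
  | zero => simp
  | succ n ih =>
    rw [pow_succ', mul_apply_eq_comp, pow_succ', mul_assoc]
    exact (A.le_opNorm _).trans (mul_le_mul_of_nonneg_left ih (norm_nonneg _))

theorem norm_exp_apply_le (A : V →L[ℝ] V) (x : V) :
    ‖NormedSpace.exp A x‖ ≤ Real.exp ‖A‖ * ‖x‖ := by
  have h1 := (NormedSpace.exp_series_hasSum_exp' (𝕂 := ℝ) A).mapL (ContinuousLinearMap.apply ℝ V x)
  have h2 : HasSum (fun n : ℕ => ‖A‖ ^ n / n.factorial * ‖x‖) (Real.exp ‖A‖ * ‖x‖) := by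
    rw [Real.exp_eq_exp_ℝ]
    exact (NormedSpace.expSeries_div_hasSum_exp ‖A‖).mul_right _
  refine h1.norm_le_of_bounded h2 fun n => ?_
  simp only [ContinuousLinearMap.apply_apply, smul_apply, norm_smul, norm_inv, Real.norm_natCast]
  rw [div_eq_inv_mul, mul_assoc]
  gcongr
  exact norm_pow_apply_le A n x

theorem norm_exp_apply_sub_le (A : V →L[ℝ] V) (x : V) :
    ‖NormedSpace.exp A x - x‖ ≤ Real.exp ‖A‖ * (‖A‖ * ‖x‖) := by
  have hd : ∀ s : ℝ, HasDerivAt (fun s : ℝ => NormedSpace.exp (s • A) x)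
      (NormedSpace.exp (s • A) (A x)) s := fun s => by
    have := (hasDerivAt_exp_smul A s).clm_apply (hasDerivAt_const s x)
    refine this.congr_deriv ?_
    simp
  have := norm_image_sub_le_of_norm_deriv_le_segment_01' (f := fun s : ℝ => NormedSpace.exp (s • A) x)
    (C := Real.exp ‖A‖ * (‖A‖ * ‖x‖)) (fun s _ => (hd s).hasDerivWithinAt) fun s hs => ?_
  · simpa using this
  · refine (norm_exp_apply_le _ _).trans ?_
    gcongr
    · rw [norm_smul, Real.norm_of_nonneg hs.1]
      exact mul_le_of_le_one_left (norm_nonneg _) hs.2.le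
    · exact A.le_opNorm x

end ExpBounds

/-! ### Smoothness and differentials of the group law. -/

namespace MetricLieAlgebra

variable {𝔤 : MetricLieAlgebra.{u}}

open NormedSpace

theorem contDiff_bch : ContDiff ℝ ∞ fun p : 𝔤 × 𝔤 => bch p.1 p.2 := by
  have hF : ContDiff ℝ ∞ fun q : (𝔤 × 𝔤) × ℝ =>
      bchKernel (exp (adL q.1.1) * exp (q.2 • adL q.1.2)) q.1.2 := by
    have h1 : ContDiff ℝ ∞ fun q : (𝔤 × 𝔤) × ℝ => exp (adL q.1.1) :=
      contDiff_exp_banach.comp ((adCLM 𝔤).contDiff.comp (contDiff_fst.comp contDiff_fst))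
    have h2 : ContDiff ℝ ∞ fun q : (𝔤 × 𝔤) × ℝ => exp (q.2 • adL q.1.2) :=
      contDiff_exp_banach.comp (contDiff_snd.smul
        ((adCLM 𝔤).contDiff.comp (contDiff_snd.comp contDiff_fst)))
    have h3 := h1.mul h2
    refine ContDiff.clm_apply ?_ (contDiff_snd.comp contDiff_fst)
    unfold bchKernel
    exact contDiff_const.add (ContDiff.sum fun m _ => ((h3.sub contDiff_const).pow m).const_smul _)
  exact contDiff_fst.add (contDiff_intervalIntegral hF)

theorem _root_.ContDiff.bch {E : Type*} [NormedAddCommGroup E] [NormedSpace ℝ E] {f g : E → 𝔤}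
    (hf : ContDiff ℝ ∞ f) (hg : ContDiff ℝ ∞ g) : ContDiff ℝ ∞ fun x => bch (f x) (g x) :=
  contDiff_bch.comp (hf.prodMk hg)

theorem continuous_bch : Continuous fun p : 𝔤 × 𝔤 => bch p.1 p.2 := contDiff_bch.continuous

theorem _root_.Continuous.bch {E : Type*} [TopologicalSpace E] {f g : E → 𝔤}
    (hf : Continuous f) (hg : Continuous g) : Continuous fun x => bch (f x) (g x) :=
  continuous_bch.comp (hf.prodMk hg)

variable [LieRing.IsNilpotent 𝔤]

omit [LieRing.IsNilpotent 𝔤] in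
theorem hasFDerivAt_bch_right (X : 𝔤) :
    HasFDerivAt (fun Z : 𝔤 => bch X Z) (bchKernel (exp (adL X))) 0 := by
  have h : DifferentiableAt ℝ (fun Z : 𝔤 => bch X Z) 0 :=
    ((contDiff_const.bch contDiff_id).differentiable (by simp)).differentiableAt
  refine h.hasFDerivAt.congr_fderiv (ContinuousLinearMap.ext fun Y => ?_)
  have h1 : HasDerivAt (fun t : ℝ => bch X (t • Y)) (fderiv ℝ (fun Z : 𝔤 => bch X Z) 0 Y) 0 := by
    have h2 : HasDerivAt (fun t : ℝ => t • Y) Y 0 := by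
      simpa using (hasDerivAt_id (0 : ℝ)).smul_const Y
    have h3 : HasFDerivAt (fun Z : 𝔤 => bch X Z) (fderiv ℝ (fun Z : 𝔤 => bch X Z) 0) ((0 : ℝ) • Y) := by
      rw [zero_smul]; exact h.hasFDerivAt
    exact HasFDerivAt.comp_hasDerivAt (l := fun Z : 𝔤 => bch X Z) (f := fun t : ℝ => t • Y) 0 h3 h2
  have h4 := hasDerivAt_bch_smul X Y 0
  rw [zero_smul, exp_zero, mul_one] at h4
  exact h1.unique h4

theorem bchKernel_expInt (X : 𝔤) : bchKernel (exp (adL X)) * expInt (adL X) 1 = 1 := by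
  have h := expInt_bchKernel X
  have h2 : (expInt (adL X) 1).toLinearMap * (bchKernel (exp (adL X))).toLinearMap = 1 :=
    congrArg ContinuousLinearMap.toLinearMap h
  exact ContinuousLinearMap.coe_injective (mul_eq_one_comm.1 h2)

omit [LieRing.IsNilpotent 𝔤] in
theorem norm_expInt_apply_le (X Y : 𝔤) : ‖expInt (adL X) 1 Y‖ ≤ Real.exp ‖adL X‖ * ‖Y‖ := by
  rw [expInt_apply]
  have := intervalIntegral.norm_integral_le_of_norm_le_const (a := (0 : ℝ)) (b := 1)
    (f := fun v => exp (v • -adL X) Y) (C := Real.exp ‖adL X‖ * ‖Y‖) fun v hv => ?_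
  · simpa using this
  · rw [Set.uIoc_of_le zero_le_one] at hv
    refine (norm_exp_apply_le _ _).trans ?_
    gcongr
    rw [norm_smul, norm_neg, Real.norm_of_nonneg hv.1.le]
    exact mul_le_of_le_one_left (norm_nonneg _) hv.2

omit [LieRing.IsNilpotent 𝔤] in
theorem hasDerivAt_bch_zero {c₁ c₂ : ℝ → 𝔤} {X Y : 𝔤} (h₁ : HasDerivAt c₁ X 0)
    (h₂ : HasDerivAt c₂ Y 0) (h₁0 : c₁ 0 = 0) (h₂0 : c₂ 0 = 0) :
    HasDerivAt (fun s => bch (c₁ s) (c₂ s)) (X + Y) 0 := by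
  have h : HasFDerivAt (fun p : 𝔤 × 𝔤 => bch p.1 p.2)
      (fderiv ℝ (fun p : 𝔤 × 𝔤 => bch p.1 p.2) (c₁ 0, c₂ 0)) (c₁ 0, c₂ 0) :=
    (contDiff_bch.differentiable (by simp)).differentiableAt.hasFDerivAt
  refine (h.comp_hasDerivAt 0 (h₁.prodMk h₂)).congr_deriv ?_
  rw [h₁0, h₂0] at h ⊢
  have e1 : HasFDerivAt (fun x : 𝔤 => bch x 0) _ 0 :=
    HasFDerivAt.comp (f := fun x : 𝔤 => (x, (0 : 𝔤))) (0 : 𝔤) h (hasFDerivAt_prodMk_left _ _)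
  have e2 : HasFDerivAt (fun x : 𝔤 => bch 0 x) _ 0 :=
    HasFDerivAt.comp (f := fun x : 𝔤 => ((0 : 𝔤), x)) (0 : 𝔤) h (hasFDerivAt_prodMk_right _ _)
  simp only [bch_zero, zero_bch] at e1 e2
  have e1' := congrArg (fun A : 𝔤 →L[ℝ] 𝔤 => A X) (e1.unique (hasFDerivAt_id 0))
  have e2' := congrArg (fun A : 𝔤 →L[ℝ] 𝔤 => A Y) (e2.unique (hasFDerivAt_id 0))
  simp only [ContinuousLinearMap.comp_apply, ContinuousLinearMap.inl_apply,
    ContinuousLinearMap.inr_apply, ContinuousLinearMap.id_apply] at e1' e2'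
  conv_rhs => rw [← e1', ← e2', ← map_add]
  simp

end MetricLieAlgebra

namespace MetricLieAlgebra

variable {𝔤 : MetricLieAlgebra.{u}}

open NormedSpace

/-! ### Towers of subalgebras and coordinates of the second kind -/

/-- A chain of subalgebras, each of which contains the commutators of the next and has codimension
at most one in it, with `e j` the unit vector of `𝔥 (j + 1)` orthogonal to `𝔥 j`, or zero. -/
structure IsTower (𝔥 : ℕ → Submodule ℝ 𝔤) (e : ℕ → 𝔤) : Prop where
  lie_mem_zero : ∀ X ∈ 𝔥 0, ∀ Y ∈ 𝔥 0, ⁅X, Y⁆ ∈ 𝔥 0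
  le_succ : ∀ j, 𝔥 j ≤ 𝔥 (j + 1)
  mem : ∀ j, e j ∈ 𝔥 (j + 1)
  sub_mem : ∀ j, ∀ X ∈ 𝔥 (j + 1), X - (inner ℝ (e j) X : ℝ) • e j ∈ 𝔥 j
  inner_eq_zero : ∀ j, ∀ X ∈ 𝔥 j, (inner ℝ (e j) X : ℝ) = 0
  lie_mem : ∀ j, ∀ X ∈ 𝔥 (j + 1), ∀ Y ∈ 𝔥 (j + 1), ⁅X, Y⁆ ∈ 𝔥 j
  norm_le : ∀ j, ‖e j‖ ≤ 1

/-- Division on the right by the one-parameter group of `e`, according to the coordinate of `g`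
along `e`. -/
def strip (e g : 𝔤) : 𝔤 := bch g (-(inner ℝ e g : ℝ) • e)

/-- The product of a function `χ` on the bottom of a tower with functions `ψ j` of the coordinates. -/
def towerProd {M : Type*} [Mul M] (e : ℕ → 𝔤) (χ : 𝔤 → M) (ψ : ℕ → ℝ → M) : ℕ → 𝔤 → M
  | 0, g => χ g
  | j + 1, g => ψ j (inner ℝ (e j) g) * towerProd e χ ψ j (strip (e j) g)

theorem continuous_strip : Continuous fun p : 𝔤 × 𝔤 => strip p.1 p.2 :=
  continuous_snd.bch (by fun_prop)

theorem contDiff_strip (e : 𝔤) : ContDiff ℝ ∞ (strip e) :=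
  contDiff_id.bch (((contDiff_const.inner ℝ contDiff_id).neg).smul contDiff_const)

namespace IsTower

variable {𝔥 : ℕ → Submodule ℝ 𝔤} {e : ℕ → 𝔤} (hT : IsTower 𝔥 e)
include hT

theorem lie_mem_self (j : ℕ) : ∀ X ∈ 𝔥 j, ∀ Y ∈ 𝔥 j, ⁅X, Y⁆ ∈ 𝔥 j := by
  rcases j with _ | j
  · exact hT.lie_mem_zero
  · exact fun X hX Y hY => hT.le_succ j (hT.lie_mem j X hX Y hY)

theorem bch_mem {j : ℕ} {X Y : 𝔤} (hX : X ∈ 𝔥 j) (hY : Y ∈ 𝔥 j) : bch X Y ∈ 𝔥 j :=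
  MetricLieAlgebra.bch_mem (hT.lie_mem_self j) hX hY

theorem zero_le (j : ℕ) : 𝔥 0 ≤ 𝔥 j := by
  induction j with
  | zero => exact le_rfl
  | succ j ih => exact ih.trans (hT.le_succ j)

theorem inner_bch {j : ℕ} {X Y : 𝔤} (hX : X ∈ 𝔥 (j + 1)) (hY : Y ∈ 𝔥 (j + 1)) :
    (inner ℝ (e j) (bch X Y) : ℝ) = inner ℝ (e j) X + inner ℝ (e j) Y :=
  map_bch_eq_add (hT.lie_mem_self (j + 1)) (innerₛₗ ℝ (e j))
    (fun X hX Y hY => hT.inner_eq_zero j _ (hT.lie_mem j X hX Y hY)) hX hY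

theorem strip_mem {j : ℕ} {g : 𝔤} (hg : g ∈ 𝔥 (j + 1)) : strip (e j) g ∈ 𝔥 j := by
  have h1 := bch_sub_mem (hT.le_succ j) (hT.lie_mem j) hg
    ((𝔥 (j + 1)).smul_mem (-(inner ℝ (e j) g : ℝ)) (hT.mem j))
  have h2 := (𝔥 j).add_mem h1 (hT.sub_mem j g hg)
  convert h2 using 1
  rw [strip]
  module

/-- Stripping acts on the right, so it commutes with left multiplication by elements that have no
component along `e j`. -/
theorem strip_bch [LieRing.IsNilpotent 𝔤] {j : ℕ} {Y g : 𝔤} (hY : Y ∈ 𝔥 j) (hg : g ∈ 𝔥 (j + 1)) :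
    (inner ℝ (e j) (bch Y g) : ℝ) = inner ℝ (e j) g ∧
      strip (e j) (bch Y g) = bch Y (strip (e j) g) := by
  have h : (inner ℝ (e j) (bch Y g) : ℝ) = inner ℝ (e j) g := by
    rw [hT.inner_bch (hT.le_succ j hY) hg, hT.inner_eq_zero j Y hY, zero_add]
  exact ⟨h, by rw [strip, h, bch_assoc, strip]⟩

theorem towerProd_bch [LieRing.IsNilpotent 𝔤] {M : Type*} [CommMonoid M] {χ : 𝔤 → M}
    {ψ : ℕ → ℝ → M} (hχ : ∀ X ∈ 𝔥 0, ∀ Y ∈ 𝔥 0, χ (bch X Y) = χ X * χ Y) (j : ℕ) {Y g : 𝔤}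
    (hY : Y ∈ 𝔥 0) (hg : g ∈ 𝔥 j) :
    towerProd e χ ψ j (bch Y g) = χ Y * towerProd e χ ψ j g := by
  induction j generalizing g with
  | zero => exact hχ Y hY g hg
  | succ j ih =>
    obtain ⟨h1, h2⟩ := hT.strip_bch (hT.zero_le j hY) hg
    rw [towerProd, h1, h2, ih (hT.strip_mem hg), towerProd]
    exact mul_left_comm _ _ _

/-- Right translation by a one-parameter group, in the coordinates of a tower. -/
theorem strip_bch_smul [LieRing.IsNilpotent 𝔤] {j : ℕ} {g X : 𝔤} (hg : g ∈ 𝔥 (j + 1))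
    (hX : X ∈ 𝔥 (j + 1)) (s : ℝ) :
    (inner ℝ (e j) (bch g (s • X)) : ℝ) = inner ℝ (e j) g + s * inner ℝ (e j) X ∧
      strip (e j) (bch g (s • X)) = bch (strip (e j) g)
        (bch (s • exp (adL ((inner ℝ (e j) g : ℝ) • e j)) X)
          (-(s * (inner ℝ (e j) X : ℝ)) • e j)) := by
  have h : (inner ℝ (e j) (bch g (s • X)) : ℝ) = inner ℝ (e j) g + s * inner ℝ (e j) X := by
    rw [hT.inner_bch hg ((𝔥 (j + 1)).smul_mem s hX), inner_smul_right]
  refine ⟨h, ?_⟩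
  set τ : ℝ := inner ℝ (e j) g
  set x : ℝ := inner ℝ (e j) X
  rw [← map_smul, ← bch_bch_neg, strip, strip, h]
  -- Stripping turns g exp(sX) into g exp(-τe) · exp(τe) exp(sX) exp(-τe) · exp(-sxe), where e is `e
  -- j`: the stripped g, a conjugate, and a correction.
  have h1 : bch (-τ • e j) (bch (bch (bch (τ • e j) (s • X)) (-(τ • e j))) (-(s * x) • e j))
      = bch (s • X) (-(τ + s * x) • e j) := by
    rw [bch_assoc, bch_assoc, ← bch_assoc (-τ • e j), smul_bch_smul, neg_add_cancel, zero_smul,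
      zero_bch, ← neg_smul, smul_bch_smul]
    congr 2
    ring
  rw [bch_assoc, bch_assoc g, h1]

end IsTower

/-! ### Coherent states -/

/-- The coherent state with the phase of `ζ` and the profile `β` at scale `r`. -/
def wave (ζ : StrongDual ℝ 𝔤) (β : ℝ → ℝ) (r : ℝ) (e : ℕ → 𝔤) : ℕ → 𝔤 → ℂ :=
  towerProd e (fun g => Complex.exp (2 * Real.pi * Complex.I * ζ g))
    (fun j τ => β (τ / r) * Complex.exp (2 * Real.pi * Complex.I * ((τ * ζ (e j) : ℝ) : ℂ)))

/-- The indicator function of the set where all coordinates are at most `r`. -/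
def towerBox (r : ℝ) (e : ℕ → 𝔤) : ℕ → 𝔤 → ℝ :=
  towerProd e (fun _ => 1) (fun _ τ => if |τ| ≤ r then 1 else 0)

theorem towerBox_succ (r : ℝ) (e : ℕ → 𝔤) (j : ℕ) (g : 𝔤) : towerBox r e (j + 1) g
    = (if |(inner ℝ (e j) g : ℝ)| ≤ r then 1 else 0) * towerBox r e j (strip (e j) g) := rfl

theorem wave_succ (ζ : StrongDual ℝ 𝔤) (β : ℝ → ℝ) (r : ℝ) (e : ℕ → 𝔤) (j : ℕ) (g : 𝔤) :
    wave ζ β r e (j + 1) g = β ((inner ℝ (e j) g : ℝ) / r) *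
      Complex.exp (2 * Real.pi * Complex.I * (((inner ℝ (e j) g : ℝ) * ζ (e j) : ℝ) : ℂ)) *
        wave ζ β r e j (strip (e j) g) := rfl

theorem towerBox_nonneg (r : ℝ) (e : ℕ → 𝔤) (j : ℕ) (g : 𝔤) : 0 ≤ towerBox r e j g := by
  induction j generalizing g with
  | zero => exact zero_le_one
  | succ j ih => rw [towerBox_succ]; exact mul_nonneg (by split_ifs <;> simp) (ih _)

theorem contDiff_wave {ζ : StrongDual ℝ 𝔤} {β : ℝ → ℝ} (hβ : ContDiff ℝ ∞ β) {r : ℝ} {e : ℕ → 𝔤}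
    (j : ℕ) : ContDiff ℝ ∞ (wave ζ β r e j) := by
  induction j with
  | zero =>
    exact (contDiff_const.mul (Complex.ofRealCLM.contDiff.comp ζ.contDiff)).cexp
  | succ j ih =>
    have h1 : ContDiff ℝ ∞ fun g : 𝔤 => (inner ℝ (e j) g : ℝ) := contDiff_const.inner ℝ contDiff_id
    refine ContDiff.mul (ContDiff.mul ?_ ?_) (ih.comp (contDiff_strip (e j)))
    · exact Complex.ofRealCLM.contDiff.comp (hβ.comp (h1.div_const r))
    · exact (contDiff_const.mul (Complex.ofRealCLM.contDiff.comp (h1.mul contDiff_const))).cexp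

theorem norm_exp_two_pi_I_mul (x : ℝ) : ‖Complex.exp (2 * Real.pi * Complex.I * x)‖ = 1 := by
  rw [show 2 * Real.pi * Complex.I * x = ((2 * Real.pi * x : ℝ) : ℂ) * Complex.I by push_cast; ring]
  exact Complex.norm_exp_ofReal_mul_I _

theorem norm_wave_le {ζ : StrongDual ℝ 𝔤} {β : ℝ → ℝ} (hβ1 : ∀ x, |β x| ≤ 1)
    (hβ0 : ∀ x, 1 < |x| → β x = 0) {r : ℝ} (hr : 0 < r) {e : ℕ → 𝔤} (j : ℕ) (g : 𝔤) :
    ‖wave ζ β r e j g‖ ≤ towerBox r e j g := by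
  induction j generalizing g with
  | zero => exact (norm_exp_two_pi_I_mul _).le
  | succ j ih =>
    rw [wave_succ, towerBox_succ, norm_mul, norm_mul, norm_exp_two_pi_I_mul, mul_one, Complex.norm_real, Real.norm_eq_abs]
    refine mul_le_mul ?_ (ih _) (norm_nonneg _) (by split_ifs <;> simp)
    split_ifs with h
    · exact hβ1 _
    · rw [hβ0, abs_zero]
      rw [abs_div, abs_of_pos hr, lt_div_iff₀ hr]
      linarith

/-- The constants in the estimate for coherent states. -/
def waveConst (L K : ℝ) : ℕ → ℝ
  | 0 => 0
  | j + 1 => L + 2 * Real.pi * (K * Real.exp K) + waveConst L K j * (Real.exp K + 1)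

theorem waveConst_nonneg {L K : ℝ} (hL : 0 ≤ L) (hK : 0 ≤ K) (j : ℕ) : 0 ≤ waveConst L K j := by
  induction j with
  | zero => exact le_rfl
  | succ j ih => have := Real.pi_pos; unfold waveConst; positivity

theorem norm_adL_le {K : ℝ} (hK0 : 0 ≤ K) (hK : ∀ X Y : 𝔤, ‖⁅X, Y⁆‖ ≤ K * ‖X‖ * ‖Y‖) (X : 𝔤) :
    ‖adL X‖ ≤ K * ‖X‖ :=
  ContinuousLinearMap.opNorm_le_bound _ (by positivity) (hK X)

theorem hasDerivAt_comp_bch {f : 𝔤 → ℂ} (hf : ContDiff ℝ ∞ f) (g : 𝔤) {c : ℝ → 𝔤} {X : 𝔤}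
    (hc : HasDerivAt c X 0) (hc0 : c 0 = 0) :
    HasDerivAt (fun s => f (bch g (c s))) (fderiv ℝ (fun Z => f (bch g Z)) 0 X) 0 := by
  have h : HasFDerivAt (fun Z => f (bch g Z)) (fderiv ℝ (fun Z => f (bch g Z)) 0) (c 0) := by
    rw [hc0]
    exact ((hf.comp (contDiff_const.bch contDiff_id)).differentiable
      (by simp)).differentiableAt.hasFDerivAt
  exact HasFDerivAt.comp_hasDerivAt (l := fun Z => f (bch g Z)) 0 h hc

theorem hasDerivAt_smul_self (X : 𝔤) (s : ℝ) : HasDerivAt (fun s : ℝ => s • X) X s := by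
  simpa using (hasDerivAt_id s).smul_const X

/-- The coherent state is an approximate joint eigenvector of the Lie algebra. -/
theorem IsTower.norm_fderiv_wave_sub_le [LieRing.IsNilpotent 𝔤] {𝔥 : ℕ → Submodule ℝ 𝔤}
    {e : ℕ → 𝔤} (hT : IsTower 𝔥 e) {K : ℝ} (hK0 : 0 ≤ K)
    (hK : ∀ X Y : 𝔤, ‖⁅X, Y⁆‖ ≤ K * ‖X‖ * ‖Y‖) {β : ℝ → ℝ} (hβ : ContDiff ℝ ∞ β)
    (hβ1 : ∀ x, |β x| ≤ 1) (hβ0 : ∀ x, 1 < |x| → β x = 0) {L : ℝ} (hL : ∀ x, |deriv β x| ≤ L)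
    (hL0 : ∀ x, 1 < |x| → deriv β x = 0) {r Λ : ℝ} (hr : 0 < r) (hr1 : r ≤ 1) (hrΛ : 1 / r ≤ Λ)
    {ζ : StrongDual ℝ 𝔤} (hζΛ : ‖ζ‖ * r ≤ Λ) (hζ : ∀ X ∈ 𝔥 0, ∀ Y ∈ 𝔥 0, ζ ⁅X, Y⁆ = 0) (j : ℕ)
    {g X : 𝔤} (hg : g ∈ 𝔥 j) (hX : X ∈ 𝔥 j) :
    ‖fderiv ℝ (fun Z => wave ζ β r e j (bch g Z)) 0 X
        - 2 * Real.pi * Complex.I * ζ X * wave ζ β r e j g‖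
      ≤ waveConst L K j * Λ * ‖X‖ * towerBox r e j g := by
  have hL1 : 0 ≤ L := (abs_nonneg _).trans (hL 0)
  have hΛ0 : 0 ≤ Λ := (by positivity : 0 ≤ 1 / r).trans hrΛ
  induction j generalizing g X with
  | zero =>
    have h1 := hasDerivAt_comp_bch (contDiff_wave (ζ := ζ) hβ (r := r) (e := e) 0) g
      (hasDerivAt_smul_self X 0) (zero_smul _ _)
    have h2 : ∀ s : ℝ, wave ζ β r e 0 (bch g (s • X))
        = Complex.exp (2 * Real.pi * Complex.I * ((ζ g + s * ζ X : ℝ) : ℂ)) := fun s => by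
      have := map_bch_eq_add hT.lie_mem_zero (ζ : 𝔤 →ₗ[ℝ] ℝ) hζ hg ((𝔥 0).smul_mem s hX)
      simp only [ContinuousLinearMap.coe_coe, map_smul, smul_eq_mul] at this
      rw [← this]
      rfl
    have h3 : HasDerivAt (fun s : ℝ => Complex.exp (2 * Real.pi * Complex.I * ((ζ g + s * ζ X : ℝ) : ℂ)))
        (Complex.exp (2 * Real.pi * Complex.I * ((ζ g + 0 * ζ X : ℝ) : ℂ)) *
          (2 * Real.pi * Complex.I * (ζ X : ℝ))) 0 := by
      refine HasDerivAt.cexp (HasDerivAt.const_mul _ (HasDerivAt.ofReal_comp ?_))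
      simpa using ((hasDerivAt_id (0 : ℝ)).mul_const (ζ X)).const_add (ζ g)
    simp only [h2] at h1
    rw [h1.unique h3]
    simp only [wave, towerProd, waveConst]
    rw [zero_mul, add_zero, mul_comm, sub_self]
    simp
  | succ j ih =>
    set τ : ℝ := inner ℝ (e j) g with hτ
    set x : ℝ := inner ℝ (e j) X with hx
    set g' := strip (e j) g with hg'
    set X₁ := exp (adL (τ • e j)) X with hX₁
    set X' := X₁ + (-x) • e j with hX'
    have hx_le : |x| ≤ ‖X‖ := by
      refine (abs_real_inner_le_norm _ _).trans ?_
      exact mul_le_of_le_one_left (norm_nonneg _) (hT.norm_le j)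
    have hg'm : g' ∈ 𝔥 j := hT.strip_mem hg
    have hX₁m : X₁ - X ∈ 𝔥 j := by
      refine exp_apply_sub_mem (hT.le_succ j) (fun Y hY => ?_) hX
      exact hT.lie_mem j _ ((𝔥 (j + 1)).smul_mem _ (hT.mem j)) _ hY
    have hX'm : X' ∈ 𝔥 j := by
      have := (𝔥 j).add_mem hX₁m (hT.sub_mem j X hX)
      convert this using 1
      rw [hX', ← hx]
      module
    -- Right translation by sX moves the top coordinate linearly and moves the stripped point along
    -- this curve. Its velocity `X'` lies in `𝔥 j`, so the induction hypothesis applies there.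
    set c : ℝ → 𝔤 := fun s => bch (s • X₁) (-(s * x) • e j) with hc
    have hcd : HasDerivAt c X' 0 := by
      refine hasDerivAt_bch_zero (hasDerivAt_smul_self X₁ 0) ?_ (by simp) (by simp)
      have := (((hasDerivAt_id (0 : ℝ)).mul_const x).neg).smul_const (e j)
      simpa using this
    have hQ := hasDerivAt_comp_bch (contDiff_wave (ζ := ζ) hβ (r := r) (e := e) j) g' hcd (by simp [hc])
    set T := fderiv ℝ (fun Z => wave ζ β r e j (bch g' Z)) 0 X' with hTdef
    have hlin : HasDerivAt (fun s : ℝ => τ + s * x) x 0 := by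
      simpa using ((hasDerivAt_id (0 : ℝ)).mul_const x).const_add τ
    have hE : HasDerivAt (fun s : ℝ => Complex.exp (2 * Real.pi * Complex.I * (((τ + s * x) * ζ (e j) : ℝ) : ℂ)))
        (Complex.exp (2 * Real.pi * Complex.I * (((τ + 0 * x) * ζ (e j) : ℝ) : ℂ)) *
          (2 * Real.pi * Complex.I * ((x * ζ (e j) : ℝ) : ℂ))) 0 :=
      HasDerivAt.cexp (HasDerivAt.const_mul _ (HasDerivAt.ofReal_comp (hlin.mul_const _)))
    have hB : HasDerivAt (fun s : ℝ => ((β ((τ + s * x) / r) : ℝ) : ℂ))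
        ((deriv β ((τ + 0 * x) / r) * (x / r) : ℝ) : ℂ) 0 := by
      refine HasDerivAt.ofReal_comp ?_
      exact HasDerivAt.comp (0 : ℝ) (hβ.differentiable (by simp)).differentiableAt.hasDerivAt
        (hlin.div_const r)
    have h1 := hasDerivAt_comp_bch (contDiff_wave (ζ := ζ) hβ (r := r) (e := e) (j + 1)) g
      (hasDerivAt_smul_self X 0) (zero_smul _ _)
    have h2 : ∀ s : ℝ, wave ζ β r e (j + 1) (bch g (s • X)) = ((β ((τ + s * x) / r) : ℝ) : ℂ) *
        Complex.exp (2 * Real.pi * Complex.I * (((τ + s * x) * ζ (e j) : ℝ) : ℂ)) *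
          wave ζ β r e j (bch g' (c s)) := fun s => by
      obtain ⟨e1, e2⟩ := hT.strip_bch_smul hg hX s
      rw [wave_succ, e1, e2]
    simp only [h2] at h1
    rw [h1.unique ((hB.mul hE).mul hQ)]
    have hc0 : bch g' (c 0) = g' := by simp [hc]
    simp only [Pi.mul_apply, hc0, zero_mul, add_zero]
    set E : ℂ := Complex.exp (2 * Real.pi * Complex.I * ((τ * ζ (e j) : ℝ) : ℂ)) with hEdef
    have hE1 : ‖E‖ = 1 := norm_exp_two_pi_I_mul _
    set w := wave ζ β r e j g' with hw
    have hww : wave ζ β r e (j + 1) g = β (τ / r) * E * w := wave_succ _ _ _ _ _ _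
    have hbox : towerBox r e (j + 1) g = (if |τ| ≤ r then 1 else 0) * towerBox r e j g' :=
      towerBox_succ _ _ _ _
    have hζX : ζ X' = ζ X₁ - x * ζ (e j) := by
      rw [hX', map_add, map_smul, smul_eq_mul]; ring
    rw [hww, hbox]
    by_cases hτr : |τ| ≤ r
    -- Since ζ(X) = ζ(X') + xζ(e_j) - ζ(X₁ - X), the phase of the top coordinate accounts for
    -- xζ(e_j). Three errors remain: the derivative of the bump, the error of the lower wave in
    -- direction `X'`, and the conjugation error ζ(X₁ - X).
    · have key : ((deriv β (τ / r) * (x / r) : ℝ) * E + β (τ / r) *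
            (E * (2 * Real.pi * Complex.I * ((x * ζ (e j) : ℝ) : ℂ)))) * w + β (τ / r) * E * T
          - 2 * Real.pi * Complex.I * ζ X * (β (τ / r) * E * w)
          = (deriv β (τ / r) * (x / r) : ℝ) * E * w
            + β (τ / r) * E * (T - 2 * Real.pi * Complex.I * ζ X' * w)
            + β (τ / r) * E * (2 * Real.pi * Complex.I * ((ζ (X₁ - X) : ℝ) : ℂ)) * w := by
        rw [hζX, map_sub]
        push_cast
        ring
      rw [key, if_pos hτr, one_mul]
      have hwb : ‖w‖ ≤ towerBox r e j g' := norm_wave_le hβ1 hβ0 hr j g'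
      have hb0 := towerBox_nonneg r e j g'
      have hA : ‖adL (τ • e j)‖ ≤ K * r := by
        refine (norm_adL_le hK0 hK _).trans (mul_le_mul_of_nonneg_left ?_ hK0)
        rw [norm_smul, Real.norm_eq_abs]
        exact (mul_le_of_le_one_right (abs_nonneg _) (hT.norm_le j)).trans hτr
      have hA1 : Real.exp ‖adL (τ • e j)‖ ≤ Real.exp K :=
        Real.exp_le_exp.2 (hA.trans (mul_le_of_le_one_right hK0 hr1))
      have hn1 : ‖X₁‖ ≤ Real.exp K * ‖X‖ :=
        (norm_exp_apply_le _ _).trans (mul_le_mul_of_nonneg_right hA1 (norm_nonneg _))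
      have hn2 : ‖X₁ - X‖ ≤ Real.exp K * (K * r * ‖X‖) :=
        (norm_exp_apply_sub_le _ _).trans (mul_le_mul hA1
          (mul_le_mul_of_nonneg_right hA (norm_nonneg _)) (by positivity) (by positivity))
      have hn3 : ‖X'‖ ≤ (Real.exp K + 1) * ‖X‖ := by
        refine (norm_add_le _ _).trans ?_
        have : ‖(-x) • e j‖ ≤ ‖X‖ := by
          rw [norm_smul, norm_neg, Real.norm_eq_abs]
          exact (mul_le_of_le_one_right (abs_nonneg _) (hT.norm_le j)).trans hx_le
        linarith
      have t1 : ‖((deriv β (τ / r) * (x / r) : ℝ) : ℂ) * E * w‖ ≤ L * (‖X‖ * Λ) * towerBox r e j g' := by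
        rw [norm_mul, norm_mul, hE1, mul_one, Complex.norm_real, Real.norm_eq_abs, abs_mul, abs_div,
          abs_of_pos hr]
        have hxr : |x| / r ≤ ‖X‖ * Λ := by
          rw [div_eq_mul_one_div]
          gcongr
        exact mul_le_mul (mul_le_mul (hL _) hxr (by positivity) hL1) hwb (norm_nonneg _)
          (by positivity)
      have hβE : ‖(β (τ / r) : ℂ) * E‖ ≤ 1 := by
        rw [norm_mul, hE1, mul_one, Complex.norm_real]
        exact hβ1 _
      have t2 : ‖(β (τ / r) : ℂ) * E * (T - 2 * Real.pi * Complex.I * ζ X' * w)‖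
          ≤ waveConst L K j * Λ * ((Real.exp K + 1) * ‖X‖) * towerBox r e j g' := by
        rw [norm_mul]
        refine (mul_le_of_le_one_left (norm_nonneg _) hβE).trans ((ih hg'm hX'm).trans ?_)
        have := waveConst_nonneg hL1 hK0 j
        gcongr
      -- Inside the box |τ| ≤ r, conjugation moves `X` by O(r), so the error is controlled by ‖ζ‖r ≤
      -- Λ rather than by ‖ζ‖.
      have t3 : ‖(β (τ / r) : ℂ) * E * (2 * Real.pi * Complex.I * ((ζ (X₁ - X) : ℝ) : ℂ)) * w‖
          ≤ 2 * Real.pi * (Real.exp K * (K * Λ * ‖X‖)) * towerBox r e j g' := by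
        rw [norm_mul, norm_mul]
        have hp : ‖2 * Real.pi * Complex.I * ((ζ (X₁ - X) : ℝ) : ℂ)‖ = 2 * Real.pi * ‖ζ (X₁ - X)‖ := by
          rw [norm_mul, norm_mul, norm_mul, Complex.norm_real, Complex.norm_real, Complex.norm_I,
            Complex.norm_ofNat, mul_one, Real.norm_of_nonneg Real.pi_pos.le]
        rw [hp]
        have hz : ‖ζ (X₁ - X)‖ ≤ Real.exp K * (K * Λ * ‖X‖) :=
          calc ‖ζ (X₁ - X)‖ ≤ ‖ζ‖ * (Real.exp K * (K * r * ‖X‖)) :=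
                (ζ.le_opNorm _).trans (mul_le_mul_of_nonneg_left hn2 (norm_nonneg _))
            _ = Real.exp K * (K * (‖ζ‖ * r) * ‖X‖) := by ring
            _ ≤ _ := by gcongr
        have hpi := Real.pi_pos
        calc _ ≤ 1 * (2 * Real.pi * ‖ζ (X₁ - X)‖) * ‖w‖ := by gcongr
          _ ≤ _ := by rw [one_mul]; gcongr
      refine (norm_add₃_le).trans ((add_le_add (add_le_add t1 t2) t3).trans (le_of_eq ?_))
      rw [waveConst]
      ring
    -- Outside the box the bump and its derivative both vanish.
    · have hlt : 1 < |τ / r| := by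
        rw [abs_div, abs_of_pos hr, lt_div_iff₀ hr, one_mul]
        exact not_le.1 hτr
      rw [hβ0 _ hlt, hL0 _ hlt, if_neg hτr]
      simp

end MetricLieAlgebra

namespace MetricLieAlgebra

variable {𝔤 : MetricLieAlgebra.{u}}

/-! ### Integration over a section -/

/-- The product `exp(t_1 a_1) ⋯ exp(t_k a_k)` for a list `a_1, …, a_k`. -/
def listSection (l : List 𝔤) {k : ℕ} (t : Fin k → ℝ) : 𝔤 :=
  (List.zipWith (fun a s => s • a) l (List.ofFn t)).foldl bch 0

theorem listSection_append (l : List 𝔤) {k : ℕ} (hl : l.length = k) (a : 𝔤) (t : Fin (k + 1) → ℝ) :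
    listSection (l ++ [a]) t = bch (listSection l fun i => t i.castSucc) (t (Fin.last k) • a) := by
  rw [listSection, List.ofFn_succ', List.concat_eq_append, List.zipWith_append (by simp [hl])]
  simp [listSection]

theorem contDiff_listSection (l : List 𝔤) {k : ℕ} (hl : l.length = k) :
    ContDiff ℝ ∞ (listSection l : (Fin k → ℝ) → 𝔤) := by
  induction l using List.reverseRecOn generalizing k with
  | nil =>
    have : (listSection [] : (Fin k → ℝ) → 𝔤) = fun _ => 0 := by funext t; simp [listSection]
    rw [this]
    exact contDiff_const
  | append_singleton l a ih =>
    obtain ⟨k, rfl⟩ : ∃ m, k = m + 1 := ⟨l.length, by simpa using hl.symm⟩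
    have hl' : l.length = k := by simpa using hl
    rw [show (listSection (l ++ [a]) : (Fin (k + 1) → ℝ) → 𝔤) = _ from
      funext (listSection_append l hl' a)]
    refine ContDiff.bch ((ih hl').comp ?_) ?_
    · exact contDiff_pi.2 fun i => contDiff_apply ℝ ℝ _
    · exact (contDiff_apply ℝ ℝ _).smul contDiff_const

open Classical in
/-- The list of the vectors `a i` with `e i ≠ 0`, `i < j`. -/
def towerList (e a : ℕ → 𝔤) : ℕ → List 𝔤
  | 0 => []
  | j + 1 => if e j = 0 then towerList e a j else towerList e a j ++ [a j]

open Classical in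
/-- The value of the integral of a product of functions of the coordinates. -/
def towerMass (e a : ℕ → 𝔤) (ψ : ℕ → ℝ → ℝ≥0∞) : ℕ → ℝ≥0∞
  | 0 => 1
  | j + 1 => if e j = 0 then towerMass e a ψ j else
      ENNReal.ofReal |(inner ℝ (e j) (a j) : ℝ)|⁻¹ * (∫⁻ x, ψ j x) * towerMass e a ψ j

theorem lintegral_comp_mul_add {f : ℝ → ℝ≥0∞} {c : ℝ} (hc : c ≠ 0) (x₀ : ℝ) :
    ∫⁻ s, f (s * c + x₀) = ENNReal.ofReal |c|⁻¹ * ∫⁻ x, f x := by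
  have h1 : ∫⁻ s, f (s * c + x₀) = ∫⁻ x, f (x + x₀) ∂(Measure.map (fun s => s * c) volume) :=
    ((Homeomorph.mulRight₀ c hc).toMeasurableEquiv.measurableEmbedding.lintegral_map
      (fun x => f (x + x₀))).symm
  rw [h1, Real.map_volume_mul_right hc, lintegral_smul_measure,
    lintegral_add_right_eq_self (fun x => f x) x₀, abs_inv, smul_eq_mul]

theorem strip_zero (g : 𝔤) : strip 0 g = g := by simp [strip]

theorem measurable_towerProd {M : Type*} [CommMonoid M] [MeasurableSpace M] [MeasurableMul₂ M]
    (e : ℕ → 𝔤) {χ : 𝔤 → M} (hχ : Measurable χ) {ψ : ℕ → ℝ → M} (hψ : ∀ j, Measurable (ψ j))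
    (j : ℕ) : Measurable (towerProd e χ ψ j) := by
  induction j with
  | zero => exact hχ
  | succ j ih =>
    have h1 : Continuous fun g : 𝔤 => (inner ℝ (e j) g : ℝ) := by fun_prop
    exact ((hψ j).comp h1.measurable).mul (ih.comp (contDiff_strip (e j)).continuous.measurable)

namespace IsTower

variable {𝔥 : ℕ → Submodule ℝ 𝔤} {e a : ℕ → 𝔤} (hT : IsTower 𝔥 e) (ha : ∀ j, a j ∈ 𝔥 (j + 1))
include hT

theorem mem_of_eq_zero {j : ℕ} (hj : e j = 0) {g : 𝔤} (hg : g ∈ 𝔥 (j + 1)) : g ∈ 𝔥 j := by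
  simpa [hj] using hT.sub_mem j g hg

include ha

theorem listSection_mem (j : ℕ) {k : ℕ} (hk : (towerList e a j).length = k) (t : Fin k → ℝ) :
    listSection (towerList e a j) t ∈ 𝔥 j := by
  induction j generalizing k with
  | zero => simp [listSection, towerList]
  | succ j ih =>
    rw [towerList] at hk ⊢
    split_ifs at hk ⊢ with h
    · exact hT.le_succ j (ih hk t)
    · obtain ⟨k, rfl⟩ : ∃ m, k = m + 1 := ⟨(towerList e a j).length, by simpa using hk.symm⟩
      have hk' : (towerList e a j).length = k := by simpa using hk
      rw [listSection_append _ hk']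
      exact hT.bch_mem (hT.le_succ j (ih hk' _)) ((𝔥 (j + 1)).smul_mem _ (ha j))

variable [LieRing.IsNilpotent 𝔤]

theorem strip_listSection {j k : ℕ} (hk : (towerList e a j).length = k) (t : Fin k → ℝ) (s : ℝ)
    {g : 𝔤} (hg : g ∈ 𝔥 (j + 1)) :
    (inner ℝ (e j) (bch (bch (listSection (towerList e a j) t) (s • a j)) g) : ℝ)
        = s * inner ℝ (e j) (a j) + inner ℝ (e j) g ∧
      strip (e j) (bch (bch (listSection (towerList e a j) t) (s • a j)) g)
        = bch (listSection (towerList e a j) t) (strip (e j) (bch (s • a j) g)) := by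
  have hs := (𝔥 (j + 1)).smul_mem s (ha j)
  rw [bch_assoc]
  obtain ⟨h1, h2⟩ := hT.strip_bch (hT.listSection_mem ha j hk t) (hT.bch_mem hs hg)
  refine ⟨?_, h2⟩
  rw [h1, hT.inner_bch hs hg, inner_smul_right]

/-- By induction the integral over the lower coordinates does not depend on the point left after
stripping, so Fubini splits off the top coordinate as an affine change of variable. The independence
of `g` is the right invariance of the measure on M\G. A step with `e j = 0` carries no variable and
contributes ψ j 0 = 1. -/
theorem lintegral_towerProd (hne : ∀ j, e j ≠ 0 → (inner ℝ (e j) (a j) : ℝ) ≠ 0)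
    {ψ : ℕ → ℝ → ℝ≥0∞} (hψ : ∀ j, Measurable (ψ j)) (hψ0 : ∀ j, ψ j 0 = 1) (j : ℕ) {k : ℕ}
    (hk : (towerList e a j).length = k) {g : 𝔤} (hg : g ∈ 𝔥 j) :
    ∫⁻ t : Fin k → ℝ, towerProd e (fun _ => 1) ψ j (bch (listSection (towerList e a j) t) g)
      = towerMass e a ψ j := by
  induction j generalizing k g with
  | zero =>
    obtain rfl : k = 0 := by simpa [towerList] using hk.symm
    simp [towerProd, towerMass, volume_pi]
  | succ j ih =>
    rw [towerList] at hk ⊢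
    rw [towerMass]
    split_ifs at hk ⊢ with h
    · rw [← ih hk (hT.mem_of_eq_zero h hg)]
      refine lintegral_congr fun t => ?_
      rw [towerProd, h, inner_zero_left, hψ0, one_mul, strip_zero]
    · obtain ⟨k, rfl⟩ : ∃ m, k = m + 1 := ⟨(towerList e a j).length, by simpa using hk.symm⟩
      have hk' : (towerList e a j).length = k := by simpa using hk
      have hm := (volume_preserving_piFinSuccAbove (fun _ : Fin (k + 1) => ℝ) (Fin.last k))
      set G : ℝ × (Fin k → ℝ) → ℝ≥0∞ := fun p =>
        ψ j (p.1 * inner ℝ (e j) (a j) + inner ℝ (e j) g) *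
          towerProd e (fun _ => 1) ψ j (bch (listSection (towerList e a j) p.2)
            (strip (e j) (bch (p.1 • a j) g))) with hG
      have hcs : Continuous (listSection (towerList e a j) : (Fin k → ℝ) → 𝔤) :=
        (contDiff_listSection _ hk').continuous
      have hGm : Measurable G := by
        refine Measurable.mul ((hψ j).comp (by fun_prop)) ((measurable_towerProd e
          measurable_const hψ j).comp (Continuous.measurable ?_))
        refine (hcs.comp continuous_snd).bch ((contDiff_strip (e j)).continuous.comp ?_)
        exact (continuous_fst.smul continuous_const).bch continuous_const
      have h1 : ∀ t : Fin (k + 1) → ℝ, towerProd e (fun _ => 1) ψ (j + 1)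
          (bch (listSection (towerList e a j ++ [a j]) t) g)
          = G (MeasurableEquiv.piFinSuccAbove (fun _ => ℝ) (Fin.last k) t) := fun t => by
        obtain ⟨e1, e2⟩ := hT.strip_listSection ha hk' (fun i => t i.castSucc) (t (Fin.last k)) hg
        rw [listSection_append _ hk', towerProd, e1, e2, hG]
        simp [MeasurableEquiv.piFinSuccAbove, Fin.insertNthEquiv]
        rfl
      simp only [h1]
      rw [hm.lintegral_comp hGm, Measure.volume_eq_prod, lintegral_prod _ hGm.aemeasurable]
      have h2 : ∀ s : ℝ, ∫⁻ t : Fin k → ℝ, G (s, t)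
          = ψ j (s * inner ℝ (e j) (a j) + inner ℝ (e j) g) * towerMass e a ψ j := fun s => by
        have hs : strip (e j) (bch (s • a j) g) ∈ 𝔥 j :=
          hT.strip_mem (hT.bch_mem ((𝔥 (j + 1)).smul_mem s (ha j)) hg)
        rw [← ih hk' hs, ← lintegral_const_mul]
        exact (measurable_towerProd e measurable_const hψ j).comp
          (hcs.bch continuous_const).measurable
      simp only [h2]
      rw [lintegral_mul_const _ (show Measurable fun s : ℝ => ψ j (s * inner ℝ (e j) (a j) +
        inner ℝ (e j) g) from (hψ j).comp (by fun_prop)), lintegral_comp_mul_add (hne j h)]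

/-- The top coordinate bounds the last parameter; then the stripped point stays in a compact set and
induction bounds the others. This makes the supports uniformly compact while the group element stays
bounded. -/
theorem exists_bound_of_towerBox_ne_zero (hne : ∀ j, e j ≠ 0 → (inner ℝ (e j) (a j) : ℝ) ≠ 0)
    (he : ∀ j, ‖e j‖ ≤ 1) (r : ℝ) (j : ℕ) {k : ℕ} (hk : (towerList e a j).length = k) (R : ℝ) :
    ∃ ρ : ℝ, ∀ g ∈ 𝔥 j, ‖g‖ ≤ R → ∀ t : Fin k → ℝ,
      towerBox r e j (bch (listSection (towerList e a j) t) g) ≠ 0 → ∀ i, |t i| ≤ ρ := by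
  induction j generalizing k R with
  | zero =>
    obtain rfl : k = 0 := by simpa [towerList] using hk.symm
    exact ⟨0, fun _ _ _ _ _ i => i.elim0⟩
  | succ j ih =>
    rw [towerList] at hk ⊢
    split_ifs at hk ⊢ with h
    · obtain ⟨ρ, hρ⟩ := ih hk R
      refine ⟨ρ, fun g hg hgR t ht => hρ g (hT.mem_of_eq_zero h hg) hgR t ?_⟩
      rw [towerBox_succ, h, strip_zero] at ht
      exact right_ne_zero_of_mul ht
    · obtain ⟨k, rfl⟩ : ∃ m, k = m + 1 := ⟨(towerList e a j).length, by simpa using hk.symm⟩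
      have hk' : (towerList e a j).length = k := by simpa using hk
      set c : ℝ := inner ℝ (e j) (a j) with hc
      have hc0 : 0 < |c| := abs_pos.2 (hne j h)
      set S : ℝ := (r + R) / |c| with hS
      have hcpt : IsCompact ((fun p : ℝ × 𝔤 => strip (e j) (bch (p.1 • a j) p.2)) ''
          (Set.Icc (-S) S ×ˢ Metric.closedBall 0 R)) := by
        refine (isCompact_Icc.prod (isCompact_closedBall _ _)).image ?_
        exact (contDiff_strip (e j)).continuous.comp
          ((continuous_fst.smul continuous_const).bch continuous_snd)
      obtain ⟨R', hR'⟩ := hcpt.isBounded.exists_norm_le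
      obtain ⟨ρ, hρ⟩ := ih hk' R'
      refine ⟨max ρ S, fun g hg hgR t ht => ?_⟩
      obtain ⟨e1, e2⟩ := hT.strip_listSection ha hk' (fun i => t i.castSucc) (t (Fin.last k)) hg
      rw [listSection_append _ hk', towerBox_succ, e1, e2] at ht
      have h1 : |t (Fin.last k) * c + inner ℝ (e j) g| ≤ r := by
        by_contra hcon
        rw [if_neg hcon, zero_mul] at ht
        exact ht rfl
      have h2 : |(inner ℝ (e j) g : ℝ)| ≤ R :=
        (abs_real_inner_le_norm _ _).trans
          ((mul_le_of_le_one_left (norm_nonneg _) (he j)).trans hgR)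
      have h3 : |t (Fin.last k)| ≤ S := by
        rw [hS, le_div_iff₀ hc0, ← abs_mul]
        have := abs_sub (t (Fin.last k) * c + inner ℝ (e j) g) (inner ℝ (e j) g)
        rw [add_sub_cancel_right] at this
        linarith
      intro i
      refine Fin.lastCases ?_ (fun i => ?_) i
      · exact h3.trans (le_max_right _ _)
      · refine (hρ _ ?_ ?_ (fun i => t i.castSucc) (right_ne_zero_of_mul ht) i).trans
          (le_max_left _ _)
        · exact hT.strip_mem (hT.bch_mem ((𝔥 (j + 1)).smul_mem _ (ha j)) hg)
        · exact hR' _ ⟨(t (Fin.last k), g), ⟨abs_le.1 h3, by simpa using hgR⟩, rfl⟩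

end IsTower

theorem towerMass_le {e a : ℕ → 𝔤} {ψ ψ' : ℕ → ℝ → ℝ≥0∞} {D : ℝ≥0∞} (hD : 1 ≤ D)
    (h : ∀ j, ∫⁻ x, ψ j x ≤ D * ∫⁻ x, ψ' j x) (j : ℕ) :
    towerMass e a ψ j ≤ D ^ j * towerMass e a ψ' j := by
  induction j with
  | zero => simp [towerMass]
  | succ j ih =>
    rw [towerMass, towerMass]
    split_ifs
    · exact ih.trans (mul_le_mul_left (pow_le_pow_right₀ hD j.le_succ) _)
    · calc _ ≤ ENNReal.ofReal |(inner ℝ (e j) (a j) : ℝ)|⁻¹ * (D * ∫⁻ x, ψ' j x) *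
            (D ^ j * towerMass e a ψ' j) := by gcongr; exact h j
        _ = _ := by ring

theorem towerMass_ne_zero {e a : ℕ → 𝔤} {ψ : ℕ → ℝ → ℝ≥0∞}
    (hne : ∀ j, e j ≠ 0 → (inner ℝ (e j) (a j) : ℝ) ≠ 0) (h : ∀ j, ∫⁻ x, ψ j x ≠ 0) (j : ℕ) :
    towerMass e a ψ j ≠ 0 := by
  induction j with
  | zero => simp [towerMass]
  | succ j ih =>
    rw [towerMass]
    split_ifs with h0
    · exact ih
    · have : 0 < |(inner ℝ (e j) (a j) : ℝ)|⁻¹ := inv_pos.2 (abs_pos.2 (hne j h0))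
      exact mul_ne_zero (mul_ne_zero (ENNReal.ofReal_pos.2 this).ne' (h j)) ih

theorem towerMass_ne_top {e a : ℕ → 𝔤} {ψ : ℕ → ℝ → ℝ≥0∞} (h : ∀ j, ∫⁻ x, ψ j x ≠ ⊤) (j : ℕ) :
    towerMass e a ψ j ≠ ⊤ := by
  induction j with
  | zero => simp [towerMass]
  | succ j ih =>
    rw [towerMass]
    split_ifs with h0
    · exact ih
    · exact ENNReal.mul_ne_top (ENNReal.mul_ne_top ENNReal.ofReal_ne_top (h j)) ih

/-- The phases have modulus one, so the squared modulus is again a tower product and its integral is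
computed by `lintegral_towerProd`. -/
theorem enorm_wave_sq (ζ : StrongDual ℝ 𝔤) (β : ℝ → ℝ) (r : ℝ) (e : ℕ → 𝔤) (j : ℕ) (g : 𝔤) :
    ‖wave ζ β r e j g‖ₑ ^ 2
      = towerProd e (fun _ => 1) (fun _ τ => ENNReal.ofReal (β (τ / r) ^ 2)) j g := by
  induction j generalizing g with
  | zero =>
    rw [towerProd, wave, towerProd, ← ofReal_norm, norm_exp_two_pi_I_mul]
    simp
  | succ j ih =>
    rw [towerProd, ← ih, wave_succ, enorm_mul, enorm_mul, mul_pow, mul_pow]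
    congr 1
    rw [← ofReal_norm, ← ofReal_norm (Complex.exp _), norm_exp_two_pi_I_mul,
      Complex.norm_real, ← ENNReal.ofReal_pow (norm_nonneg _), Real.norm_eq_abs, sq_abs]
    simp

theorem ofReal_towerBox_sq (r : ℝ) (e : ℕ → 𝔤) (j : ℕ) (g : 𝔤) :
    ENNReal.ofReal (towerBox r e j g) ^ 2
      = towerProd e (fun _ => 1) (fun _ τ => if |τ| ≤ r then 1 else 0) j g := by
  induction j generalizing g with
  | zero => simp [towerProd, towerBox]
  | succ j ih =>
    rw [towerProd, ← ih, towerBox_succ, ENNReal.ofReal_mul (by split_ifs <;> simp), mul_pow]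
    congr 1
    split_ifs <;> simp

end MetricLieAlgebra

/-! ### Smooth families of compactly supported functions as curves in `L²` -/

section SmoothFamily

variable {E T : Type*} [NormedAddCommGroup E] [NormedSpace ℝ E] [FiniteDimensional ℝ E]
  [NormedAddCommGroup T] [NormedSpace ℝ T] [FiniteDimensional ℝ T] [MeasurableSpace T]
  [BorelSpace T] {μ : Measure T} [IsFiniteMeasureOnCompacts μ]

/-- A jointly smooth family of functions whose supports are locally uniformly compact. -/
structure IsSmoothFamily (H : E → T → ℂ) : Prop where
  contDiff : ContDiff ℝ ∞ (Function.uncurry H)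
  support : ∀ R : ℝ, ∃ ρ : ℝ, ∀ X, ‖X‖ ≤ R → ∀ t, ρ < ‖t‖ → H X t = 0

theorem memLp_of_support {F : T → ℂ} (hF : Continuous F) {ρ : ℝ} (hρ : ∀ t, ρ < ‖t‖ → F t = 0) :
    MemLp F 2 μ := by
  refine hF.memLp_of_hasCompactSupport ?_
  refine HasCompactSupport.intro (isCompact_closedBall (0 : T) ρ) fun t ht => hρ t ?_
  simpa using ht

omit [BorelSpace T] in
theorem norm_toLp_le_of_support {F : T → ℂ} {ρ ε : ℝ} (hε : 0 ≤ ε) (hρ : ∀ t, ρ < ‖t‖ → F t = 0)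
    (hF : ∀ t, ‖t‖ ≤ ρ → ‖F t‖ ≤ ε) (hm : MemLp F 2 μ) :
    ‖hm.toLp F‖ ≤ ε * ((μ (Metric.closedBall (0 : T) ρ)) ^ (1 / 2 : ℝ)).toReal := by
  rw [Lp.norm_toLp]
  have hfin : μ (Metric.closedBall (0 : T) ρ) ^ (1 / 2 : ℝ) ≠ ⊤ :=
    ENNReal.rpow_ne_top_of_nonneg (by norm_num)
      (isCompact_closedBall (0 : T) ρ).measure_lt_top.ne
  have h1 : eLpNorm F 2 μ ≤ eLpNorm ((Metric.closedBall (0 : T) ρ).indicator fun _ => ε) 2 μ := by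
    refine eLpNorm_mono fun t => ?_
    by_cases ht : ‖t‖ ≤ ρ
    · rw [Set.indicator_of_mem (by simpa using ht)]
      exact (hF t ht).trans (le_abs_self ε)
    · rw [hρ t (not_le.1 ht), norm_zero]
      exact norm_nonneg _
  have h2 := h1.trans (eLpNorm_indicator_const_le (μ := μ) ε 2)
  refine (ENNReal.toReal_mono ?_ h2).trans (le_of_eq ?_)
  · exact ENNReal.mul_ne_top enorm_ne_top (by simpa using hfin)
  · rw [ENNReal.toReal_mul, toReal_enorm, Real.norm_of_nonneg hε]
    simp

omit [FiniteDimensional ℝ E] [NormedSpace ℝ T] [FiniteDimensional ℝ T] [MeasurableSpace T]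
  [BorelSpace T] in
theorem fderiv_eq_zero_of_support {H : E → T → ℂ} {R ρ : ℝ} (hρ : ∀ X, ‖X‖ ≤ R → ∀ t, ρ < ‖t‖ → H X t = 0) {X : E}
    (hX : ‖X‖ < R) {t : T} (ht : ρ < ‖t‖) : fderiv ℝ (fun X => H X t) X = 0 := by
  have : (fun X => H X t) =ᶠ[nhds X] fun _ => 0 := by
    filter_upwards [(isOpen_lt continuous_norm continuous_const).mem_nhds hX] with Y hY
    exact hρ Y (le_of_lt hY) t ht
  rw [this.fderiv_eq]
  simp

namespace IsSmoothFamily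

variable {H : E → T → ℂ} (hH : IsSmoothFamily H)
include hH

omit [FiniteDimensional ℝ E] [FiniteDimensional ℝ T] [MeasurableSpace T] [BorelSpace T] in
theorem contDiff_left (t : T) : ContDiff ℝ ∞ fun X => H X t :=
  hH.contDiff.comp (contDiff_id.prodMk contDiff_const)

omit [FiniteDimensional ℝ E] in
theorem memLp (X : E) : MemLp (H X) 2 μ := by
  obtain ⟨ρ, hρ⟩ := hH.support ‖X‖
  exact memLp_of_support (hH.contDiff.continuous.comp (Continuous.prodMk_right X)) (hρ X le_rfl)

omit [FiniteDimensional ℝ E] [FiniteDimensional ℝ T] [MeasurableSpace T] [BorelSpace T] in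
theorem contDiff_fderiv : ContDiff ℝ ∞ fun p : E × T => fderiv ℝ (fun X => H X p.2) p.1 := by
  refine ContDiff.fderiv (f := fun (p : E × T) X => H X p.2) (n := ∞) (m := ∞) ?_ contDiff_fst le_rfl
  exact hH.contDiff.comp (contDiff_snd.prodMk (contDiff_snd.comp contDiff_fst))

theorem fderiv_apply (V : E) : IsSmoothFamily fun X t => fderiv ℝ (fun X => H X t) X V where
  contDiff := hH.contDiff_fderiv.clm_apply contDiff_const
  support R := by
    obtain ⟨ρ, hρ⟩ := hH.support (R + 1)
    exact ⟨ρ, fun X hX t ht => by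
      rw [fderiv_eq_zero_of_support hρ (by linarith) ht, zero_apply]⟩

variable (μ) in
/-- The derivative of a smooth family as a map to `L²`. -/
def fderivLp (X : E) : E →L[ℝ] Lp ℂ 2 μ := LinearMap.toContinuousLinearMap
  { toFun := fun V => ((hH.fderiv_apply V).memLp X).toLp
    map_add' := fun V W => by
      rw [← MemLp.toLp_add]
      congr 1
      funext t
      simp
    map_smul' := fun c V => by
      rw [RingHom.id_apply, ← MemLp.toLp_const_smul]
      congr 1
      funext t
      simp }

/-- Near X₀ all functions vanish outside a fixed ball. On it the derivatives are uniformly close to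
the one at X₀ by compactness, and the mean value inequality bounds the remainder uniformly, hence in
L². -/
theorem hasFDerivAt_toLp (X₀ : E) :
    HasFDerivAt (fun X => (hH.memLp X).toLp (μ := μ)) (hH.fderivLp μ X₀) X₀ := by
  obtain ⟨ρ, hρ⟩ := hH.support (‖X₀‖ + 1)
  set B : ℝ := ((μ (Metric.closedBall (0 : T) ρ)) ^ (1 / 2 : ℝ)).toReal with hB
  have hB0 : 0 ≤ B := ENNReal.toReal_nonneg
  rw [hasFDerivAt_iff_isLittleO, Asymptotics.isLittleO_iff]
  intro c hc
  have hε : 0 < c / (B + 1) := by positivity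
  have hcont := hH.contDiff_fderiv.continuous
  have htube : ∀ᶠ X in nhds X₀, ∀ t ∈ Metric.closedBall (0 : T) ρ,
      ‖fderiv ℝ (fun X => H X t) X - fderiv ℝ (fun X => H X t) X₀‖ < c / (B + 1) := by
    refine (isCompact_closedBall (0 : T) ρ).eventually_forall_of_forall_eventually fun t _ => ?_
    have h1 : Continuous fun p : E × T =>
        ‖fderiv ℝ (fun X => H X p.2) p.1 - fderiv ℝ (fun X => H X p.2) X₀‖ :=
      (hcont.sub (hcont.comp (continuous_const.prodMk continuous_snd))).norm
    exact h1.continuousAt.eventually_lt continuousAt_const (by simpa using hε)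
  obtain ⟨η, hη0, hη⟩ := Metric.eventually_nhds_iff_ball.1 htube
  filter_upwards [Metric.ball_mem_nhds X₀ (lt_min hη0 one_pos)] with X hX
  have hXη : X ∈ Metric.ball X₀ η := Metric.ball_subset_ball (min_le_left _ _) hX
  have hX1 : ‖X - X₀‖ < 1 := by
    rw [← dist_eq_norm]; exact (Metric.mem_ball.1 hX).trans_le (min_le_right _ _)
  have hXn : ‖X‖ ≤ ‖X₀‖ + 1 := by
    have := norm_add_le X₀ (X - X₀)
    rw [add_sub_cancel] at this
    linarith
  have e1 : (hH.memLp X).toLp (μ := μ) - (hH.memLp X₀).toLp - hH.fderivLp μ X₀ (X - X₀)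
      = (((hH.memLp X).sub (hH.memLp X₀)).sub ((hH.fderiv_apply (X - X₀)).memLp X₀)).toLp := by
    rw [MemLp.toLp_sub ((hH.memLp X).sub (hH.memLp X₀)) ((hH.fderiv_apply (X - X₀)).memLp X₀),
      MemLp.toLp_sub (hH.memLp X) (hH.memLp X₀)]
    rfl
  rw [e1]
  refine (norm_toLp_le_of_support (ρ := ρ) (ε := c / (B + 1) * ‖X - X₀‖) (by positivity)
    (fun t ht => ?_) (fun t ht => ?_) _).trans ?_
  · simp only [Pi.sub_apply]
    rw [hρ X hXn t ht, hρ X₀ (by linarith) t ht, fderiv_eq_zero_of_support hρ (by linarith) ht]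
    simp
  · simp only [Pi.sub_apply]
    refine (convex_ball X₀ η).norm_image_sub_le_of_norm_hasFDerivWithin_le'
      (f := fun X => H X t) (f' := fun X => fderiv ℝ (fun X => H X t) X) (fun Y _ => ?_)
      (fun Y hY => (hη Y hY t (by simpa using ht)).le) (Metric.mem_ball_self hη0) hXη
    exact (((hH.contDiff_left t).differentiable (by simp)) Y).hasFDerivAt.hasFDerivWithinAt
  · rw [← hB]
    have : c / (B + 1) * B ≤ c := by
      rw [div_mul_eq_mul_div, div_le_iff₀ (by positivity)]
      nlinarith
    calc c / (B + 1) * ‖X - X₀‖ * B = c / (B + 1) * B * ‖X - X₀‖ := by ring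
      _ ≤ _ := by gcongr

theorem fderiv_toLp_apply (X V : E) :
    fderiv ℝ (fun X => (hH.memLp X).toLp (μ := μ)) X V = ((hH.fderiv_apply V).memLp X).toLp := by
  rw [(hH.hasFDerivAt_toLp X).fderiv]
  rfl

omit hH in
theorem contDiff_nat_toLp (n : ℕ) : ∀ {H : E → T → ℂ} (hH : IsSmoothFamily H),
    ContDiff ℝ n fun X => (hH.memLp X).toLp (μ := μ) := by
  induction n with
  | zero =>
    intro H hH
    exact contDiff_zero.2 (Differentiable.continuous (𝕜 := ℝ)
      fun X => (hH.hasFDerivAt_toLp X).differentiableAt)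
  | succ n ih =>
    intro H hH
    push_cast
    refine contDiff_succ_iff_fderiv_apply.2
      ⟨fun X => (hH.hasFDerivAt_toLp X).differentiableAt, by simp, fun V => ?_⟩
    simp only [hH.fderiv_toLp_apply]
    exact ih (hH.fderiv_apply V)

theorem contDiff_toLp : ContDiff ℝ ∞ fun X => (hH.memLp X).toLp (μ := μ) :=
  contDiff_infty.2 fun n => contDiff_nat_toLp n hH

end IsSmoothFamily

end SmoothFamily

namespace MetricLieAlgebra

variable {𝔤 : MetricLieAlgebra.{u}}

open NormedSpace

/-! ### Matrix coefficients of approximate eigenvectors -/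

/-- The orbit map `X ↦ σ(exp X) u` of a smooth unit vector that is, up to the error `A ‖Y‖`, an
eigenvector of the Lie algebra with eigenvalue `2 π i ζ`. -/
structure IsCoherentOrbit {k : ℕ} (ζ : StrongDual ℝ 𝔤) (A : ℝ)
    (Φ : 𝔤 → Lp ℂ 2 (volume : Measure (Fin k → ℝ))) : Prop where
  nonneg : 0 ≤ A
  contDiff : ContDiff ℝ ∞ Φ
  norm_eq : ∀ X, ‖Φ X‖ = 1
  norm_sub_le : ∀ g Y, ‖fderiv ℝ (fun Z => Φ (bch g Z)) 0 Y
    - (2 * Real.pi * Complex.I * ζ Y : ℂ) • Φ g‖ ≤ A * ‖Y‖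

namespace IsCoherentOrbit

variable {k : ℕ} {ζ : StrongDual ℝ 𝔤} {A : ℝ} {Φ : 𝔤 → Lp ℂ 2 (volume : Measure (Fin k → ℝ))}
  (h : IsCoherentOrbit ζ A Φ)
include h

theorem contDiff_inner (v : Lp ℂ 2 (volume : Measure (Fin k → ℝ))) :
    ContDiff ℝ ∞ fun X => (inner ℂ v (Φ X) : ℂ) :=
  ((innerSL ℂ v).restrictScalars ℝ).contDiff.comp h.contDiff

theorem norm_inner_le {v : Lp ℂ 2 (volume : Measure (Fin k → ℝ))} (hv : ‖v‖ = 1) (X : 𝔤) :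
    ‖(inner ℂ v (Φ X) : ℂ)‖ ≤ 1 := by
  simpa [hv, h.norm_eq X] using norm_inner_le_norm (𝕜 := ℂ) v (Φ X)

theorem differentiableAt_bch (g : 𝔤) : DifferentiableAt ℝ (fun Z => Φ (bch g Z)) 0 :=
  ((h.contDiff.comp (contDiff_const.bch contDiff_id)).differentiable (by simp)).differentiableAt

theorem fderiv_inner_bch (v : Lp ℂ 2 (volume : Measure (Fin k → ℝ))) (g Y : 𝔤) :
    fderiv ℝ (fun Z => (inner ℂ v (Φ (bch g Z)) : ℂ)) 0 Y
      = inner ℂ v (fderiv ℝ (fun Z => Φ (bch g Z)) 0 Y) := by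
  have := ((innerSL ℂ v).restrictScalars ℝ).hasFDerivAt.comp (0 : 𝔤)
    (h.differentiableAt_bch g).hasFDerivAt
  exact congrArg (fun f : 𝔤 →L[ℝ] ℂ => f Y) this.fderiv

theorem norm_fderiv_inner_bch_sub_le {v : Lp ℂ 2 (volume : Measure (Fin k → ℝ))} (hv : ‖v‖ = 1)
    (g Y : 𝔤) : ‖fderiv ℝ (fun Z => (inner ℂ v (Φ (bch g Z)) : ℂ)) 0 Y
      - 2 * Real.pi * Complex.I * ζ Y * inner ℂ v (Φ g)‖ ≤ A * ‖Y‖ := by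
  rw [h.fderiv_inner_bch, ← inner_smul_right, ← inner_sub_right]
  refine (norm_inner_le_norm _ _).trans ?_
  rw [hv, one_mul]
  exact h.norm_sub_le g Y

theorem norm_fderiv_inner_bch_le {v : Lp ℂ 2 (volume : Measure (Fin k → ℝ))} (hv : ‖v‖ = 1)
    (g Y : 𝔤) : ‖fderiv ℝ (fun Z => (inner ℂ v (Φ (bch g Z)) : ℂ)) 0 Y‖
      ≤ (2 * Real.pi * ‖ζ‖ + A) * ‖Y‖ := by
  have h1 := h.norm_fderiv_inner_bch_sub_le hv g Y
  have h2 : ‖2 * Real.pi * Complex.I * ζ Y * inner ℂ v (Φ g)‖ ≤ 2 * Real.pi * (‖ζ‖ * ‖Y‖) := by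
    have hp := Real.pi_pos
    rw [norm_mul, norm_mul, norm_mul, norm_mul, Complex.norm_real, Complex.norm_real,
      Complex.norm_I, Complex.norm_ofNat, mul_one, Real.norm_of_nonneg hp.le]
    calc _ ≤ 2 * Real.pi * ‖ζ Y‖ * 1 := by gcongr; exact h.norm_inner_le hv g
      _ ≤ _ := by rw [mul_one]; gcongr; exact ζ.le_opNorm Y
  have h3 := norm_add_le (fderiv ℝ (fun Z => (inner ℂ v (Φ (bch g Z)) : ℂ)) 0 Y
      - 2 * Real.pi * Complex.I * ζ Y * inner ℂ v (Φ g))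
      (2 * Real.pi * Complex.I * ζ Y * inner ℂ v (Φ g))
  rw [sub_add_cancel] at h3
  linarith

theorem groupC1Norm_le {v : Lp ℂ 2 (volume : Measure (Fin k → ℝ))} (hv : ‖v‖ = 1) :
    groupC1Norm (fun X => (inner ℂ v (Φ X) : ℂ))
      ≤ ENNReal.ofReal (1 + (2 * Real.pi * ‖ζ‖ + A)) := by
  have hp := Real.pi_pos
  have hA := h.nonneg
  rw [ENNReal.ofReal_add zero_le_one (by positivity)]
  refine add_le_add (iSup_le fun g => ?_) (iSup_le fun g => iSup_le fun Y => iSup_le fun hY => ?_)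
  · rw [← ofReal_norm]
    exact ENNReal.ofReal_le_ofReal (h.norm_inner_le hv g)
  · rw [← ofReal_norm]
    refine ENNReal.ofReal_le_ofReal ?_
    rw [(hasDerivAt_comp_bch (h.contDiff_inner v) g (hasDerivAt_smul_self Y 0)
      (zero_smul _ _)).deriv]
    exact (h.norm_fderiv_inner_bch_le hv g Y).trans (mul_le_of_le_one_right (by positivity) hY)

/-- A derivative in the exponential chart is a left-invariant derivative whose direction is changed
by the differential of exp. Thus the norm on the ball reduces to the estimates on the group, with a
factor e^(KR). -/
theorem fderiv_inner_apply [LieRing.IsNilpotent 𝔤] (v : Lp ℂ 2 (volume : Measure (Fin k → ℝ)))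
    (X V : 𝔤) : fderiv ℝ (fun X => (inner ℂ v (Φ X) : ℂ)) X V
      = fderiv ℝ (fun Z => (inner ℂ v (Φ (bch X Z)) : ℂ)) 0 (expInt (adL X) 1 V) := by
  have h1 : HasFDerivAt (fun X => (inner ℂ v (Φ X) : ℂ))
      (fderiv ℝ (fun X => (inner ℂ v (Φ X) : ℂ)) X) (bch X 0) := by
    rw [bch_zero]
    exact ((h.contDiff_inner v).differentiable (by simp)).differentiableAt.hasFDerivAt
  have h2 := h1.comp (0 : 𝔤) (hasFDerivAt_bch_right X)
  rw [show (fun Z => (inner ℂ v (Φ (bch X Z)) : ℂ)) = (fun X => inner ℂ v (Φ X)) ∘ bch X from rfl,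
    h2.fderiv, ContinuousLinearMap.comp_apply]
  congr 1
  exact (congrArg (fun f : 𝔤 →L[ℝ] 𝔤 => f V) (bchKernel_expInt X)).symm

theorem ballC1Norm_le [LieRing.IsNilpotent 𝔤] {K : ℝ} (hK0 : 0 ≤ K)
    (hK : ∀ X Y : 𝔤, ‖⁅X, Y⁆‖ ≤ K * ‖X‖ * ‖Y‖) (R : ℝ)
    {v : Lp ℂ 2 (volume : Measure (Fin k → ℝ))} (hv : ‖v‖ = 1) :
    ballC1Norm R (fun X => (inner ℂ v (Φ X) : ℂ))
      ≤ ENNReal.ofReal (1 + (2 * Real.pi * ‖ζ‖ + A) * Real.exp (K * R)) := by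
  have hp := Real.pi_pos
  have hA := h.nonneg
  rw [ENNReal.ofReal_add zero_le_one (by positivity)]
  refine add_le_add (iSup_le fun X => iSup_le fun hX => ?_)
    (iSup_le fun X => iSup_le fun hX => ?_)
  · rw [← ofReal_norm]
    exact ENNReal.ofReal_le_ofReal (h.norm_inner_le hv X)
  · rw [← ofReal_norm]
    refine ENNReal.ofReal_le_ofReal ?_
    refine ContinuousLinearMap.opNorm_le_bound _ (by positivity) fun V => ?_
    rw [h.fderiv_inner_apply]
    have hXR : ‖adL X‖ ≤ K * R := (norm_adL_le hK0 hK X).trans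
      (mul_le_mul_of_nonneg_left (by simpa using (Metric.mem_ball.1 hX).le) hK0)
    calc _ ≤ (2 * Real.pi * ‖ζ‖ + A) * ‖expInt (adL X) 1 V‖ := h.norm_fderiv_inner_bch_le hv _ _
      _ ≤ (2 * Real.pi * ‖ζ‖ + A) * (Real.exp (K * R) * ‖V‖) := by
        gcongr
        refine (norm_expInt_apply_le X V).trans ?_
        gcongr
      _ = _ := by ring

/-- On the one-parameter group s ↦ sX, the function m(sX)e^(-2πisζ(X)) starts at 1, and its
derivative is exactly the eigenvector error. -/
theorem norm_inner_mul_exp_sub_one_le [LieRing.IsNilpotent 𝔤] (X : 𝔤) :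
    ‖(inner ℂ (Φ 0) (Φ X) : ℂ) * Complex.exp (-(2 * Real.pi * Complex.I * ζ X)) - 1‖
      ≤ A * ‖X‖ := by
  set m : 𝔤 → ℂ := fun X => inner ℂ (Φ 0) (Φ X) with hm
  set z : ℂ := 2 * Real.pi * Complex.I * ζ X with hz
  set D : ℝ → ℂ := fun s => fderiv ℝ (fun Z => m (bch (s • X) Z)) 0 X with hD
  have hd : ∀ s : ℝ, HasDerivAt (fun s : ℝ => m (s • X)) (D s) s := fun s => by
    have h1 : HasDerivAt (fun t : ℝ => t • X) X 0 := hasDerivAt_smul_self X 0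
    have h2 := hasDerivAt_comp_bch (h.contDiff_inner (Φ 0)) (s • X) h1 (zero_smul _ _)
    simp only [smul_bch_smul] at h2
    have h3 : HasDerivAt (fun t : ℝ => m ((s + t) • X)) (D s) (s - s) := by
      rw [sub_self]; exact h2
    have h4 := h3.comp_sub_const s s
    simpa using h4
  have hw : ∀ s : ℝ, HasDerivAt (fun s : ℝ => m (s • X) * Complex.exp (-(s * z)))
      ((D s - z * m (s • X)) * Complex.exp (-(s * z))) s := fun s => by
    have h1 : HasDerivAt (fun s : ℝ => -((s : ℂ) * z)) (-z) s := by
      exact ((hasDerivAt_id s).ofReal_comp.mul_const z).neg.congr_deriv (by simp)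
    exact ((hd s).mul h1.cexp).congr_deriv (by ring)
  have hexp : ∀ s : ℝ, ‖Complex.exp (-(s * z))‖ = 1 := fun s => by
    have : -(s * z) = 2 * Real.pi * Complex.I * ((-(s * ζ X) : ℝ) : ℂ) := by
      rw [hz]; push_cast; ring
    rw [this, norm_exp_two_pi_I_mul]
  have hb : ∀ s : ℝ, ‖(D s - z * m (s • X)) * Complex.exp (-(s * z))‖ ≤ A * ‖X‖ := fun s => by
    rw [norm_mul, hexp, mul_one]
    exact h.norm_fderiv_inner_bch_sub_le (h.norm_eq 0) (s • X) X
  have := (convex_univ (𝕜 := ℝ)).norm_image_sub_le_of_norm_hasDerivWithin_le (C := A * ‖X‖)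
    (fun s _ => (hw s).hasDerivWithinAt) (fun s _ => hb s) (Set.mem_univ (0 : ℝ))
    (Set.mem_univ (1 : ℝ))
  have hm0 : m 0 = 1 := by
    simp only [hm]
    rw [inner_self_eq_norm_sq_to_K, h.norm_eq 0]
    simp
  simpa [hm0] using this

end IsCoherentOrbit

/-- The bound on x excludes negative cosines; together with the small sine it gives cos ≥ 1/2. The
real part is then at least 1/2 · 1/2 - 1/2 · 1/8 = 3/16. -/
theorem half_mul_cos_sub_le {w : ℂ} {x : ℝ} (hw : ‖w - 1‖ ≤ 1 / 2)
    (hx : |Real.sin (2 * Real.pi * x)| ≤ 1 / 8) (hx1 : |x| ≤ 1 / 4) :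
    1 / 8 ≤ (w * Complex.exp (-(2 * Real.pi * Complex.I * x))).re := by
  have h1 : (w * Complex.exp (-(2 * Real.pi * Complex.I * x))).re
      = w.re * Real.cos (2 * Real.pi * x) + w.im * Real.sin (2 * Real.pi * x) := by
    rw [show -(2 * Real.pi * Complex.I * x) = ((-(2 * Real.pi * x) : ℝ) : ℂ) * Complex.I by
      push_cast; ring, Complex.mul_re, Complex.exp_ofReal_mul_I_re, Complex.exp_ofReal_mul_I_im,
      Real.cos_neg, Real.sin_neg]
    ring
  rw [h1]
  have h2 : |w.re - 1| ≤ 1 / 2 := by simpa using (Complex.abs_re_le_norm (w - 1)).trans hw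
  have h3 : |w.im| ≤ 1 / 2 := by simpa using (Complex.abs_im_le_norm (w - 1)).trans hw
  have h4 : 0 ≤ Real.cos (2 * Real.pi * x) := by
    have hp := Real.pi_pos
    rw [abs_le] at hx1
    refine Real.cos_nonneg_of_neg_pi_div_two_le_of_le ?_ ?_ <;> nlinarith
  have h5 : 1 / 2 ≤ Real.cos (2 * Real.pi * x) := by
    have h6 := Real.sin_sq_add_cos_sq (2 * Real.pi * x)
    have h7 : Real.sin (2 * Real.pi * x) ^ 2 ≤ (1 / 8) ^ 2 := sq_le_sq' (abs_le.1 hx).1 (abs_le.1 hx).2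
    nlinarith
  have h6 : |w.im * Real.sin (2 * Real.pi * x)| ≤ 1 / 2 * (1 / 8) := by
    rw [abs_mul]
    exact mul_le_mul h3 hx (abs_nonneg _) (by norm_num)
  have h7 := (abs_le.1 h6).1
  have h8 := (abs_le.1 h2).1
  nlinarith

/-- The inequality holds pointwise: on the support, m(X)e^(-2πiζ(X)) is within 1/2 of 1, and the
remaining phase (η - ζ)(X) is below δ. -/
theorem IsCoherentOrbit.integral_re_ge [LieRing.IsNilpotent 𝔤] {k : ℕ} {ζ : StrongDual ℝ 𝔤} {A : ℝ}
    {Φ : 𝔤 → Lp ℂ 2 (volume : Measure (Fin k → ℝ))} (h : IsCoherentOrbit ζ A Φ) {n N : ℕ}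
    (hn : Module.finrank ℝ 𝔤 = n) (hnN : n ≤ N) {δ : ℝ} (hδ0 : 0 < δ)
    (hδ : ∀ x : ℝ, |x| < δ → |Real.sin (2 * Real.pi * x)| ≤ 1 / 2 ^ (3 * N))
    {ε r : ℝ} (hε : 0 < ε) (hr1 : r ≤ 1) (hA : A * (ε * r) ≤ 1 / 2)
    {η : StrongDual ℝ 𝔤} (hη : ‖η - ζ‖ < ε⁻¹ * δ) {φ : 𝔤 → ℝ} (hφ : Continuous φ)
    (hφc : HasCompactSupport φ) (hsupp : tsupport φ ⊆ Metric.ball 0 (ε * r))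
    (hφ0 : ∀ X, 0 ≤ φ X) :
    (∫ X, φ X) / 2 ^ (3 * n) ≤ (∫ X, (inner ℂ (Φ 0) (Φ X) : ℂ) * (φ X : ℂ) *
      Complex.exp (-(2 * Real.pi * Complex.I * η X))).re := by
  set F : 𝔤 → ℂ := fun X => (inner ℂ (Φ 0) (Φ X) : ℂ) * (φ X : ℂ) *
      Complex.exp (-(2 * Real.pi * Complex.I * η X)) with hF
  have hFc : Continuous F := by
    have := (h.contDiff_inner (Φ 0)).continuous
    fun_prop
  have hFs : HasCompactSupport F := by
    refine hφc.mono fun X hX hX0 => hX ?_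
    simp only [hF, hX0]
    simp
  have hFi : Integrable F := hFc.integrable_of_hasCompactSupport hFs
  have hre : (∫ X, F X).re = ∫ X, (F X).re := (integral_re hFi).symm
  rw [hre, ← integral_div]
  refine integral_mono ((hφ.integrable_of_hasCompactSupport hφc).div_const _) hFi.re fun X => ?_
  change φ X / 2 ^ (3 * n) ≤ (F X).re
  by_cases hX : φ X = 0
  · simp [hF, hX]
  have hXb : ‖X‖ < ε * r := by simpa using hsupp (subset_tsupport φ hX)
  set w : ℂ := (inner ℂ (Φ 0) (Φ X) : ℂ) * Complex.exp (-(2 * Real.pi * Complex.I * ζ X)) with hw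
  set x : ℝ := η X - ζ X with hx
  have hFX : F X = (φ X : ℂ) * (w * Complex.exp (-(2 * Real.pi * Complex.I * x))) := by
    have : Complex.exp (-(2 * Real.pi * Complex.I * η X))
        = Complex.exp (-(2 * Real.pi * Complex.I * ζ X)) *
          Complex.exp (-(2 * Real.pi * Complex.I * x)) := by
      rw [← Complex.exp_add, hx]
      push_cast
      ring_nf
    simp only [hF, hw]
    rw [this]
    ring
  rw [hFX, Complex.re_ofReal_mul, div_eq_mul_inv, ← one_div]
  refine mul_le_mul_of_nonneg_left ?_ (hφ0 X)
  have hw1 := h.norm_inner_mul_exp_sub_one_le X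
  rw [← hw] at hw1
  -- For n = 0 the required factor is 1 instead of at most 1/8; it is attained, since the algebra is
  -- a point.
  rcases Nat.eq_zero_or_pos n with rfl | hn0
  · have hX0 : X = 0 := by
      have := Module.finrank_zero_iff.1 hn
      exact Subsingleton.elim _ _
    have hx0 : x = 0 := by simp [hx, hX0]
    have hw0 : w = 1 := by
      rw [hX0, norm_zero, mul_zero] at hw1
      exact sub_eq_zero.1 (norm_le_zero_iff.1 hw1)
    rw [hx0, hw0]
    simp
  have hpow : ∀ m : ℕ, 0 < m → (1 : ℝ) / 2 ^ (3 * m) ≤ 1 / 8 := fun m hm => by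
    refine one_div_le_one_div_of_le (by norm_num) ?_
    calc (8 : ℝ) = 2 ^ 3 := by norm_num
      _ ≤ 2 ^ (3 * m) := pow_le_pow_right₀ (by norm_num) (by omega)
  -- Otherwise x = 1/4 would be allowed in the hypothesis on δ, where the sine equals 1.
  have hδ4 : δ ≤ 1 / 4 := by
    by_contra! hlt
    have := (hδ (1 / 4) (by rwa [abs_of_pos (by norm_num)])).trans (hpow N (hn0.trans_le hnN))
    rw [show 2 * Real.pi * (1 / 4) = Real.pi / 2 by ring, Real.sin_pi_div_two] at this
    norm_num at this
  have hxδ : |x| < δ := by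
    have h1 : |x| ≤ ‖η - ζ‖ * ‖X‖ := (η - ζ).le_opNorm X
    have h2 : ‖η - ζ‖ * ‖X‖ ≤ ‖η - ζ‖ * ε := by
      gcongr
      nlinarith
    have h3 : ‖η - ζ‖ * ε < δ := by
      calc _ < ε⁻¹ * δ * ε := by gcongr
        _ = δ := by field_simp
    linarith
  refine (hpow n hn0).trans (half_mul_cos_sub_le (hw1.trans ?_)
    ((hδ x hxδ).trans (hpow N (hn0.trans_le hnN))) (hxδ.le.trans hδ4))
  exact (mul_le_mul_of_nonneg_left hXb.le h.nonneg).trans hA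

end MetricLieAlgebra

theorem IsSmoothFamily.comp {E E' T : Type*} [NormedAddCommGroup E] [NormedSpace ℝ E]
    [NormedAddCommGroup E'] [NormedSpace ℝ E'] [FiniteDimensional ℝ E']
    [NormedAddCommGroup T] [NormedSpace ℝ T] {H : E → T → ℂ} (hH : IsSmoothFamily H) {c : E' → E}
    (hc : ContDiff ℝ ∞ c) : IsSmoothFamily fun X t => H (c X) t where
  contDiff := hH.contDiff.comp ((hc.comp contDiff_fst).prodMk contDiff_snd)
  support R := by
    obtain ⟨R', hR'⟩ := ((isCompact_closedBall (0 : E') R).image hc.continuous).isBounded.exists_norm_le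
    obtain ⟨ρ, hρ⟩ := hH.support R'
    exact ⟨ρ, fun X hX => hρ _ (hR' _ ⟨X, by simpa using hX, rfl⟩)⟩

theorem IsSmoothFamily.const_mul {E T : Type*} [NormedAddCommGroup E] [NormedSpace ℝ E]
    [NormedAddCommGroup T] [NormedSpace ℝ T] {H : E → T → ℂ} (hH : IsSmoothFamily H) (c : ℂ) :
    IsSmoothFamily fun X t => c * H X t where
  contDiff := contDiff_const.mul hH.contDiff
  support R := by
    obtain ⟨ρ, hρ⟩ := hH.support R
    exact ⟨ρ, fun X hX t ht => by rw [hρ X hX t ht, mul_zero]⟩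

theorem MeasureTheory.MemLp.ofReal_norm_toLp_sq {T : Type*} [MeasurableSpace T] {μ : Measure T}
    {F : T → ℂ} (hF : MemLp F 2 μ) : ENNReal.ofReal (‖hF.toLp F‖ ^ 2) = ∫⁻ t, ‖F t‖ₑ ^ 2 ∂μ := by
  rw [Lp.norm_toLp, ENNReal.ofReal_pow ENNReal.toReal_nonneg, ENNReal.ofReal_toReal hF.2.ne]
  have := eLpNorm_nnreal_pow_eq_lintegral (μ := μ) (f := F) (p := 2) two_ne_zero
  simpa using this

/-! ### Cutoff profiles and the normalized coherent state of an adapted tower. -/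

namespace MetricLieAlgebra

variable {𝔤 : MetricLieAlgebra.{u}}

/-- A smooth cutoff function with an upper bound for its derivative and a lower bound for its
`L²` norm. -/
structure IsProfile (β : ℝ → ℝ) (L D : ℝ) : Prop where
  contDiff : ContDiff ℝ ∞ β
  map_zero : β 0 = 1
  abs_le_one : ∀ x, |β x| ≤ 1
  eq_zero : ∀ x, 1 < |x| → β x = 0
  abs_deriv_le : ∀ x, |deriv β x| ≤ L
  one_le : 1 ≤ D
  two_le : 2 ≤ ENNReal.ofReal (D ^ 2) * ∫⁻ x, ENNReal.ofReal (β x ^ 2)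

/-- A bump equal to 1 on [-1/2, 1/2] has squared L² norm at least 1, so D = 2 leaves room: 2 ≤ D² ·
1. -/
theorem exists_isProfile : ∃ (β : ℝ → ℝ) (L D : ℝ), IsProfile β L D := by
  let β : ContDiffBump (0 : ℝ) := ⟨1 / 2, 1, by norm_num, by norm_num⟩
  have hβ : ContDiff ℝ ∞ β := β.contDiff
  have hc : HasCompactSupport (deriv β) := β.hasCompactSupport.deriv
  obtain ⟨L, hL⟩ := hc.exists_bound_of_continuous (hβ.continuous_deriv (by simp))
  refine ⟨β, L, 2, hβ, β.one_of_mem_closedBall (by simp [β]), fun x => ?_, fun x hx => ?_, hL,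
    one_le_two, ?_⟩
  · rw [abs_of_nonneg β.nonneg]
    exact β.le_one
  · exact β.zero_of_le_dist (by simpa [β] using hx.le)
  · have h1 : (1 : ℝ≥0∞) ≤ ∫⁻ x, ENNReal.ofReal (β x ^ 2) := by
      calc (1 : ℝ≥0∞) = ∫⁻ _ in Metric.closedBall (0 : ℝ) (1 / 2), 1 := by
            rw [setLIntegral_one, Real.volume_closedBall]
            norm_num
        _ ≤ ∫⁻ x in Metric.closedBall (0 : ℝ) (1 / 2), ENNReal.ofReal (β x ^ 2) := by
            refine setLIntegral_mono' measurableSet_closedBall fun x hx => ?_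
            rw [β.one_of_mem_closedBall hx]
            simp
        _ ≤ _ := setLIntegral_le_lintegral _ _
    calc (2 : ℝ≥0∞) ≤ ENNReal.ofReal (2 ^ 2) * 1 := by
          rw [mul_one, ENNReal.ofReal_pow (by norm_num)]; norm_num
      _ ≤ _ := by gcongr

namespace IsProfile

variable {β : ℝ → ℝ} {L D : ℝ} (hβ : IsProfile β L D)
include hβ

theorem deriv_eq_zero (x : ℝ) (hx : 1 < |x|) : deriv β x = 0 := by
  have : β =ᶠ[nhds x] fun _ => 0 := by
    filter_upwards [(isOpen_lt continuous_const continuous_abs).mem_nhds hx] with y hy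
    exact hβ.eq_zero y hy
  rw [this.deriv_eq]
  simp

theorem measurable (r : ℝ) : Measurable fun τ => ENNReal.ofReal (β (τ / r) ^ 2) :=
  (((hβ.contDiff.continuous.comp (by fun_prop : Continuous fun τ : ℝ => τ / r)).pow 2).measurable).ennreal_ofReal

omit hβ in
theorem lintegral_div {r : ℝ} (hr : 0 < r) : ∫⁻ τ, ENNReal.ofReal (β (τ / r) ^ 2)
    = ENNReal.ofReal r * ∫⁻ x, ENNReal.ofReal (β x ^ 2) := by
  have := lintegral_comp_mul_add (f := fun x => ENNReal.ofReal (β x ^ 2)) (inv_ne_zero hr.ne') 0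
  simpa [div_eq_mul_inv, abs_of_pos hr] using this

theorem lintegral_ne_top : ∫⁻ x, ENNReal.ofReal (β x ^ 2) ≠ ⊤ := by
  have h : ∀ x, ENNReal.ofReal (β x ^ 2)
      ≤ (Set.Icc (-1 : ℝ) 1).indicator (fun _ => (1 : ℝ≥0∞)) x := fun x => by
    by_cases hx : x ∈ Set.Icc (-1 : ℝ) 1
    · rw [Set.indicator_of_mem hx, ENNReal.ofReal_le_one]
      exact (sq_le_one_iff_abs_le_one _).2 (hβ.abs_le_one x)
    · rw [hβ.eq_zero x (not_le.1 fun h => hx (abs_le.1 h))]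
      simp
  refine ((lintegral_mono h).trans_lt ?_).ne
  rw [lintegral_indicator measurableSet_Icc]
  simp

theorem lintegral_ne_zero : ∫⁻ x, ENNReal.ofReal (β x ^ 2) ≠ 0 := fun h => by
  have := hβ.two_le
  rw [h, mul_zero] at this
  simp at this

/-- The box has length 2r and the scaled bump has mass r∫β², so the ratio does not depend on r. -/
theorem lintegral_box_le {r : ℝ} (hr : 0 < r) : ∫⁻ τ : ℝ, (if |τ| ≤ r then 1 else 0)
    ≤ ENNReal.ofReal (D ^ 2) * ∫⁻ τ, ENNReal.ofReal (β (τ / r) ^ 2) := by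
  have h : ∫⁻ τ : ℝ, (if |τ| ≤ r then 1 else 0 : ℝ≥0∞) = ENNReal.ofReal r * 2 := by
    have h1 : (fun τ : ℝ => (if |τ| ≤ r then 1 else 0 : ℝ≥0∞))
        = (Set.Icc (-r) r).indicator fun _ => 1 := by
      funext τ
      simp [Set.indicator, Set.mem_Icc, abs_le]
    rw [h1, lintegral_indicator measurableSet_Icc, setLIntegral_one, Real.volume_Icc,
      ← ENNReal.ofReal_ofNat, ← ENNReal.ofReal_mul hr.le]
    ring_nf
  rw [h, lintegral_div hr, mul_left_comm]
  gcongr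
  exact hβ.two_le

end IsProfile

/-- The hypotheses under which a coherent state is studied: a tower that starts with the
polarization `𝔪` and ends with `𝔤`, adapted to the section defined by the basis `b`. -/
structure IsAdaptedTower {n : ℕ} (b : Module.Basis (Fin n) ℝ 𝔤) (k : ℕ) (𝔪 : LieSubalgebra ℝ 𝔤)
    (𝔥 : ℕ → Submodule ℝ 𝔤) (e a : ℕ → 𝔤) : Prop extends IsTower 𝔥 e where
  zero_eq : 𝔥 0 = 𝔪.toSubmodule
  eq_top : 𝔥 n = ⊤
  mem_succ : ∀ j, a j ∈ 𝔥 (j + 1)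
  inner_ne_zero : ∀ j, e j ≠ 0 → (inner ℝ (e j) (a j) : ℝ) ≠ 0
  length_eq : (towerList e a n).length = k
  section_eq : ∀ t : Fin k → ℝ, cosetSection b 𝔪 t = listSection (towerList e a n) t

namespace IsAdaptedTower

variable {n : ℕ} {b : Module.Basis (Fin n) ℝ 𝔤} {k : ℕ} {𝔪 : LieSubalgebra ℝ 𝔤}
  {𝔥 : ℕ → Submodule ℝ 𝔤} {e a : ℕ → 𝔤} (hT : IsAdaptedTower b k 𝔪 𝔥 e a)
  {β : ℝ → ℝ} {L D : ℝ} (hβ : IsProfile β L D) {ζ : StrongDual ℝ 𝔤} {r : ℝ} (hr : 0 < r)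
include hT

theorem mem_top (X : 𝔤) : X ∈ 𝔥 n := by rw [hT.eq_top]; exact Submodule.mem_top

theorem contDiff_cosetSection : ContDiff ℝ ∞ (cosetSection b 𝔪 : (Fin k → ℝ) → 𝔤) := by
  rw [show (cosetSection b 𝔪 : (Fin k → ℝ) → 𝔤) = _ from funext hT.section_eq]
  exact contDiff_listSection _ hT.length_eq

variable [LieRing.IsNilpotent 𝔤]

include hβ hr

theorem isSmoothFamily_wave : IsSmoothFamily fun (X : 𝔤) (t : Fin k → ℝ) =>
    wave ζ β r e n (bch (cosetSection b 𝔪 t) X) where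
  contDiff := (contDiff_wave hβ.contDiff n).comp
    ((hT.contDiff_cosetSection.comp contDiff_snd).bch contDiff_fst)
  support R := by
    obtain ⟨ρ, hρ⟩ := hT.exists_bound_of_towerBox_ne_zero hT.mem_succ hT.inner_ne_zero hT.norm_le r
      n hT.length_eq R
    refine ⟨max ρ 0, fun X hX t ht => ?_⟩
    by_contra hne
    refine ht.not_ge ((pi_norm_le_iff_of_nonneg (le_max_right _ _)).2 fun i => ?_)
    refine (hρ X (hT.mem_top X) hX t (fun h0 => hne ?_) i).trans (le_max_left _ _)
    have := norm_wave_le (ζ := ζ) hβ.abs_le_one hβ.eq_zero hr (e := e) n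
      (bch (listSection (towerList e a n) t) X)
    rw [h0] at this
    rw [hT.section_eq]
    exact norm_le_zero_iff.1 this

omit hr in
-- The value does not involve `X`: this is the unitarity of the right translations, as far as it is
-- needed.
theorem lintegral_wave (X : 𝔤) :
    ∫⁻ t : Fin k → ℝ, ‖wave ζ β r e n (bch (cosetSection b 𝔪 t) X)‖ₑ ^ 2
      = towerMass e a (fun _ τ => ENNReal.ofReal (β (τ / r) ^ 2)) n := by
  simp only [enorm_wave_sq, hT.section_eq]
  exact hT.lintegral_towerProd hT.mem_succ hT.inner_ne_zero (fun _ => hβ.measurable r)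
    (fun _ => by simp [hβ.map_zero]) n hT.length_eq (hT.mem_top X)

theorem lintegral_towerBox_le (X : 𝔤) :
    ∫⁻ t : Fin k → ℝ, ENNReal.ofReal (towerBox r e n (bch (cosetSection b 𝔪 t) X)) ^ 2
      ≤ ENNReal.ofReal (D ^ 2) ^ n *
        towerMass e a (fun _ τ => ENNReal.ofReal (β (τ / r) ^ 2)) n := by
  simp only [ofReal_towerBox_sq, hT.section_eq]
  rw [hT.lintegral_towerProd hT.mem_succ hT.inner_ne_zero (fun _ => ?_)
    (fun _ => by simp [hr.le]) n hT.length_eq (hT.mem_top X)]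
  · refine towerMass_le ?_ (fun _ => hβ.lintegral_box_le hr) n
    rw [ENNReal.one_le_ofReal]
    exact one_le_pow₀ hβ.one_le
  · exact Measurable.ite (measurableSet_le (by fun_prop) measurable_const) measurable_const
      measurable_const

omit [LieRing.IsNilpotent 𝔤] in
theorem towerMass_wave_ne_zero :
    towerMass e a (fun _ τ => ENNReal.ofReal (β (τ / r) ^ 2)) n ≠ 0 := by
  refine towerMass_ne_zero hT.inner_ne_zero (fun _ => ?_) n
  rw [IsProfile.lintegral_div hr]
  exact mul_ne_zero (ENNReal.ofReal_pos.2 hr).ne' hβ.lintegral_ne_zero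

omit hT [LieRing.IsNilpotent 𝔤] in
theorem towerMass_wave_ne_top :
    towerMass e a (fun _ τ => ENNReal.ofReal (β (τ / r) ^ 2)) n ≠ ⊤ := by
  refine towerMass_ne_top (fun _ => ?_) n
  rw [IsProfile.lintegral_div hr]
  exact ENNReal.mul_ne_top ENNReal.ofReal_ne_top hβ.lintegral_ne_top

theorem norm_toLp_wave_sq (X : 𝔤) :
    ‖((hT.isSmoothFamily_wave hβ hr (ζ := ζ)).memLp (μ := volume) X).toLp‖ ^ 2
      = (towerMass e a (fun _ τ => ENNReal.ofReal (β (τ / r) ^ 2)) n).toReal := by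
  rw [← hT.lintegral_wave hβ (ζ := ζ) X, ← MemLp.ofReal_norm_toLp_sq,
    ENNReal.toReal_ofReal (by positivity)]

theorem toL2_wave (X : 𝔤) (c : ℂ) :
    toL2 b k 𝔪 (rightTranslate X fun g => c * wave ζ β r e n g)
      = (((hT.isSmoothFamily_wave hβ hr (ζ := ζ)).const_mul c).memLp X).toLp :=
  dif_pos (((hT.isSmoothFamily_wave hβ hr (ζ := ζ)).const_mul c).memLp X)

/-- The normalized coherent state is an approximate eigenvector. -/
theorem isCoherentOrbit {K : ℝ} (hK0 : 0 ≤ K) (hK : ∀ X Y : 𝔤, ‖⁅X, Y⁆‖ ≤ K * ‖X‖ * ‖Y‖)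
    (hr1 : r ≤ 1) {Λ : ℝ} (hrΛ : 1 / r ≤ Λ) (hζΛ : ‖ζ‖ * r ≤ Λ)
    (hζ : ∀ X ∈ 𝔪, ∀ Y ∈ 𝔪, ζ ⁅X, Y⁆ = 0) {c : ℝ}
    (hc : c = ‖toL2 b k 𝔪 (wave ζ β r e n)‖⁻¹) :
    IsCoherentOrbit ζ (waveConst L K n * Λ * D ^ n)
      (fun X => toL2 b k 𝔪 (rightTranslate X fun g => c * wave ζ β r e n g)) := by
  set M := towerMass e a (fun _ τ => ENNReal.ofReal (β (τ / r) ^ 2)) n with hM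
  have hM0 : 0 < M.toReal := ENNReal.toReal_pos (hT.towerMass_wave_ne_zero hβ hr)
    (towerMass_wave_ne_top hβ hr)
  have hL0 : 0 ≤ L := (abs_nonneg _).trans (hβ.abs_deriv_le 0)
  have hD0 : 0 ≤ D := zero_le_one.trans hβ.one_le
  have hW0 := waveConst_nonneg hL0 hK0 n
  have hΛ0 : 0 ≤ Λ := (by positivity : 0 ≤ 1 / r).trans hrΛ
  have hH := hT.isSmoothFamily_wave hβ hr (ζ := ζ)
  have hc0 : 0 ≤ c := by rw [hc]; positivity
  have hcM : c ^ 2 * M.toReal = 1 := by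
    have h1 := hT.toL2_wave hβ hr (ζ := ζ) 0 1
    have h0 : rightTranslate 0 (wave ζ β r e n) = wave ζ β r e n :=
      funext fun W => by rw [rightTranslate, bch_zero]
    simp only [one_mul] at h1
    rw [show (fun g => wave ζ β r e n g) = wave ζ β r e n from rfl, h0] at h1
    have h2 : ‖toL2 b k 𝔪 (wave ζ β r e n)‖ ^ 2 = M.toReal := by
      rw [h1]
      exact hT.norm_toLp_wave_sq hβ hr (ζ := ζ) 0
    rw [hc, inv_pow, h2, inv_mul_cancel₀ hM0.ne']
  have hHc := hH.const_mul (c : ℂ)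
  have heq : (fun X => toL2 b k 𝔪 (rightTranslate X fun g => (c : ℂ) * wave ζ β r e n g))
      = fun X => (hHc.memLp X).toLp := funext fun X => hT.toL2_wave hβ hr X c
  rw [heq]
  refine ⟨by positivity, hHc.contDiff_toLp, fun X => ?_, fun g Y => ?_⟩
  · have h1 : ‖(hHc.memLp (μ := volume) X).toLp‖ ^ 2 = 1 := by
      rw [← hcM, ← hT.norm_toLp_wave_sq hβ hr (ζ := ζ) X, ← mul_pow]
      congr 1
      have : (hHc.memLp (μ := volume) X).toLp = (c : ℂ) • (hH.memLp X).toLp := rfl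
      rw [this, norm_smul, Complex.norm_real, Real.norm_of_nonneg hc0]
    exact (pow_eq_one_iff_of_nonneg (norm_nonneg _) two_ne_zero).1 h1
  · have hHg := hHc.comp (c := fun Z => bch g Z) (contDiff_const.bch contDiff_id)
    have e1 : fderiv ℝ (fun Z => (hHc.memLp (μ := volume) (bch g Z)).toLp) 0 Y
        = ((hHg.fderiv_apply Y).memLp 0).toLp := hHg.fderiv_toLp_apply 0 Y
    set z : ℂ := 2 * Real.pi * Complex.I * ζ Y with hz
    have e2 : fderiv ℝ (fun Z => (hHc.memLp (μ := volume) (bch g Z)).toLp) 0 Y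
        - z • (hHc.memLp (μ := volume) g).toLp
        = (((hHg.fderiv_apply Y).memLp 0).sub ((hHc.memLp g).const_smul z)).toLp := by
      rw [e1, MemLp.toLp_sub ((hHg.fderiv_apply Y).memLp 0) ((hHc.memLp g).const_smul z)]
      rfl
    rw [e2]
    set κ : ℝ := c * (waveConst L K n * Λ * ‖Y‖) with hκ
    have hκ0 : 0 ≤ κ := by positivity
    -- The eigenvector estimate for the tower at the group element `bch (cosetSection b 𝔪 t) g`;
    -- associativity moves the derivative to the right end.
    have hpt : ∀ t : Fin k → ℝ, ‖fderiv ℝ (fun Z => (c : ℂ) * wave ζ β r e n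
        (bch (cosetSection b 𝔪 t) (bch g Z))) 0 Y - z • ((c : ℂ) * wave ζ β r e n
        (bch (cosetSection b 𝔪 t) g))‖
        ≤ κ * towerBox r e n (bch (cosetSection b 𝔪 t) g) := fun t => by
      have h1 := hT.norm_fderiv_wave_sub_le hK0 hK hβ.contDiff hβ.abs_le_one hβ.eq_zero
        hβ.abs_deriv_le hβ.deriv_eq_zero hr hr1 hrΛ hζΛ (by rwa [hT.zero_eq]) n
        (hT.mem_top (bch (cosetSection b 𝔪 t) g)) (hT.mem_top Y)
      have h2 : fderiv ℝ (fun Z => (c : ℂ) * wave ζ β r e n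
          (bch (cosetSection b 𝔪 t) (bch g Z))) 0 Y = c * fderiv ℝ (fun Z => wave ζ β r e n
          (bch (bch (cosetSection b 𝔪 t) g) Z)) 0 Y := by
        simp only [← bch_assoc]
        rw [fderiv_const_mul]
        · simp
        · exact (((contDiff_wave hβ.contDiff n).comp
            (contDiff_const.bch contDiff_id)).differentiable (by simp)).differentiableAt
      rw [h2, smul_eq_mul, mul_left_comm z, ← mul_sub, norm_mul,
        Complex.norm_real, Real.norm_of_nonneg hc0, hκ, mul_assoc c]
      exact mul_le_mul_of_nonneg_left h1 hc0
    have hint := (((hHg.fderiv_apply Y).memLp 0).sub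
      ((hHc.memLp (μ := volume) g).const_smul z)).ofReal_norm_toLp_sq
    refine le_of_sq_le_sq ?_ (by positivity)
    rw [← ENNReal.ofReal_le_ofReal_iff (by positivity), hint]
    -- The box has at most D^(2n) times the mass M of the state, and M cancels against the
    -- normalization c²M = 1. So no constant depends on the position of 𝔪 relative to the basis,
    -- which enters through M only.
    calc _ ≤ ∫⁻ t : Fin k → ℝ, ENNReal.ofReal (κ ^ 2) *
            ENNReal.ofReal (towerBox r e n (bch (cosetSection b 𝔪 t) g)) ^ 2 := by
          refine lintegral_mono fun t => ?_
          rw [ENNReal.ofReal_pow hκ0, ← mul_pow, ← ENNReal.ofReal_mul hκ0]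
          refine pow_le_pow_left₀ zero_le ?_ 2
          rw [← ofReal_norm]
          exact ENNReal.ofReal_le_ofReal (hpt t)
      _ ≤ ENNReal.ofReal (κ ^ 2) * (ENNReal.ofReal (D ^ 2) ^ n * M) := by
          rw [lintegral_const_mul' _ _ ENNReal.ofReal_ne_top]
          gcongr
          exact hT.lintegral_towerBox_le hβ hr g
      _ = ENNReal.ofReal ((waveConst L K n * Λ * D ^ n * ‖Y‖) ^ 2) := by
          rw [← ENNReal.ofReal_toReal (show M ≠ ⊤ from towerMass_wave_ne_top hβ hr),
            ← ENNReal.ofReal_pow (by positivity), ← ENNReal.ofReal_mul (by positivity),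
            ← ENNReal.ofReal_mul (by positivity)]
          congr 1
          calc _ = (c ^ 2 * M.toReal) * (waveConst L K n * Λ * D ^ n * ‖Y‖) ^ 2 := by
                rw [hκ]; ring
            _ = _ := by rw [hcM, one_mul]

end IsAdaptedTower

end MetricLieAlgebra

/-! ### Orthonormalization -/

section UnitPart

variable {E : Type*} [NormedAddCommGroup E] [InnerProductSpace ℝ E] [FiniteDimensional ℝ E]
  (W : Submodule ℝ E) (v : E)

/-- The normalized component of `v` orthogonal to `W`, or zero if `v` lies in `W`. -/
def unitPart : E := ‖v - W.starProjection v‖⁻¹ • (v - W.starProjection v)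

variable {W v}

theorem inner_unitPart_of_mem {X : E} (hX : X ∈ W) : (inner ℝ (unitPart W v) X : ℝ) = 0 := by
  rw [unitPart, real_inner_smul_left, real_inner_comm,
    (Submodule.mem_orthogonal W _).1 (Submodule.sub_starProjection_mem_orthogonal v) X hX, mul_zero]

theorem norm_unitPart_le : ‖unitPart W v‖ ≤ 1 := by
  rw [unitPart, norm_smul, norm_inv, norm_norm]
  exact inv_mul_le_one

theorem unitPart_eq_zero_iff : unitPart W v = 0 ↔ v ∈ W := by
  rw [unitPart, smul_eq_zero, inv_eq_zero, norm_eq_zero, or_self, sub_eq_zero, eq_comm,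
    Submodule.starProjection_eq_self_iff]

theorem inner_unitPart_self : (inner ℝ (unitPart W v) v : ℝ) = ‖v - W.starProjection v‖ := by
  have h : (inner ℝ (unitPart W v) (v - W.starProjection v) : ℝ) = ‖v - W.starProjection v‖ := by
    rw [unitPart, real_inner_smul_left, real_inner_self_eq_norm_sq, sq, ← mul_assoc,
      inv_mul_mul_self]
  rwa [inner_sub_right, inner_unitPart_of_mem (W.starProjection_apply_mem v), sub_zero] at h

theorem inner_unitPart_self_ne_zero (h : unitPart W v ≠ 0) :
    (inner ℝ (unitPart W v) v : ℝ) ≠ 0 := by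
  rw [inner_unitPart_self, norm_ne_zero_iff]
  exact right_ne_zero_of_smul h

theorem norm_smul_unitPart : ‖v - W.starProjection v‖ • unitPart W v = v - W.starProjection v := by
  rw [unitPart, smul_smul]
  rcases eq_or_ne (v - W.starProjection v) 0 with h | h
  · simp [h]
  · rw [mul_inv_cancel₀ (norm_ne_zero_iff.2 h), one_smul]

theorem unitPart_mem : unitPart W v ∈ W ⊔ Submodule.span ℝ {v} :=
  Submodule.smul_mem _ _ (Submodule.sub_mem _
    (Submodule.mem_sup_right (Submodule.mem_span_singleton_self v))
    (Submodule.mem_sup_left (W.starProjection_apply_mem v)))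

theorem sub_inner_unitPart_mem {X : E} (hX : X ∈ W ⊔ Submodule.span ℝ {v}) :
    X - (inner ℝ (unitPart W v) X : ℝ) • unitPart W v ∈ W := by
  obtain ⟨w, hw, y, hy, rfl⟩ := Submodule.mem_sup.1 hX
  obtain ⟨s, rfl⟩ := Submodule.mem_span_singleton.1 hy
  have h : w + s • v - (inner ℝ (unitPart W v) (w + s • v) : ℝ) • unitPart W v
      = w + s • W.starProjection v := by
    rw [inner_add_right, inner_smul_right, inner_unitPart_of_mem hw, inner_unitPart_self, zero_add,
      mul_smul, norm_smul_unitPart]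
    module
  rw [h]
  exact W.add_mem hw (W.smul_mem s (W.starProjection_apply_mem v))

/-- One more vector adds an explicit rank-one term to the projection. Measurable dependence of
subspaces is built from this formula. -/
theorem starProjection_sup_span_singleton (X : E) :
    (W ⊔ Submodule.span ℝ {v}).starProjection X
      = W.starProjection X + (inner ℝ (unitPart W v) X : ℝ) • unitPart W v := by
  refine Submodule.eq_starProjection_of_mem_of_inner_eq_zero (Submodule.add_mem _
    (Submodule.mem_sup_left (W.starProjection_apply_mem X))
    (Submodule.smul_mem _ _ unitPart_mem)) fun w hw => ?_
  have h1 := sub_inner_unitPart_mem hw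
  set e := unitPart W v with he
  have h2 : ∀ x ∈ W, (inner ℝ (X - W.starProjection X) x : ℝ) = 0 := fun x hx => by
    rw [real_inner_comm]
    exact (Submodule.mem_orthogonal W _).1 (Submodule.sub_starProjection_mem_orthogonal X) x hx
  have h3 : (inner ℝ e (W.starProjection X) : ℝ) = 0 :=
    inner_unitPart_of_mem (W.starProjection_apply_mem X)
  have h4 := h2 _ h1
  rw [inner_sub_right, inner_smul_right, inner_sub_left, inner_sub_left] at h4
  rw [← sub_sub, inner_sub_left, inner_sub_left, real_inner_smul_left]
  have h3' : (inner ℝ (W.starProjection X) e : ℝ) = 0 := by rw [real_inner_comm]; exact h3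
  have h6 : (inner ℝ X e : ℝ) = inner ℝ e X := real_inner_comm _ _
  linear_combination h4 + inner ℝ e w * h6 - inner ℝ e w * h3'

open Classical in
theorem finrank_sup_span_singleton :
    Module.finrank ℝ ↥(W ⊔ Submodule.span ℝ {v})
      = Module.finrank ℝ W + if unitPart W v = 0 then 0 else 1 := by
  split_ifs with h
  · rw [unitPart_eq_zero_iff] at h
    rw [sup_of_le_left ((Submodule.span_singleton_le_iff_mem _ _).2 h), add_zero]
  · rw [unitPart_eq_zero_iff] at h
    have h1 := Submodule.finrank_sup_add_finrank_inf_eq W (Submodule.span ℝ {v})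
    have hv : v ≠ 0 := fun h0 => h (h0 ▸ W.zero_mem)
    have h2 : W ⊓ Submodule.span ℝ {v} = ⊥ :=
      (Submodule.disjoint_span_singleton' hv).2 h |>.eq_bot
    rw [h2, finrank_bot, add_zero, finrank_span_singleton hv] at h1
    exact h1

end UnitPart

namespace MetricLieAlgebra

variable {𝔤 : MetricLieAlgebra.{u}} {n : ℕ} (b : Module.Basis (Fin n) ℝ 𝔤)

/-! ### The tower of a polarization and a strong Malcev basis -/

/-- The sequence of basis vectors, extended by zero. -/
def basisSeq (j : ℕ) : 𝔤 := if h : j < n then b ⟨j, h⟩ else 0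

theorem flag_succ (j : ℕ) : flag b (j + 1) = flag b j ⊔ Submodule.span ℝ {basisSeq b j} := by
  rw [flag, flag, basisSeq]
  split_ifs with h
  · rw [← Submodule.span_union, ← Set.image_singleton, ← Set.image_union]
    congr 2
    ext i
    simp [Fin.ext_iff]
    omega
  · rw [Submodule.span_singleton_eq_bot.2 rfl, sup_bot_eq]
    congr 2
    ext i
    have := i.2
    simp
    omega

theorem flag_zero : flag b 0 = ⊥ := by simp [flag]

theorem flag_eq_top : flag b n = ⊤ := by
  rw [flag, show {i : Fin n | (i : ℕ) < n} = Set.univ from Set.eq_univ_of_forall fun i => i.2,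
    Set.image_univ, b.span_eq]

theorem flag_mono {i j : ℕ} (h : i ≤ j) : flag b i ≤ flag b j :=
  Submodule.span_mono (Set.image_mono fun _ hx => lt_of_lt_of_le hx h)

variable {b}

/-- ad X acts on the line 𝔤_(j+1)/𝔤_j by a scalar c, and nilpotency of ad X forces c = 0. -/
theorem IsStrongMalcev.lie_mem [LieRing.IsNilpotent 𝔤] (hb : IsStrongMalcev b) {j : ℕ} (X : 𝔤)
    {Y : 𝔤} (hY : Y ∈ flag b (j + 1)) : ⁅X, Y⁆ ∈ flag b j := by
  rw [flag_succ] at hY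
  obtain ⟨f, hf, y, hy, rfl⟩ := Submodule.mem_sup.1 hY
  obtain ⟨s, rfl⟩ := Submodule.mem_span_singleton.1 hy
  rw [lie_add, lie_smul]
  refine (flag b j).add_mem (hb j X f hf) ((flag b j).smul_mem s ?_)
  rw [basisSeq]
  split_ifs with h
  swap
  · rw [lie_zero]; exact Submodule.zero_mem _
  set y := b ⟨j, h⟩ with hy
  have hyseq : basisSeq b j = y := dif_pos h
  have h1 : ⁅X, y⁆ ∈ flag b j ⊔ Submodule.span ℝ {y} := by
    have := hb (j + 1) X y (Submodule.subset_span ⟨⟨j, h⟩, Nat.lt_succ_self j, rfl⟩)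
    rwa [flag_succ, hyseq] at this
  obtain ⟨g, hg, z, hz, hgz⟩ := Submodule.mem_sup.1 h1
  obtain ⟨c, rfl⟩ := Submodule.mem_span_singleton.1 hz
  have h2 : ∀ m : ℕ, (adL X ^ m) y - c ^ m • y ∈ flag b j := fun m => by
    induction m with
    | zero => simp
    | succ m ih =>
      have h3 : (adL X ^ (m + 1)) y - c ^ (m + 1) • y
          = ⁅X, (adL X ^ m) y - c ^ m • y⁆ + c ^ m • g := by
        rw [pow_succ', mul_apply_eq_comp, adL_apply, lie_sub, lie_smul, ← hgz, pow_succ]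
        module
      rw [h3]
      exact (flag b j).add_mem (hb j X _ ih) ((flag b j).smul_mem _ hg)
  have h4 := h2 (Module.finrank ℝ 𝔤)
  rw [adL_pow_eq_zero, zero_apply, zero_sub, neg_mem_iff] at h4
  have hy0 : y ∉ flag b j := fun hmem => by
    have := (b.mem_span_image).1 hmem
    rw [hy, b.repr_self] at this
    have := this (by simp : (⟨j, h⟩ : Fin n) ∈ _)
    simp at this
  have hc : c = 0 := by
    by_contra hc
    exact hy0 (((flag b j).smul_mem_iff (pow_ne_zero _ hc)).1 h4)
  rw [← hgz, hc, zero_smul, add_zero]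
  exact hg

variable (b) (𝔪 : LieSubalgebra ℝ 𝔤)

/-- The subalgebras `𝔪 + 𝔤_j`. -/
def polTower (j : ℕ) : Submodule ℝ 𝔤 := 𝔪.toSubmodule ⊔ flag b j

/-- The unit vectors of `𝔪 + 𝔤_{j+1}` orthogonal to `𝔪 + 𝔤_j`. -/
def polUnit (j : ℕ) : 𝔤 := unitPart (polTower b 𝔪 j) (basisSeq b j)

theorem polTower_succ (j : ℕ) :
    polTower b 𝔪 (j + 1) = polTower b 𝔪 j ⊔ Submodule.span ℝ {basisSeq b j} := by
  rw [polTower, polTower, flag_succ, sup_assoc]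

theorem polUnit_eq_zero_iff (j : ℕ) : polUnit b 𝔪 j = 0 ↔ basisSeq b j ∈ polTower b 𝔪 j :=
  unitPart_eq_zero_iff

/-- Commutators drop by one step because those within 𝔪 stay in 𝔪, and those with an element of
𝔤_(j+1) fall into 𝔤_j. -/
theorem isTower_polTower [LieRing.IsNilpotent 𝔤] (hb : IsStrongMalcev b) :
    IsTower (polTower b 𝔪) (polUnit b 𝔪) where
  lie_mem_zero X hX Y hY := by
    rw [polTower, flag_zero, sup_bot_eq] at *
    exact 𝔪.lie_mem hX hY
  le_succ j := by rw [polTower_succ]; exact le_sup_left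
  mem j := by rw [polTower_succ]; exact unitPart_mem
  sub_mem j X hX := by rw [polTower_succ] at hX; exact sub_inner_unitPart_mem hX
  inner_eq_zero j X hX := inner_unitPart_of_mem hX
  norm_le j := norm_unitPart_le
  lie_mem j X hX Y hY := by
    obtain ⟨m, hm, f, hf, rfl⟩ := Submodule.mem_sup.1 hX
    obtain ⟨m', hm', f', hf', rfl⟩ := Submodule.mem_sup.1 hY
    rw [add_lie, lie_add, ← lie_skew f]
    refine Submodule.add_mem _ (Submodule.add_mem _ ?_ ?_) (Submodule.neg_mem _ ?_)
    · exact Submodule.mem_sup_left (𝔪.lie_mem hm hm')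
    · exact Submodule.mem_sup_right (hb.lie_mem m hf')
    · exact Submodule.mem_sup_right (hb.lie_mem _ hf)

open Classical in
/-- The indices `i < j` with `X_i ∉ 𝔪 + 𝔤_i`, as an increasing list. -/
def cosetList : ℕ → List (Fin n)
  | 0 => []
  | j + 1 => if h : j < n ∧ polUnit b 𝔪 j ≠ 0 then cosetList j ++ [⟨j, h.1⟩] else cosetList j

theorem basisSeq_coe (i : Fin n) : basisSeq b i = b i := dif_pos i.2

theorem polUnit_eq_zero_of_le {j : ℕ} (hj : n ≤ j) : polUnit b 𝔪 j = 0 := by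
  rw [polUnit_eq_zero_iff, basisSeq, dif_neg (not_lt.2 hj)]
  exact Submodule.zero_mem _

theorem towerList_eq_map (j : ℕ) :
    towerList (polUnit b 𝔪) (basisSeq b) j = (cosetList b 𝔪 j).map b := by
  induction j with
  | zero => rfl
  | succ j ih =>
    rw [towerList, cosetList]
    by_cases h : polUnit b 𝔪 j = 0
    · rw [if_pos h, dif_neg (by simp [h]), ih]
    · have hj : j < n := by
        by_contra hj
        exact h (polUnit_eq_zero_of_le b 𝔪 (not_lt.1 hj))
      rw [if_neg h, dif_pos ⟨hj, h⟩, ih, List.map_append, List.map_singleton, basisSeq, dif_pos hj]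

theorem mem_cosetList (j : ℕ) (i : Fin n) :
    i ∈ cosetList b 𝔪 j ↔ (i : ℕ) < j ∧ polUnit b 𝔪 i ≠ 0 := by
  induction j with
  | zero => simp [cosetList]
  | succ j ih =>
    rw [cosetList]
    split_ifs with h
    · rw [List.mem_append, ih, List.mem_singleton, Fin.ext_iff]
      constructor
      · rintro (h1 | h1)
        · exact ⟨by omega, h1.2⟩
        · exact ⟨by simp at h1; omega, by rw [h1]; exact h.2⟩
      · rintro ⟨h1, h2⟩
        by_cases h3 : (i : ℕ) < j
        · exact Or.inl ⟨h3, h2⟩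
        · exact Or.inr (by simp; omega)
    · rw [ih]
      constructor
      · exact fun h1 => ⟨by omega, h1.2⟩
      · rintro ⟨h1, h2⟩
        refine ⟨lt_of_le_of_ne (by omega) fun h3 => h ⟨h3 ▸ i.2, h3 ▸ h2⟩, h2⟩

theorem pairwise_cosetList (j : ℕ) : (cosetList b 𝔪 j).Pairwise (· < ·) := by
  induction j with
  | zero => exact List.Pairwise.nil
  | succ j ih =>
    rw [cosetList]
    split_ifs with h
    · rw [List.pairwise_append]
      refine ⟨ih, List.pairwise_singleton _ _, fun i hi i' hi' => ?_⟩
      rw [List.mem_singleton] at hi'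
      rw [hi', Fin.lt_def]
      exact ((mem_cosetList b 𝔪 j i).1 hi).1
    · exact ih

theorem sort_cosetIndices : (cosetIndices b 𝔪).sort (· ≤ ·) = cosetList b 𝔪 n := by
  classical
  have h1 : cosetIndices b 𝔪 = (cosetList b 𝔪 n).toFinset := by
    ext i
    rw [List.mem_toFinset, mem_cosetList, cosetIndices, Finset.mem_filter, Ne, polUnit_eq_zero_iff,
      basisSeq_coe, polTower]
    simp
  rw [h1]
  exact (List.toFinset_sort (· ≤ ·) ((pairwise_cosetList b 𝔪 n).imp fun h => h.ne)).2
    ((pairwise_cosetList b 𝔪 n).imp fun h => h.le)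

theorem cosetSection_eq {k : ℕ} (t : Fin k → ℝ) :
    cosetSection b 𝔪 t = listSection (towerList (polUnit b 𝔪) (basisSeq b) n) t := by
  rw [cosetSection, listSection, towerList_eq_map, sort_cosetIndices, List.zipWith_map_left]

/-- Each nonzero unit vector adds one dimension, so the full list has as many entries as the
codimension of 𝔪. -/
theorem finrank_polTower (j : ℕ) : Module.finrank ℝ (polTower b 𝔪 j)
    = Module.finrank ℝ 𝔪.toSubmodule + (towerList (polUnit b 𝔪) (basisSeq b) j).length := by
  induction j with
  | zero => rw [polTower, flag_zero, sup_bot_eq]; rfl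
  | succ j ih =>
    rw [polTower_succ, finrank_sup_span_singleton, ih, towerList, add_assoc]
    congr 1
    rw [show unitPart (polTower b 𝔪 j) (basisSeq b j) = polUnit b 𝔪 j from rfl]
    split_ifs <;> simp

variable {b 𝔪}

/-- A polarizing subalgebra is its own annihilator. -/
theorem IsPolarizing.orthogonal_eq {ζ : StrongDual ℝ 𝔤} (h : IsPolarizing ζ 𝔪) :
    LinearMap.BilinForm.orthogonal (kirillovForm ζ) 𝔪.toSubmodule = 𝔪.toSubmodule := by
  refine le_antisymm (fun X hX => ?_) fun X hX => ?_
  · rw [LinearMap.BilinForm.mem_orthogonal_iff] at hX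
    have hX' : ∀ Y ∈ 𝔪.toSubmodule, ζ ⁅Y, X⁆ = 0 := hX
    rw [← h.2 (𝔪.toSubmodule ⊔ Submodule.span ℝ {X}) le_sup_left]
    · exact Submodule.mem_sup_right (Submodule.mem_span_singleton_self X)
    · intro Y hY Z hZ
      obtain ⟨m, hm, x, hx, rfl⟩ := Submodule.mem_sup.1 hY
      obtain ⟨s, rfl⟩ := Submodule.mem_span_singleton.1 hx
      obtain ⟨m', hm', x', hx', rfl⟩ := Submodule.mem_sup.1 hZ
      obtain ⟨s', rfl⟩ := Submodule.mem_span_singleton.1 hx'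
      have h1 : ζ ⁅X, m'⁆ = 0 := by rw [← lie_skew, map_neg, hX' m' hm', neg_zero]
      simp only [add_lie, lie_add, smul_lie, lie_smul, map_add, map_smul, lie_self, h1,
        hX' m hm, h.1 m hm m' hm', smul_zero, add_zero]
  · rw [LinearMap.BilinForm.mem_orthogonal_iff]
    exact fun Y hY => h.1 Y hY X hX

/-- Since 𝔪 equals its own annihilator and contains the radical, its codimension is half the rank of
the form. This identifies the number of section parameters with d_n/2. -/
theorem finrank_range_kirillovForm (ζ : StrongDual ℝ 𝔤) (h : IsPolarizing ζ 𝔪) :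
    Module.finrank ℝ (LinearMap.range (kirillovForm ζ)) + 2 * Module.finrank ℝ 𝔪.toSubmodule
      = 2 * Module.finrank ℝ 𝔤 := by
  have hrefl : LinearMap.BilinForm.IsRefl (kirillovForm ζ) := fun X Y hXY => by
    change ζ ⁅Y, X⁆ = 0
    rw [← lie_skew, map_neg, neg_eq_zero]
    exact hXY
  have h1 := LinearMap.BilinForm.finrank_add_finrank_orthogonal hrefl 𝔪.toSubmodule
  have h2 : LinearMap.BilinForm.orthogonal (kirillovForm ζ) ⊤ = LinearMap.ker (kirillovForm ζ) := by
    ext X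
    rw [LinearMap.BilinForm.mem_orthogonal_iff, LinearMap.mem_ker, LinearMap.ext_iff]
    exact ⟨fun hX Y => hrefl _ _ (hX Y trivial), fun hX Y _ => hrefl _ _ (hX Y)⟩
  have h3 : 𝔪.toSubmodule ⊓ LinearMap.BilinForm.orthogonal (kirillovForm ζ) ⊤
      = LinearMap.ker (kirillovForm ζ) := by
    rw [h2, inf_eq_right]
    intro X hX
    rw [← h2] at hX
    rw [← h.orthogonal_eq]
    exact LinearMap.BilinForm.orthogonal_le le_top hX
  rw [h3, h.orthogonal_eq] at h1
  have h4 := LinearMap.finrank_range_add_finrank_ker (kirillovForm ζ)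
  omega

theorem orbitType_last (ζ : StrongDual ℝ 𝔤) : orbitType b ζ (Fin.last n)
    = Module.finrank ℝ (LinearMap.range (kirillovForm ζ)) := by
  have h1 := LinearMap.finrank_range_add_finrank_ker ((kirillovForm ζ).domRestrict₂ (flag b n))
  have h2 := LinearMap.finrank_range_add_finrank_ker (kirillovForm ζ)
  have h3 : LinearMap.ker ((kirillovForm ζ).domRestrict₂ (flag b n))
      = LinearMap.ker (kirillovForm ζ) := by
    ext X
    rw [LinearMap.mem_ker, LinearMap.mem_ker, LinearMap.ext_iff, LinearMap.ext_iff]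
    refine ⟨fun hX Y => hX ⟨Y, ?_⟩, fun hX Y => hX Y⟩
    rw [flag_eq_top]
    trivial
  rw [h3] at h1
  rw [orbitType, Fin.val_last]
  omega

theorem IsPolarizing.isAdaptedTower [LieRing.IsNilpotent 𝔤] {ζ : StrongDual ℝ 𝔤}
    (h : IsPolarizing ζ 𝔪) (hb : IsStrongMalcev b) {k : ℕ}
    (hk : k = orbitType b ζ (Fin.last n) / 2) :
    IsAdaptedTower b k 𝔪 (polTower b 𝔪) (polUnit b 𝔪) (basisSeq b) where
  toIsTower := isTower_polTower b 𝔪 hb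
  zero_eq := by rw [polTower, flag_zero, sup_bot_eq]
  eq_top := by rw [polTower, flag_eq_top, sup_top_eq]
  mem_succ j := by
    rw [polTower_succ]
    exact Submodule.mem_sup_right (Submodule.mem_span_singleton_self _)
  inner_ne_zero j := inner_unitPart_self_ne_zero
  length_eq := by
    have h1 := finrank_polTower b 𝔪 n
    rw [polTower, flag_eq_top, sup_top_eq, finrank_top] at h1
    have h2 := finrank_range_kirillovForm ζ h
    rw [orbitType_last] at hk
    omega
  section_eq := cosetSection_eq b 𝔪

end MetricLieAlgebra

/-! ### Measurable families of subspaces -/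

section MeasurableProj

variable {Ω E : Type*} [MeasurableSpace Ω] [NormedAddCommGroup E] [InnerProductSpace ℝ E]
  [FiniteDimensional ℝ E] [MeasurableSpace E] [BorelSpace E]

/-- The orthogonal projections onto the members of a family of subspaces depend measurably on the
parameter. -/
def MeasurableProj (W : Ω → Submodule ℝ E) : Prop :=
  ∀ X : E, Measurable fun p => (W p).starProjection X

namespace MeasurableProj

variable {W W' : Ω → Submodule ℝ E} (hW : MeasurableProj W)

omit [BorelSpace E] in
theorem const (W : Submodule ℝ E) : MeasurableProj fun _ : Ω => W :=
  fun X => show Measurable fun _ : Ω => W.starProjection X from measurable_const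

include hW

theorem measurable_apply {X : Ω → E} (hX : Measurable X) :
    Measurable fun p => (W p).starProjection (X p) := by
  let u := stdOrthonormalBasis ℝ E
  have h : (fun p => (W p).starProjection (X p))
      = fun p => ∑ i, (inner ℝ (u i) (X p) : ℝ) • (W p).starProjection (u i) := by
    funext p
    conv_lhs => rw [← u.sum_repr' (X p)]
    simp
  rw [h]
  exact Finset.measurable_sum _ fun i _ => (measurable_const.inner hX).smul (hW _)

theorem unitPart {v : Ω → E} (hv : Measurable v) : Measurable fun p => unitPart (W p) (v p) := by
  have h := hv.sub (hW.measurable_apply hv)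
  exact h.norm.inv.smul h

theorem sup_span_singleton {v : Ω → E} (hv : Measurable v) :
    MeasurableProj fun p => W p ⊔ Submodule.span ℝ {v p} := fun X => by
  simp only [starProjection_sup_span_singleton]
  have h := hW.unitPart hv
  exact (hW X).add ((h.inner measurable_const).smul h)

/-- `W'` is spanned by the projections of a fixed orthonormal basis, which depend measurably on the
parameter; they are adjoined one at a time. -/
theorem sup (hW' : MeasurableProj W') : MeasurableProj fun p => W p ⊔ W' p := by
  let u := stdOrthonormalBasis ℝ E
  have h : ∀ s : Finset (Fin (Module.finrank ℝ E)), MeasurableProj fun p =>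
      W p ⊔ s.sup fun i => Submodule.span ℝ {(W' p).starProjection (u i)} := fun s => by
    induction s using Finset.induction_on with
    | empty => simpa using hW
    | insert i s _ ih =>
      simp only [Finset.sup_insert]
      simp only [sup_comm (Submodule.span ℝ _), ← sup_assoc]
      exact ih.sup_span_singleton (hW' (u i))
  have h2 : ∀ p, W' p = Finset.univ.sup fun i =>
      Submodule.span ℝ {(W' p).starProjection (u i)} := fun p => by
    refine le_antisymm (fun X hX => ?_) (Finset.sup_le fun i _ => ?_)
    · rw [← Submodule.starProjection_eq_self_iff.2 hX, ← u.sum_repr' X, map_sum]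
      refine Submodule.sum_mem _ fun i _ => ?_
      rw [map_smul]
      exact Submodule.smul_mem _ _ (Finset.le_sup (f := fun i =>
        Submodule.span ℝ {(W' p).starProjection (u i)}) (Finset.mem_univ i)
        (Submodule.mem_span_singleton_self _))
    · rw [Submodule.span_singleton_le_iff_mem]
      exact (W' p).starProjection_apply_mem _
  have h3 := h Finset.univ
  simp only [← h2] at h3
  exact h3

theorem orthogonal : MeasurableProj fun p => (W p)ᗮ := fun X => by
  simp only [Submodule.starProjection_orthogonal]
  exact measurable_const.sub (hW X)

theorem measurableSet_mem {v : Ω → E} (hv : Measurable v) : MeasurableSet {p | v p ∈ W p} := by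
  simp only [← Submodule.starProjection_eq_self_iff]
  exact measurableSet_eq_fun (hW.measurable_apply hv) hv

end MeasurableProj

end MeasurableProj

/-- A linear form that vanishes on the radical of an alternating form is represented by it. -/
theorem LinearMap.exists_eq_of_vanish_on_ker {V : Type*} [AddCommGroup V] [Module ℝ V]
    [FiniteDimensional ℝ V] (B : V →ₗ[ℝ] V →ₗ[ℝ] ℝ) (hB : ∀ x y, B x y = -B y x) (f : V →ₗ[ℝ] ℝ)
    (hf : ∀ x, B x = 0 → f x = 0) : ∃ y, B y = f := by
  have h1 : f ∈ (LinearMap.ker B).dualAnnihilator :=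
    (Submodule.mem_dualAnnihilator f).2 fun x hx => hf x hx
  rw [← LinearMap.range_dualMap_eq_dualAnnihilator_ker] at h1
  obtain ⟨φ, rfl⟩ := h1
  refine ⟨-(Module.evalEquiv ℝ V).symm φ, LinearMap.ext fun z => ?_⟩
  rw [map_neg, LinearMap.neg_apply, ← hB, LinearMap.dualMap_apply,
    Module.apply_evalEquiv_symm_apply]

namespace MetricLieAlgebra

variable {𝔤 : MetricLieAlgebra.{u}} {n : ℕ} (b : Module.Basis (Fin n) ℝ 𝔤)

/-! ### Vergne polarizations -/

theorem forall_mem_flag_iff (f : 𝔤 →ₗ[ℝ] ℝ) (j : ℕ) :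
    (∀ i < j, f (basisSeq b i) = 0) ↔ ∀ Y ∈ flag b j, f Y = 0 := by
  induction j with
  | zero => simp [flag_zero]
  | succ j ih =>
    rw [flag_succ]
    constructor
    · intro h Y hY
      obtain ⟨y, hy, z, hz, rfl⟩ := Submodule.mem_sup.1 hY
      obtain ⟨s, rfl⟩ := Submodule.mem_span_singleton.1 hz
      rw [map_add, map_smul, h j (Nat.lt_succ_self j),
        ih.1 (fun i hi => h i (hi.trans (Nat.lt_succ_self j))) y hy, smul_zero, add_zero]
    · intro h i hi
      rcases Nat.lt_succ_iff_lt_or_eq.1 hi with h1 | rfl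
      · exact ih.2 (fun Y hY => h Y (Submodule.mem_sup_left hY)) i h1
      · exact h _ (Submodule.mem_sup_right (Submodule.mem_span_singleton_self _))

/-- The gradient of the linear form `ζ([X, ·])`. -/
def adGradient (ζ : StrongDual ℝ 𝔤) (X : 𝔤) : 𝔤 :=
  (InnerProductSpace.toDual ℝ 𝔤).symm (ζ.comp (adL X))

theorem inner_adGradient (ζ : StrongDual ℝ 𝔤) (X Y : 𝔤) :
    (inner ℝ (adGradient ζ X) Y : ℝ) = ζ ⁅X, Y⁆ := by
  rw [adGradient, InnerProductSpace.toDual_symm_apply]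
  rfl

theorem measurable_adGradient (X : 𝔤) :
    Measurable fun ζ : StrongDual ℝ 𝔤 => adGradient ζ X := by
  refine Continuous.measurable ?_
  exact (InnerProductSpace.toDual ℝ 𝔤).symm.continuous.comp
    ((ContinuousLinearMap.compL ℝ 𝔤 𝔤 ℝ).flip (adL X)).continuous

/-- The span of `W` and the gradients of the first `j` linear forms `ζ([X_i, ·])`. -/
def gradientSpan (ζ : StrongDual ℝ 𝔤) (W : Submodule ℝ 𝔤) : ℕ → Submodule ℝ 𝔤
  | 0 => W
  | j + 1 => gradientSpan ζ W j ⊔ Submodule.span ℝ {adGradient ζ (basisSeq b j)}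

/-- The radical of the restriction of `B_ζ` to `𝔤_j`. -/
def flagRadical (ζ : StrongDual ℝ 𝔤) (j : ℕ) : Submodule ℝ 𝔤 :=
  (gradientSpan b ζ (flag b j)ᗮ j)ᗮ

theorem mem_gradientSpan_orthogonal (ζ : StrongDual ℝ 𝔤) (W : Submodule ℝ 𝔤) (j : ℕ) (X : 𝔤) :
    X ∈ (gradientSpan b ζ W j)ᗮ ↔ X ∈ Wᗮ ∧ ∀ i < j, ζ ⁅basisSeq b i, X⁆ = 0 := by
  induction j with
  | zero => simp [gradientSpan]
  | succ j ih =>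
    rw [gradientSpan, ← Submodule.inf_orthogonal, Submodule.mem_inf, ih,
      Submodule.mem_orthogonal_singleton_iff_inner_right, inner_adGradient, and_assoc]
    refine and_congr_right fun _ => ⟨fun h i hi => ?_, fun h => ⟨fun i hi => ?_, ?_⟩⟩
    · rcases Nat.lt_succ_iff_lt_or_eq.1 hi with h1 | rfl
      · exact h.1 i h1
      · exact h.2
    · exact h i (hi.trans (Nat.lt_succ_self j))
    · exact h j (Nat.lt_succ_self j)

theorem mem_flagRadical (ζ : StrongDual ℝ 𝔤) (j : ℕ) (X : 𝔤) :
    X ∈ flagRadical b ζ j ↔ X ∈ flag b j ∧ ∀ Y ∈ flag b j, ζ ⁅X, Y⁆ = 0 := by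
  rw [flagRadical, mem_gradientSpan_orthogonal, Submodule.orthogonal_orthogonal]
  refine and_congr_right fun _ => ?_
  refine Iff.trans ?_ (forall_mem_flag_iff b (kirillovForm ζ X) j)
  refine forall_congr' fun i => imp_congr_right fun _ => ?_
  change _ ↔ ζ ⁅X, basisSeq b i⁆ = 0
  rw [← lie_skew, map_neg, neg_eq_zero]

/-- The sum of the radicals of the restrictions of `B_ζ` to `𝔤_1, …, 𝔤_j`. -/
def vergneSum (ζ : StrongDual ℝ 𝔤) : ℕ → Submodule ℝ 𝔤
  | 0 => ⊥
  | j + 1 => vergneSum ζ j ⊔ flagRadical b ζ (j + 1)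

/-- Each radical is the orthogonal complement of a span of a fixed subspace and finitely many
gradients, and the gradients depend continuously on ζ. -/
theorem measurableProj_vergneSum (j : ℕ) : MeasurableProj fun ζ => vergneSum b ζ j := by
  induction j with
  | zero => exact MeasurableProj.const _
  | succ j ih =>
    refine ih.sup (MeasurableProj.orthogonal ?_)
    generalize (flag b (j + 1))ᗮ = W
    generalize j + 1 = i
    induction i with
    | zero => exact MeasurableProj.const _
    | succ i ih => exact ih.sup_span_singleton (measurable_adGradient _)

variable {b}

theorem lie_eq_zero_of_mem_flagRadical {ζ : StrongDual ℝ 𝔤} {i j : ℕ} {X Y : 𝔤}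
    (hX : X ∈ flagRadical b ζ i) (hY : Y ∈ flagRadical b ζ j) : ζ ⁅X, Y⁆ = 0 := by
  rw [mem_flagRadical] at hX hY
  rcases le_total i j with h | h
  · rw [← lie_skew, map_neg, neg_eq_zero]
    exact hY.2 X (flag_mono b h hX.1)
  · exact hX.2 Y (flag_mono b h hY.1)

theorem flagRadical_zero (ζ : StrongDual ℝ 𝔤) : flagRadical b ζ 0 = ⊥ :=
  (Submodule.eq_bot_iff _).2 fun X hX => by
    have := ((mem_flagRadical b ζ _ X).1 hX).1
    rwa [flag_zero, Submodule.mem_bot] at this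

theorem flagRadical_le_vergneSum (ζ : StrongDual ℝ 𝔤) {i j : ℕ} (h : i ≤ j) :
    flagRadical b ζ i ≤ vergneSum b ζ j := by
  induction j with
  | zero =>
    obtain rfl : i = 0 := by omega
    rw [flagRadical_zero]
    exact bot_le
  | succ j ih =>
    rcases Nat.le_succ_iff.1 h with h1 | rfl
    · exact (ih h1).trans le_sup_left
    · exact le_sup_right

/-- A bilinear relation holds on the sum of radicals if it holds on the radicals. -/
theorem vergneSum_induction {ζ : StrongDual ℝ 𝔤} {P : 𝔤 → Prop} (h0 : P 0)
    (hadd : ∀ X Y, P X → P Y → P (X + Y)) (hr : ∀ i, ∀ X ∈ flagRadical b ζ i, P X) (j : ℕ) {X : 𝔤}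
    (hX : X ∈ vergneSum b ζ j) : P X := by
  induction j generalizing X with
  | zero =>
    rw [vergneSum, Submodule.mem_bot] at hX
    exact hX ▸ h0
  | succ j ih =>
    obtain ⟨y, hy, z, hz, rfl⟩ := Submodule.mem_sup.1 hX
    exact hadd y z (ih hy) (hr _ z hz)

theorem isIsotropic_vergneSum (ζ : StrongDual ℝ 𝔤) (j : ℕ) : IsIsotropic ζ (vergneSum b ζ j) := by
  intro X hX Y hY
  refine vergneSum_induction (P := fun X => ζ ⁅X, Y⁆ = 0) (by simp)
    (fun X X' h h' => by rw [add_lie, map_add, h, h', add_zero]) (fun i X hX => ?_) j hX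
  refine vergneSum_induction (P := fun Y => ζ ⁅X, Y⁆ = 0) (by simp)
    (fun X X' h h' => by rw [lie_add, map_add, h, h', add_zero])
    (fun i' Y hY => lie_eq_zero_of_mem_flagRadical hX hY) j hY

/-- By the Jacobi identity and because the flag consists of ideals, the radical of a smaller step is
normalized by that of a larger one. Hence the sum of the radicals is a subalgebra. -/
theorem lie_mem_flagRadical (hb : IsStrongMalcev b) {ζ : StrongDual ℝ 𝔤} {i j : ℕ} (hij : i ≤ j)
    {X Y : 𝔤} (hX : X ∈ flagRadical b ζ i) (hY : Y ∈ flagRadical b ζ j) :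
    ⁅X, Y⁆ ∈ flagRadical b ζ i := by
  rw [mem_flagRadical] at hX hY ⊢
  refine ⟨?_, fun Z hZ => ?_⟩
  · rw [← lie_skew, neg_mem_iff]
    exact hb i Y X hX.1
  · have h1 : ⁅⁅X, Y⁆, Z⁆ = ⁅X, ⁅Y, Z⁆⁆ - ⁅Y, ⁅X, Z⁆⁆ := lie_lie X Y Z
    rw [h1, map_sub, hX.2 _ (hb i Y Z hZ), hY.2 _ (flag_mono b hij (hb i X Z hZ)), sub_zero]

theorem lie_mem_vergneSum (hb : IsStrongMalcev b) {ζ : StrongDual ℝ 𝔤} {X Y : 𝔤} {j : ℕ}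
    (hX : X ∈ vergneSum b ζ j) (hY : Y ∈ vergneSum b ζ j) : ⁅X, Y⁆ ∈ vergneSum b ζ j := by
  have key : ∀ i i' : ℕ, i ≤ j → i' ≤ j → ∀ X ∈ flagRadical b ζ i, ∀ Y ∈ flagRadical b ζ i',
      ⁅X, Y⁆ ∈ vergneSum b ζ j := fun i i' hi hi' X hX Y hY => by
    rcases le_total i i' with h | h
    · exact flagRadical_le_vergneSum ζ hi (lie_mem_flagRadical hb h hX hY)
    · rw [← lie_skew, neg_mem_iff]
      exact flagRadical_le_vergneSum ζ hi' (lie_mem_flagRadical hb h hY hX)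
  have key2 : ∀ m ≤ j, ∀ X ∈ vergneSum b ζ m, ∀ i ≤ j, ∀ Y ∈ flagRadical b ζ i,
      ⁅X, Y⁆ ∈ vergneSum b ζ j := fun m => by
    induction m with
    | zero =>
      intro _ X hX i _ Y _
      rw [vergneSum, Submodule.mem_bot] at hX
      rw [hX, zero_lie]
      exact Submodule.zero_mem _
    | succ m ih =>
      intro hm X hX i hi Y hY
      obtain ⟨y, hy, z, hz, rfl⟩ := Submodule.mem_sup.1 hX
      rw [add_lie]
      exact Submodule.add_mem _ (ih (by omega) y hy i hi Y hY) (key _ _ hm hi z hz Y hY)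
  have key3 : ∀ m ≤ j, ∀ Y ∈ vergneSum b ζ m, ⁅X, Y⁆ ∈ vergneSum b ζ j := fun m => by
    induction m with
    | zero =>
      intro _ Y hY
      rw [vergneSum, Submodule.mem_bot] at hY
      rw [hY, lie_zero]
      exact Submodule.zero_mem _
    | succ m ih =>
      intro hm Y hY
      obtain ⟨y, hy, z, hz, rfl⟩ := Submodule.mem_sup.1 hY
      rw [lie_add]
      exact Submodule.add_mem _ (ih (by omega) y hy) (key2 j le_rfl X hX _ hm z hz)
  exact key3 j le_rfl Y hY

/-- Maximality, by induction along the flag. If X is not in 𝔤_j, then ζ([X, ·]) vanishes on the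
radical of 𝔤_j, so on 𝔤_j it equals ζ([Y, ·]) for some Y in 𝔤_j. Then X - Y lies in the radical of
𝔤_(j+1), while Y still annihilates the earlier sum and belongs to it by induction. -/
theorem mem_vergneSum_of_forall {ζ : StrongDual ℝ 𝔤} {j : ℕ} {X : 𝔤} (hX : X ∈ flag b j)
    (h : ∀ Y ∈ vergneSum b ζ j, ζ ⁅X, Y⁆ = 0) : X ∈ vergneSum b ζ j := by
  induction j generalizing X with
  | zero => rwa [flag_zero] at hX
  | succ j ih =>
    by_cases hXj : X ∈ flag b j
    · exact Submodule.mem_sup_left (ih hXj fun Y hY => h Y (Submodule.mem_sup_left hY))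
    set V := flag b j with hV
    obtain ⟨Y, hY⟩ := LinearMap.exists_eq_of_vanish_on_ker
      ((kirillovForm ζ).domRestrict₁₂ V V)
      (fun x y => by
        change ζ ⁅(x : 𝔤), (y : 𝔤)⁆ = -ζ ⁅(y : 𝔤), (x : 𝔤)⁆
        rw [← lie_skew, map_neg])
      ((kirillovForm ζ X).domRestrict V) (fun x hx => by
        refine h x (Submodule.mem_sup_left (flagRadical_le_vergneSum ζ le_rfl ?_))
        rw [mem_flagRadical]
        exact ⟨x.2, fun Y hY => LinearMap.congr_fun hx ⟨Y, hY⟩⟩)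
    have hY' : ∀ Z ∈ V, ζ ⁅(Y : 𝔤), Z⁆ = ζ ⁅X, Z⁆ := fun Z hZ => LinearMap.congr_fun hY ⟨Z, hZ⟩
    have hYV : (Y : 𝔤) ∈ flag b (j + 1) := flag_mono b j.le_succ Y.2
    have h1 : ζ ⁅X, (Y : 𝔤)⁆ = 0 := by rw [← hY' Y Y.2, lie_self, map_zero]
    have hspan : ∀ Z ∈ flag b (j + 1), ∃ (v : V) (s : ℝ), Z = v + s • X := by
      rw [flag_succ] at hX ⊢
      obtain ⟨v, hv, z, hz, rfl⟩ := Submodule.mem_sup.1 hX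
      obtain ⟨s, rfl⟩ := Submodule.mem_span_singleton.1 hz
      have hs : s ≠ 0 := by
        rintro rfl
        exact hXj (by simpa using hv)
      intro Z hZ
      obtain ⟨v', hv', z', hz', rfl⟩ := Submodule.mem_sup.1 hZ
      obtain ⟨s', rfl⟩ := Submodule.mem_span_singleton.1 hz'
      refine ⟨⟨v' - (s' / s) • v, V.sub_mem hv' (V.smul_mem _ hv)⟩, s' / s, ?_⟩
      simp only [smul_add, smul_smul, div_mul_cancel₀ _ hs]
      abel
    have hrad : X - (Y : 𝔤) ∈ flagRadical b ζ (j + 1) := by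
      rw [mem_flagRadical]
      refine ⟨Submodule.sub_mem _ hX hYV, fun Z hZ => ?_⟩
      obtain ⟨v, s, rfl⟩ := hspan Z hZ
      have h2 : ζ ⁅(Y : 𝔤), X⁆ = 0 := by rw [← lie_skew, map_neg, h1, neg_zero]
      rw [sub_lie, lie_add, lie_add, lie_smul, lie_smul, lie_self, map_sub, map_add, map_add,
        hY' v v.2, map_smul, map_smul, h2, map_zero, sub_self]
    have hradm := flagRadical_le_vergneSum ζ le_rfl hrad
    have hYm : (Y : 𝔤) ∈ vergneSum b ζ j := by
      refine ih Y.2 fun Z hZ => ?_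
      have hZ' : Z ∈ vergneSum b ζ (j + 1) := Submodule.mem_sup_left hZ
      have h3 := isIsotropic_vergneSum ζ (j + 1) _ hradm Z hZ'
      rw [sub_lie, map_sub, h Z hZ', zero_sub, neg_eq_zero] at h3
      exact h3
    rw [← sub_add_cancel X (Y : 𝔤)]
    exact Submodule.add_mem _ hradm (Submodule.mem_sup_left hYm)

/-- The Vergne polarization of a strong Malcev basis. -/
def vergne (hb : IsStrongMalcev b) (ζ : StrongDual ℝ 𝔤) : LieSubalgebra ℝ 𝔤 :=
  { vergneSum b ζ n with lie_mem' := fun hX hY => lie_mem_vergneSum hb hX hY }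

theorem isPolarizing_vergne (hb : IsStrongMalcev b) (ζ : StrongDual ℝ 𝔤) :
    IsPolarizing ζ (vergne hb ζ) := by
  refine ⟨isIsotropic_vergneSum ζ n, fun W hW hiso => le_antisymm (fun X hX => ?_) hW⟩
  refine mem_vergneSum_of_forall (j := n) ?_ fun Y hY => hiso X hX Y (hW hY)
  rw [flag_eq_top]
  trivial

theorem measurableFamily_vergne (hb : IsStrongMalcev b) (U : Set (StrongDual ℝ 𝔤)) :
    MeasurableFamily U (vergne hb) := fun X =>
  (measurableProj_vergneSum b n X).comp measurable_subtype_coe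

end MetricLieAlgebra

/-- A measurable map into `L²`, given by a jointly measurable family of functions. -/
theorem stronglyMeasurable_toLp {Ω T : Type*} [MeasurableSpace Ω] [MeasurableSpace T]
    {μ : Measure T} [SFinite μ] [IsSeparable μ] {F : Ω → T → ℂ}
    (hF : Measurable (Function.uncurry F)) (hm : ∀ p, MemLp (F p) 2 μ) :
    StronglyMeasurable fun p => (hm p).toLp := by
  have : Fact ((2 : ℝ≥0∞) ≠ ⊤) := ⟨by norm_num⟩
  have : SecondCountableTopology (Lp ℂ 2 μ) := inferInstance
  borelize ↥(Lp ℂ 2 μ)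
  -- The distance to a fixed vector is an integral with a parameter, so preimages of balls are
  -- measurable by Tonelli; in a separable space they suffice for all open sets.
  have hball : ∀ (h : Lp ℂ 2 μ) (r : ℝ),
      MeasurableSet ((fun p => (hm p).toLp) ⁻¹' Metric.ball h r) := fun h r => by
    rcases le_or_gt r 0 with hr | hr
    · rw [Metric.ball_eq_empty.2 hr]
      exact MeasurableSet.empty
    have h1 : (fun p => (hm p).toLp) ⁻¹' Metric.ball h r
        = {p | ∫⁻ t, ‖F p t - h t‖ₑ ^ 2 ∂μ < ENNReal.ofReal (r ^ 2)} := by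
      ext p
      have h2 : (hm p).toLp - h = ((hm p).sub (Lp.memLp h)).toLp := by
        rw [MemLp.toLp_sub (hm p) (Lp.memLp h), Lp.toLp_coeFn]
      have h3 := ((hm p).sub (Lp.memLp h)).ofReal_norm_toLp_sq
      rw [Set.mem_preimage, Metric.mem_ball, dist_eq_norm, h2, Set.mem_ofPred_eq]
      simp only [Pi.sub_apply] at h3
      rw [← h3, ENNReal.ofReal_lt_ofReal_iff (by positivity),
        sq_lt_sq₀ (norm_nonneg _) hr.le]
    rw [h1]
    refine measurableSet_lt (Measurable.lintegral_prod_right' (f := fun q : Ω × T =>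
      ‖F q.1 q.2 - h q.2‖ₑ ^ 2) ?_) measurable_const
    exact ((hF.sub ((Lp.stronglyMeasurable h).measurable.comp measurable_snd)).enorm).pow_const 2
  refine Measurable.stronglyMeasurable (measurable_of_isOpen fun O hO => ?_)
  obtain ⟨S, hSc, hSO, hSU⟩ : ∃ S : Set (Lp ℂ 2 μ × ℝ), S.Countable ∧
      (∀ s ∈ S, Metric.ball s.1 s.2 ⊆ O) ∧ ⋃ s ∈ S, Metric.ball s.1 s.2 = O := by
    obtain ⟨S, hSI, hSc, hSU⟩ := TopologicalSpace.isOpen_biUnion_countable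
      {s : Lp ℂ 2 μ × ℝ | Metric.ball s.1 s.2 ⊆ O} (fun s => Metric.ball s.1 s.2)
      fun s _ => Metric.isOpen_ball
    refine ⟨S, hSc, fun s hs => hSI hs, hSU.trans (Set.Subset.antisymm
      (Set.iUnion₂_subset fun s hs => hs) fun x hx => ?_)⟩
    obtain ⟨ε, hε, hεO⟩ := Metric.isOpen_iff.1 hO x hx
    exact Set.mem_biUnion (x := (x, ε)) hεO (Metric.mem_ball_self hε)
  rw [← hSU, Set.preimage_iUnion₂]
  exact MeasurableSet.biUnion hSc fun s _ => hball s.1 s.2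

/-! ### Measurable dependence on ζ, and the bounds inherited along ≺. -/

namespace MetricLieAlgebra

variable {𝔤 : MetricLieAlgebra.{u}}

theorem measurable_wave {Ω : Type*} [MeasurableSpace Ω] {ζ : Ω → StrongDual ℝ 𝔤}
    (hζ : Measurable ζ) {β : ℝ → ℝ} (hβ : Measurable β) {r : Ω → ℝ} (hr : Measurable r)
    {e : Ω → ℕ → 𝔤} (he : ∀ j, Measurable fun p => e p j) (j : ℕ) {g : Ω → 𝔤} (hg : Measurable g) :
    Measurable fun p => wave (ζ p) β (r p) (e p) j (g p) := by
  have happ : ∀ {X : Ω → 𝔤}, Measurable X → Measurable fun p => ζ p (X p) := fun hX => by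
    have h : Continuous fun q : StrongDual ℝ 𝔤 × 𝔤 => q.1 q.2 := by fun_prop
    exact h.measurable.comp (hζ.prodMk hX)
  induction j generalizing g with
  | zero =>
    exact Complex.measurable_exp.comp (measurable_const.mul (Complex.measurable_ofReal.comp
      (happ hg)))
  | succ j ih =>
    simp only [wave_succ]
    have h1 : Measurable fun p => (inner ℝ (e p j) (g p) : ℝ) := (he j).inner hg
    refine Measurable.mul (Measurable.mul ?_ ?_) (ih ?_)
    · exact Complex.measurable_ofReal.comp (hβ.comp (h1.div hr))
    · exact Complex.measurable_exp.comp (measurable_const.mul (Complex.measurable_ofReal.comp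
        (h1.mul (happ (he j)))))
    · exact continuous_strip.measurable.comp ((he j).prodMk hg)

section

variable {n : ℕ} {b : Module.Basis (Fin n) ℝ 𝔤} {U : Set (StrongDual ℝ 𝔤)}
  {𝔪 : StrongDual ℝ 𝔤 → LieSubalgebra ℝ 𝔤}

theorem MeasurableFamily.measurableProj_polTower (h : MeasurableFamily U 𝔪) (j : ℕ) :
    MeasurableProj fun ζ : U => polTower b (𝔪 ζ) j :=
  MeasurableProj.sup (W := fun ζ : U => (𝔪 ζ).toSubmodule) h (MeasurableProj.const (flag b j))

theorem MeasurableFamily.measurable_polUnit (h : MeasurableFamily U 𝔪) (j : ℕ) :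
    Measurable fun ζ : U => polUnit b (𝔪 ζ) j :=
  (h.measurableProj_polTower j).unitPart measurable_const

theorem MeasurableFamily.measurableSet_cosetIndices_eq (h : MeasurableFamily U 𝔪)
    (S : Finset (Fin n)) : MeasurableSet {ζ : U | cosetIndices b (𝔪 ζ) = S} := by
  have h1 : {ζ : U | cosetIndices b (𝔪 ζ) = S}
      = ⋂ i : Fin n, {ζ : U | b i ∉ polTower b (𝔪 ζ) i ↔ i ∈ S} := by
    ext ζ
    simp [Finset.ext_iff, cosetIndices, polTower]
  rw [h1]
  refine MeasurableSet.iInter fun i => ?_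
  have h2 := (h.measurableProj_polTower (b := b) i).measurableSet_mem
    (measurable_const (a := b i))
  by_cases hi : i ∈ S
  · convert h2.compl using 1
    ext ζ
    simp [hi]
  · convert h2 using 1
    ext ζ
    simp [hi]

/-- The section depends on 𝔪 only through its index set, which takes finitely many values, each on a
measurable set. -/
theorem MeasurableFamily.measurable_cosetSection (h : MeasurableFamily U 𝔪) {k : ℕ}
    (hk : ∀ ζ ∈ U, (cosetIndices b (𝔪 ζ)).card = k) :
    Measurable fun p : U × (Fin k → ℝ) => cosetSection b (𝔪 p.1) p.2 := by
  classical
  let _ : MeasurableSpace (Finset (Fin n)) := ⊤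
  have : MeasurableSingletonClass (Finset (Fin n)) := ⟨fun _ => trivial⟩
  let G : Finset (Fin n) × (Fin k → ℝ) → 𝔤 := fun q =>
    if q.1.card = k then listSection ((q.1.sort (· ≤ ·)).map b) q.2 else 0
  have hG : Measurable G := by
    refine measurable_from_prod_countable_right fun S => ?_
    by_cases hS : S.card = k
    · simp only [G, if_pos hS]
      exact (contDiff_listSection _ (by simpa using hS)).continuous.measurable
    · simp only [G, if_neg hS]
      exact measurable_const
  have h1 : Measurable fun ζ : U => cosetIndices b (𝔪 ζ) :=
    measurable_to_countable' fun S => h.measurableSet_cosetIndices_eq S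
  have h2 : (fun p : U × (Fin k → ℝ) => cosetSection b (𝔪 p.1) p.2)
      = fun p => G (cosetIndices b (𝔪 p.1), p.2) := by
    funext p
    simp only [G, if_pos (hk p.1 p.1.2)]
    rw [cosetSection, listSection, List.zipWith_map_left]
  rw [h2]
  exact hG.comp ((h1.comp measurable_fst).prodMk measurable_snd)

end

/-! ### The relation `≺` -/

theorem exists_norm_lie_le (𝔫 : MetricLieAlgebra.{u}) :
    ∃ K : ℝ, 0 ≤ K ∧ ∀ X Y : 𝔫, ‖⁅X, Y⁆‖ ≤ K * ‖X‖ * ‖Y‖ := by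
  let Φ : 𝔫 →L[ℝ] 𝔫 →L[ℝ] 𝔫 := LinearMap.toContinuousLinearMap
    { toFun := adL
      map_add' := adL_add
      map_smul' := adL_smul }
  exact ⟨‖Φ‖, Φ.opNorm_nonneg, fun X Y => Φ.le_opNorm₂ X Y⟩

/-- In a quotient, lift both vectors isometrically into the orthogonal complement of the kernel,
take the bracket there and project, which does not increase the norm. A subalgebra inherits the
bound directly. -/
theorem Prec.isNilpotent_and_norm_lie_le {𝔫 𝔤 : MetricLieAlgebra.{u}} (h : Prec 𝔫 𝔤)
    (hnil : LieRing.IsNilpotent 𝔫) {K : ℝ}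
    (hK : ∀ X Y : 𝔫, ‖⁅X, Y⁆‖ ≤ K * ‖X‖ * ‖Y‖) :
    LieRing.IsNilpotent 𝔤 ∧ ∀ X Y : 𝔤, ‖⁅X, Y⁆‖ ≤ K * ‖X‖ * ‖Y‖ := by
  induction h with
  | refl => exact ⟨hnil, hK⟩
  | @quotient 𝔥 𝔤 _ Z hZ _ π hsurj hker hisom ih =>
    obtain ⟨h1, h2⟩ := ih
    refine ⟨hsurj.lieAlgebra_isNilpotent, fun X Y => ?_⟩
    have hπZ : π Z = 0 := (hker Z).2 (Submodule.mem_span_singleton_self Z)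
    have hlift : ∀ W : 𝔥, ∃ W' : 𝔥, π W' = π W ∧ ‖W'‖ = ‖π W‖ ∧ ‖W'‖ ≤ ‖W‖ := fun W => by
      set P := (Submodule.span ℝ {Z}).starProjection W with hP
      have hPm : P ∈ Submodule.span ℝ {Z} := Submodule.starProjection_apply_mem _ _
      have horth : (inner ℝ (W - P) Z : ℝ) = 0 := by
        rw [real_inner_comm]
        exact (Submodule.mem_orthogonal _ _).1 (Submodule.sub_starProjection_mem_orthogonal W) Z
          (Submodule.mem_span_singleton_self Z)
      have hπ : π (W - P) = π W := by rw [map_sub, (hker P).2 hPm, sub_zero]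
      refine ⟨W - P, hπ, ?_, ?_⟩
      · rw [← hisom _ horth, hπ]
      · obtain ⟨s, hs⟩ := Submodule.mem_span_singleton.1 hPm
        have h3 : (inner ℝ (W - P) P : ℝ) = 0 := by
          nth_rw 2 [← hs]
          rw [inner_smul_right, horth, mul_zero]
        have h4 := norm_add_sq_eq_norm_sq_add_norm_sq_of_inner_eq_zero (W - P) P h3
        rw [sub_add_cancel] at h4
        nlinarith [norm_nonneg (W - P), norm_nonneg W, norm_nonneg P]
    obtain ⟨x, rfl⟩ := hsurj X
    obtain ⟨y, rfl⟩ := hsurj Y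
    obtain ⟨x', hx1, hx2, -⟩ := hlift x
    obtain ⟨y', hy1, hy2, -⟩ := hlift y
    obtain ⟨w, -, hw2, hw3⟩ := hlift ⁅x', y'⁆
    rw [← hx1, ← hy1, ← LieHom.map_lie, ← hw2, hx1, hy1, ← hx2, ← hy2]
    exact hw3.trans (h2 x' y')
  | @subalgebra 𝔥 𝔤 _ X Y Z _ _ _ ι hisom _ _ ih =>
    obtain ⟨h1, h2⟩ := ih
    have hinj : Function.Injective ι := fun V W hVW => by
      rw [← sub_eq_zero, ← norm_eq_zero, ← hisom, map_sub, hVW, sub_self, norm_zero]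
    refine ⟨hinj.lieAlgebra_isNilpotent, fun V W => ?_⟩
    rw [← hisom, LieHom.map_lie, ← hisom V, ← hisom W]
    exact h2 _ _

end MetricLieAlgebra

/-! ### The coherent state at the scale ⟨‖ζ‖⟩^(-1/2) and the main theorem. -/

namespace MetricLieAlgebra

theorem japanese_pos (x : ℝ) : 0 < japanese x := Real.sqrt_pos.2 (by positivity)

theorem one_le_japanese (x : ℝ) : 1 ≤ japanese x :=
  Real.one_le_sqrt.2 (by nlinarith [sq_nonneg x])

theorem le_japanese (x : ℝ) : x ≤ japanese x :=
  Real.le_sqrt_of_sq_le (by linarith)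

variable {𝔤 : MetricLieAlgebra.{u}} {n : ℕ} (b : Module.Basis (Fin n) ℝ 𝔤) (k : ℕ)

/-- The normalized coherent state of a polarization at the scale `⟨ζ⟩^{-1/2}`. -/
def coherentState (β : ℝ → ℝ) (𝔪 : StrongDual ℝ 𝔤 → LieSubalgebra ℝ 𝔤) (ζ : StrongDual ℝ 𝔤)
    (g : 𝔤) : ℂ :=
  (‖toL2 b k (𝔪 ζ) (wave ζ β (japanese ‖ζ‖ ^ (-(1 / 2) : ℝ)) (polUnit b (𝔪 ζ)) n)‖⁻¹ : ℝ) *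
    wave ζ β (japanese ‖ζ‖ ^ (-(1 / 2) : ℝ)) (polUnit b (𝔪 ζ)) n g

variable {b k} {β : ℝ → ℝ} {L D : ℝ} {𝔪 : StrongDual ℝ 𝔤 → LieSubalgebra ℝ 𝔤}

theorem rightTranslate_zero (f : 𝔤 → ℂ) : rightTranslate 0 f = f :=
  funext fun W => by rw [rightTranslate, bch_zero]

section

variable [LieRing.IsNilpotent 𝔤] {ζ : StrongDual ℝ 𝔤}
  (hT : IsAdaptedTower b k (𝔪 ζ) (polTower b (𝔪 ζ)) (polUnit b (𝔪 ζ)) (basisSeq b))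
  (hβ : IsProfile β L D)
include hT hβ

/-- The scale r = ⟨‖ζ‖⟩^(-1/2) bounds both error sources, 1/r and ‖ζ‖r, by ⟨‖ζ‖⟩^(1/2). -/
theorem isCoherentOrbit_coherentState {K : ℝ} (hK0 : 0 ≤ K)
    (hK : ∀ X Y : 𝔤, ‖⁅X, Y⁆‖ ≤ K * ‖X‖ * ‖Y‖) (hiso : IsIsotropic ζ (𝔪 ζ).toSubmodule) :
    IsCoherentOrbit ζ (waveConst L K n * japanese ‖ζ‖ ^ (1 / 2 : ℝ) * D ^ n)
      (fun X => toL2 b k (𝔪 ζ) (rightTranslate X (coherentState b k β 𝔪 ζ))) := by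
  have hJ := one_le_japanese ‖ζ‖
  have hJ0 := japanese_pos ‖ζ‖
  refine hT.isCoherentOrbit hβ (r := japanese ‖ζ‖ ^ (-(1 / 2) : ℝ)) (by positivity) hK0 hK
    (Real.rpow_le_one_of_one_le_of_nonpos hJ (by norm_num)) ?_ ?_ hiso rfl
  · rw [Real.rpow_neg hJ0.le, one_div, inv_inv]
  · calc ‖ζ‖ * japanese ‖ζ‖ ^ (-(1 / 2) : ℝ)
        ≤ japanese ‖ζ‖ * japanese ‖ζ‖ ^ (-(1 / 2) : ℝ) := by gcongr; exact le_japanese _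
      _ = japanese ‖ζ‖ ^ (1 / 2 : ℝ) := by
        nth_rw 1 [← Real.rpow_one (japanese ‖ζ‖)]
        rw [← Real.rpow_add hJ0]
        norm_num

theorem isInducedVector_coherentState (hiso : IsIsotropic ζ (𝔪 ζ).toSubmodule) :
    IsInducedVector b k ζ (𝔪 ζ) (coherentState b k β 𝔪 ζ) where
  measurable := ((contDiff_wave hβ.contDiff n).continuous.measurable).const_mul _
  equivariant Y hY X := by
    rw [coherentState, coherentState, mul_left_comm]
    congr 1
    have hY' : Y ∈ polTower b (𝔪 ζ) 0 := by rw [hT.zero_eq]; exact hY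
    refine hT.towerProd_bch (fun X hX Y hY => ?_) n hY' (hT.mem_top X)
    rw [hT.zero_eq] at hX hY
    have h1 := map_bch_eq_add (𝔥 := (𝔪 ζ).toSubmodule) (fun X hX Y hY => (𝔪 ζ).lie_mem hX hY)
      (ζ : 𝔤 →ₗ[ℝ] ℝ) hiso hX hY
    simp only [ContinuousLinearMap.coe_coe] at h1
    rw [h1, ← Complex.exp_add]
    push_cast
    ring_nf
  memLp := by
    have hJ0 := japanese_pos ‖ζ‖
    have := ((hT.isSmoothFamily_wave hβ (ζ := ζ) (r := japanese ‖ζ‖ ^ (-(1 / 2) : ℝ))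
      (by positivity)).memLp (μ := volume) 0).const_mul
      ((‖toL2 b k (𝔪 ζ) (wave ζ β (japanese ‖ζ‖ ^ (-(1 / 2) : ℝ)) (polUnit b (𝔪 ζ)) n)‖⁻¹ : ℝ) : ℂ)
    simp only [bch_zero] at this
    exact this

end

theorem stronglyMeasurable_coherentState [LieRing.IsNilpotent 𝔤] {U : Set (StrongDual ℝ 𝔤)}
    (hT : ∀ ζ ∈ U, IsAdaptedTower b k (𝔪 ζ) (polTower b (𝔪 ζ)) (polUnit b (𝔪 ζ)) (basisSeq b))
    (hβ : IsProfile β L D) (hm : MeasurableFamily U 𝔪) :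
    StronglyMeasurable fun ζ : U => toL2 b k (𝔪 ζ) (coherentState b k β 𝔪 ζ) := by
  set r : StrongDual ℝ 𝔤 → ℝ := fun ζ => japanese ‖ζ‖ ^ (-(1 / 2) : ℝ) with hr
  have hr0 : ∀ ζ, 0 < r ζ := fun ζ => by have := japanese_pos ‖ζ‖; positivity
  have hmem : ∀ ζ : U, MemLp (fun t : Fin k → ℝ =>
      wave (ζ : StrongDual ℝ 𝔤) β (r ζ) (polUnit b (𝔪 ζ)) n (cosetSection b (𝔪 ζ) t)) 2 volume :=
    fun ζ => by
      have := ((hT ζ ζ.2).isSmoothFamily_wave hβ (ζ := (ζ : StrongDual ℝ 𝔤)) (hr0 ζ)).memLp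
        (μ := volume) 0
      simpa only [bch_zero] using this
  have hrm : Measurable r := by
    have h : Measurable fun ζ : StrongDual ℝ 𝔤 => japanese ‖ζ‖ :=
      ((measurable_norm.pow_const 2).const_add 1).sqrt
    exact h.pow_const _
  have hcard : ∀ ζ ∈ U, (cosetIndices b (𝔪 ζ)).card = k := fun ζ hζ => by
    rw [← (hT ζ hζ).length_eq, towerList_eq_map, ← sort_cosetIndices]
    simp
  have hF := measurable_wave (Ω := U × (Fin k → ℝ)) (ζ := fun p => (p.1 : StrongDual ℝ 𝔤))
    (measurable_subtype_coe.comp measurable_fst) hβ.contDiff.continuous.measurable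
    (r := fun p => r p.1) (hrm.comp (measurable_subtype_coe.comp measurable_fst))
    (e := fun p => polUnit b (𝔪 p.1)) (fun j => (hm.measurable_polUnit j).comp measurable_fst) n
    (hm.measurable_cosetSection hcard)
  have h1 := stronglyMeasurable_toLp hF hmem
  have h2 : (fun ζ : U => toL2 b k (𝔪 ζ) (coherentState b k β 𝔪 ζ))
      = fun ζ : U => ((‖(hmem ζ).toLp‖⁻¹ : ℝ) : ℂ) • (hmem ζ).toLp := by
    funext ζ
    have h3 : toL2 b k (𝔪 ζ) (wave (ζ : StrongDual ℝ 𝔤) β (r ζ) (polUnit b (𝔪 ζ)) n)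
        = (hmem ζ).toLp := dif_pos (hmem ζ)
    have h4 : toL2 b k (𝔪 ζ) (coherentState b k β 𝔪 ζ)
        = ((hmem ζ).const_smul ((‖toL2 b k (𝔪 ζ) (wave (ζ : StrongDual ℝ 𝔤) β (r ζ)
          (polUnit b (𝔪 ζ)) n)‖⁻¹ : ℝ) : ℂ)).toLp := dif_pos _
    rw [h4, h3]
    rfl
  rw [h2]
  exact (Complex.continuous_ofReal.comp_stronglyMeasurable h1.norm.measurable.inv.stronglyMeasurable).smul h1

end MetricLieAlgebra

end

open MetricLieAlgebra in
theorem mainTheorem2 (𝔫 : MetricLieAlgebra.{u}) (hnil : LieRing.IsNilpotent 𝔫)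
    (δ : ℝ) (hδ0 : 0 < δ) (hδ1 : δ < 1)
    (hδ : ∀ x : ℝ, |x| < δ →
      |Real.sin (2 * Real.pi * x)| ≤ 1 / 2 ^ (3 * Module.finrank ℝ 𝔫))
    (n : ℕ) (hn : n ≤ Module.finrank ℝ 𝔫) (c R : ℝ) (hc : 0 < c) (hR : 0 < R) :
    ∃ C : ℝ, 0 < C ∧
      ∀ (𝔤 : MetricLieAlgebra.{u}), Prec 𝔫 𝔤 →
      ∀ (b : Module.Basis (Fin n) ℝ 𝔤), IsStrongMalcev b →
      ∀ (d : Fin (n + 1) → ℕ) (k : ℕ), k = d (Fin.last n) / 2 →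
        (∃ 𝔪 : StrongDual ℝ 𝔤 → LieSubalgebra ℝ 𝔤,
          (∀ ζ ∈ orbitStratum b d, IsPolarizing ζ (𝔪 ζ)) ∧
          MeasurableFamily (orbitStratum b d) 𝔪) ∧
        ∀ 𝔪 : StrongDual ℝ 𝔤 → LieSubalgebra ℝ 𝔤,
          (∀ ζ ∈ orbitStratum b d, IsPolarizing ζ (𝔪 ζ)) →
          ∃ u v : StrongDual ℝ 𝔤 → 𝔤 → ℂ,
            (MeasurableFamily (orbitStratum b d) 𝔪 →
              StronglyMeasurable (fun ζ : orbitStratum b d => toL2 b k (𝔪 ζ) (u ζ)) ∧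
              StronglyMeasurable (fun ζ : orbitStratum b d => toL2 b k (𝔪 ζ) (v ζ))) ∧
            ∀ ζ ∈ orbitStratum b d,
              IsInducedVector b k ζ (𝔪 ζ) (u ζ) ∧ IsInducedVector b k ζ (𝔪 ζ) (v ζ) ∧
              IsSmoothVector b k (𝔪 ζ) (u ζ) ∧
              ‖toL2 b k (𝔪 ζ) (u ζ)‖ = 1 ∧ ‖toL2 b k (𝔪 ζ) (v ζ)‖ = 1 ∧
              ContDiff ℝ 1 (matrixCoeff b k (𝔪 ζ) (u ζ) (v ζ)) ∧
              groupC1Norm (matrixCoeff b k (𝔪 ζ) (u ζ) (v ζ)) ≤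
                ENNReal.ofReal (C * japanese ‖ζ‖) ∧
              ballC1Norm R (matrixCoeff b k (𝔪 ζ) (u ζ) (v ζ)) ≤
                ENNReal.ofReal (C * japanese ‖ζ‖) ∧
              ∀ ε : ℝ, ε = min (1 / 4) ((2 ^ (3 * n) * C * c) ^ (-(1 / 2) : ℝ)) →
                ∀ η : StrongDual ℝ 𝔤, ‖η - ζ‖ < ε⁻¹ * δ →
                ∀ φ : 𝔤 → ℝ, ContDiff ℝ ∞ φ → HasCompactSupport φ →
                  tsupport φ ⊆ Metric.ball 0 (ε * japanese ‖ζ‖ ^ (-(1 / 2) : ℝ)) →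
                  (∀ X, 0 ≤ φ X) →
                  (∫ X, φ X) / 2 ^ (3 * n) ≤
                    (∫ X, matrixCoeff b k (𝔪 ζ) (u ζ) (v ζ) X * (φ X : ℂ) *
                      Complex.exp (-(2 * Real.pi * Complex.I * η X))).re ∧
                  0 ≤ (∫ X, φ X) / 2 ^ (3 * n) := by
  obtain ⟨β, L, D, hβ⟩ := exists_isProfile
  obtain ⟨K, hK0, hK⟩ := exists_norm_lie_le 𝔫
  have hL0 : 0 ≤ L := (abs_nonneg _).trans (hβ.abs_deriv_le 0)
  have hD0 : 0 ≤ D := zero_le_one.trans hβ.one_le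
  set A : ℝ := waveConst L K n * D ^ n with hA
  have hA0 : 0 ≤ A := mul_nonneg (waveConst_nonneg hL0 hK0 n) (pow_nonneg hD0 n)
  have hpi := Real.pi_pos
  -- `C₁` serves the C¹ norms: 1 for the supremum, 2π for the eigenvalue, `A` for the error, and
  -- e^(KR) for the exponential chart.
  set C₁ : ℝ := 1 + (2 * Real.pi + A) * Real.exp (K * R) with hC₁
  -- `C₂` makes 2^(3n)Cc at least (2A)², so that the prescribed ε satisfies Aε ≤ 1/2. The constant ε
  -- shrinks as C grows, so enlarging C is harmless.
  set C₂ : ℝ := (2 * A) ^ 2 / (2 ^ (3 * n) * c) with hC₂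
  have hC₂0 : 0 ≤ C₂ := by positivity
  refine ⟨C₁ + C₂, by positivity, fun 𝔤 hprec b hb d k hk => ?_⟩
  obtain ⟨hnil', hK'⟩ := hprec.isNilpotent_and_norm_lie_le hnil hK
  refine ⟨⟨vergne hb, fun ζ _ => isPolarizing_vergne hb ζ, measurableFamily_vergne hb _⟩,
    fun 𝔪 h𝔪 => ⟨coherentState b k β 𝔪, coherentState b k β 𝔪, fun hm => ?_, fun ζ hζ => ?_⟩⟩
  · have hT : ∀ ζ ∈ orbitStratum b d, IsAdaptedTower b k (𝔪 ζ) (polTower b (𝔪 ζ))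
        (polUnit b (𝔪 ζ)) (basisSeq b) := fun ζ hζ =>
      (h𝔪 ζ hζ).isAdaptedTower hb (hk.trans (by rw [show orbitType b ζ = d from hζ]))
    exact ⟨stronglyMeasurable_coherentState hT hβ hm, stronglyMeasurable_coherentState hT hβ hm⟩
  have hT := (h𝔪 ζ hζ).isAdaptedTower hb (hk.trans (by rw [show orbitType b ζ = d from hζ]))
  have hind := isInducedVector_coherentState hT hβ (h𝔪 ζ hζ).1
  have horb := isCoherentOrbit_coherentState hT hβ hK0 hK' (h𝔪 ζ hζ).1
  set Φ : 𝔤 → Lp ℂ 2 (volume : Measure (Fin k → ℝ)) :=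
    fun X => toL2 b k (𝔪 ζ) (rightTranslate X (coherentState b k β 𝔪 ζ)) with hΦ
  have hΦ0 : toL2 b k (𝔪 ζ) (coherentState b k β 𝔪 ζ) = Φ 0 := by
    rw [hΦ]
    exact congrArg _ (rightTranslate_zero _).symm
  have hnorm : ‖toL2 b k (𝔪 ζ) (coherentState b k β 𝔪 ζ)‖ = 1 := by rw [hΦ0, horb.norm_eq]
  have hcoeff : matrixCoeff b k (𝔪 ζ) (coherentState b k β 𝔪 ζ) (coherentState b k β 𝔪 ζ)
      = fun X => inner ℂ (Φ 0) (Φ X) := by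
    funext X
    rw [matrixCoeff, hΦ0]
  have hJ := one_le_japanese ‖ζ‖
  have hJ0 := japanese_pos ‖ζ‖
  have hJsqrt : japanese ‖ζ‖ ^ (1 / 2 : ℝ) ≤ japanese ‖ζ‖ := by
    calc japanese ‖ζ‖ ^ (1 / 2 : ℝ) ≤ japanese ‖ζ‖ ^ (1 : ℝ) :=
          Real.rpow_le_rpow_of_exponent_le hJ (by norm_num)
      _ = _ := Real.rpow_one _
  have hAΛ : waveConst L K n * japanese ‖ζ‖ ^ (1 / 2 : ℝ) * D ^ n
      = A * japanese ‖ζ‖ ^ (1 / 2 : ℝ) := by rw [hA]; ring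
  rw [hAΛ] at horb
  have hexp : 1 ≤ Real.exp (K * R) := Real.one_le_exp (by positivity)
  have hderiv : 2 * Real.pi * ‖ζ‖ + A * japanese ‖ζ‖ ^ (1 / 2 : ℝ)
      ≤ (2 * Real.pi + A) * japanese ‖ζ‖ := by
    rw [add_mul]
    gcongr
    exact le_japanese _
  have hball : 1 + (2 * Real.pi * ‖ζ‖ + A * japanese ‖ζ‖ ^ (1 / 2 : ℝ)) * Real.exp (K * R)
      ≤ (C₁ + C₂) * japanese ‖ζ‖ := by
    calc _ ≤ 1 * japanese ‖ζ‖ + (2 * Real.pi + A) * japanese ‖ζ‖ * Real.exp (K * R) := by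
          gcongr
          linarith
      _ = C₁ * japanese ‖ζ‖ := by rw [hC₁]; ring
      _ ≤ _ := by gcongr; linarith
  rw [hcoeff]
  refine ⟨hind, hind, horb.contDiff, hnorm, hnorm,
    (horb.contDiff_inner _).of_le (by exact_mod_cast le_top),
    (horb.groupC1Norm_le (horb.norm_eq 0)).trans (ENNReal.ofReal_le_ofReal (le_trans ?_ hball)),
    (horb.ballC1Norm_le hK0 hK' R (horb.norm_eq 0)).trans (ENNReal.ofReal_le_ofReal hball),
    fun ε hε η hη φ hφ hφc hsupp hφ0 => ⟨?_, ?_⟩⟩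
  · have : 0 ≤ 2 * Real.pi * ‖ζ‖ + A * japanese ‖ζ‖ ^ (1 / 2 : ℝ) := by positivity
    nlinarith
  · have hC0 : 0 < 2 ^ (3 * n) * (C₁ + C₂) * c := by positivity
    have hε0 : 0 < ε := by
      rw [hε]
      exact lt_min (by norm_num) (by positivity)
    have hεC : ε ^ 2 * (2 ^ (3 * n) * (C₁ + C₂) * c) ≤ 1 := by
      have h1 : ε ≤ (2 ^ (3 * n) * (C₁ + C₂) * c) ^ (-(1 / 2) : ℝ) := by
        rw [hε]; exact min_le_right _ _
      calc ε ^ 2 * (2 ^ (3 * n) * (C₁ + C₂) * c)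
          ≤ ((2 ^ (3 * n) * (C₁ + C₂) * c) ^ (-(1 / 2) : ℝ)) ^ 2 *
            (2 ^ (3 * n) * (C₁ + C₂) * c) := by gcongr
        _ = 1 := by
          rw [← Real.rpow_natCast, ← Real.rpow_mul hC0.le]
          norm_num
          rw [Real.rpow_neg_one, inv_mul_cancel₀ hC0.ne']
    have hAε : A * ε ≤ 1 / 2 := by
      have h1 : (2 * A) ^ 2 ≤ 2 ^ (3 * n) * (C₁ + C₂) * c := by
        have h2 : (2 * A) ^ 2 = 2 ^ (3 * n) * C₂ * c := by
          rw [hC₂]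
          field_simp
        rw [h2]
        have hC₁0 : 0 ≤ C₁ := by positivity
        gcongr
        linarith
      have h3 : (2 * A * ε) ^ 2 ≤ 1 ^ 2 := by
        calc (2 * A * ε) ^ 2 = ε ^ 2 * (2 * A) ^ 2 := by ring
          _ ≤ ε ^ 2 * (2 ^ (3 * n) * (C₁ + C₂) * c) := by gcongr
          _ ≤ 1 ^ 2 := by simpa using hεC
      have := le_of_sq_le_sq h3 zero_le_one
      linarith
    refine horb.integral_re_ge (r := japanese ‖ζ‖ ^ (-(1 / 2) : ℝ)) ?_ hn hδ0 hδ hε0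
      (Real.rpow_le_one_of_one_le_of_nonpos hJ (by norm_num)) ?_ hη hφ.continuous hφc hsupp hφ0
    · rw [Module.finrank_eq_card_basis b, Fintype.card_fin]
    -- The growth ⟨‖ζ‖⟩^(1/2) of the eigenvector error cancels exactly against the radius of the
    -- support of φ.
    · have h1 : japanese ‖ζ‖ ^ (1 / 2 : ℝ) * japanese ‖ζ‖ ^ (-(1 / 2) : ℝ) = 1 := by
        rw [← Real.rpow_add hJ0]
        norm_num
      calc _ = A * ε * (japanese ‖ζ‖ ^ (1 / 2 : ℝ) * japanese ‖ζ‖ ^ (-(1 / 2) : ℝ)) := by ring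
        _ ≤ 1 / 2 := by rw [h1, mul_one]; exact hAε
  · exact div_nonneg (integral_nonneg hφ0) (by positivity)
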